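/- Let $\mathfrak c\ge 1$ be an integer and let $\tau:\{0,1,2,\dots\}\to[0,\infty)$ be non-decreasing with $\tau(n)\le n^{\mathfrak c}$ for all $n\ge 1$. For a group $G$ with finite generating set $S$, let $d_S$ be the word metric, let $\partial_S V$ (for $V\subseteq G$) be the set of elements of $V$ at $d_S$-distance one from $G\setminus V$, and let $\mathrm{F\o l}_{G,S}(n)$ be the least cardinality of a non-empty finite set $V\subseteq G$ with $\#\partial_S V/\#V\le 1/n$. Simple random walk $(W_k)$ on $(G,S)$, whose increments are independent and uniform in $S\cup S^{-1}$, is called cautious if for every $c>0$ $$\limsup_{n\to\infty}\ \mathbb P\Big(\max_{1\le k\le n} d_S(e,W_k)\le c\sqrt n\Big)>0 .$$ 1. There are a nilpotent group $N$ of class $\le\mathfrak c$, a semidirect product $G=N\rtimes\mathbb Z$, a finite generating set $S$ of $G$ and a constant $C>1$ such that $$C\,n\,\exp\big(Cn+\tau(n)\big)\ \ge\ \mathrm{F\o l}_{G,S}(n)\quad (n\ge 1),\qquad \mathrm{F\o l}_{G,S}(n)\ \ge\ \exp\Big(\tfrac1C\big(n+\tau(\lfloor n/C\rfloor)\big)\Big)\quad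 (n\ge 2).\qquad(*)$$ 2. Alternatively, $G$ can be taken to be a direct product: there are groups $G_i=N_i\rtimes\mathbb Z$ ($i=1,2$) with $N_i$ nilpotent of class $\le\mathfrak c$, with finite generating sets $S_i$ for which simple random walk on $(G_i,S_i)$ is cautious, and a constant $C>1$, such that $(*)$ holds for $G=G_1\times G_2$ and $S=(S_1\times\{e\})\cup(\{e\}\times S_2)$. 3. Such groups have Shalom's property $H_{\mathrm{FD}}$: if $G_1,G_2$ are groups with finite generating sets for which simple random walk is cautious, then $G_1$, $G_2$ and $G_1\times G_2$ have property $H_{\mathrm{FD}}$, that is, every orthogonal representation $\pi$ on a real Hilbert space whose reduced first cohomology $\overline H^1(\cdot,\pi)$ (cocycles modulo the pointwise closure of the coboundaries) is non-zero has a non-zero finite-dimensional subrepresentation. -/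

import Mathlib

universe u

/-- The letters that may be used in words over `S`: the elements of `S` and their inverses. -/
def genLetters {G : Type*} [Group G] (S : Finset G) : Set G :=
  {x | x ∈ S ∨ x⁻¹ ∈ S}

/-- The word length `l_S(g)`: the least length of a word in `S ∪ S⁻¹` that represents `g`
(only used for generating sets `S`). -/
noncomputable def wordLength {G : Type*} [Group G] (S : Finset G) (g : G) : ℕ :=
  sInf {n : ℕ | ∃ l : List G, l.length = n ∧ (∀ x ∈ l, x ∈ genLetters S) ∧ l.prod = g}

/-- The (left-invariant) word metric `d_S(g, h) = l_S(g⁻¹ h)`. -/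
noncomputable def wordDist {G : Type*} [Group G] (S : Finset G) (g h : G) : ℕ :=
  wordLength S (g⁻¹ * h)

/-- The boundary `∂_S V`: the elements of `V` at word distance one from the complement of `V`. -/
def wordBoundary {G : Type*} [Group G] (S : Finset G) (V : Set G) : Set G :=
  {v | v ∈ V ∧ ∃ w, w ∉ V ∧ wordDist S v w = 1}

/-- `F_{G,S}(ε)`: the least cardinality of a non-empty finite set `V` with `#∂_S V / #V ≤ ε`. -/
noncomputable def folnerMin {G : Type*} [Group G] (S : Finset G) (ε : ℝ) : ℕ :=
  sInf {m : ℕ | ∃ V : Finset G, V.Nonempty ∧ V.card = m ∧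
    ((wordBoundary S (V : Set G)).ncard : ℝ) / (V.card : ℝ) ≤ ε}

/-- The Følner function `Føl_{G,S}(n) = F_{G,S}(1/n)`. -/
noncomputable def folnerFunction {G : Type*} [Group G] (S : Finset G) (n : ℕ) : ℕ :=
  folnerMin S (1 / (n : ℝ))

/-- `S` is a finite generating set of `G`. -/
def Generates {G : Type*} [Group G] (S : Finset G) : Prop :=
  Subgroup.closure (S : Set G) = ⊤

/-- The two-sided estimate of the Følner function by `n + τ(n)`, with constant `C`.
`τ` is evaluated at the integer part of `n / C`. -/
def FolnerEstimate {G : Type*} [Group G] (S : Finset G) (τ : ℕ → ℝ) (C : ℝ) : Prop :=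
  (∀ n : ℕ, 1 ≤ n →
    (folnerFunction S n : ℝ) ≤ C * n * Real.exp (C * n + τ n)) ∧
  (∀ n : ℕ, 2 ≤ n →
    Real.exp (1 / C * (n + τ ⌊(n : ℝ) / C⌋₊)) ≤ (folnerFunction S n : ℝ))

/-- `N` is nilpotent of class at most `c`. -/
def NilpotentOfClassAtMost (N : Type*) [Group N] (c : ℕ) : Prop :=
  ∃ _ : Group.IsNilpotent N, Group.nilpotencyClass N ≤ c

/-- The generating set `(S₁ × {1}) ∪ ({1} × S₂)` of the direct product. -/
noncomputable def prodGenerators {G₁ G₂ : Type*} [Group G₁] [Group G₂]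
    (S₁ : Finset G₁) (S₂ : Finset G₂) : Finset (G₁ × G₂) :=
  letI := Classical.decEq (G₁ × G₂)
  (S₁ ×ˢ {1}) ∪ ({1} ×ˢ S₂)

/-- The possible increments of the first `n` steps of the simple random walk with respect to `S`.
The increments are independent and uniform in `S ∪ S⁻¹`, so the law is uniform on this set. -/
def walkIncrements {G : Type*} [Group G] (S : Finset G) (n : ℕ) : Set (Fin n → G) :=
  {w | ∀ i, w i ∈ genLetters S}

/-- The position `W_k = w₁ w₂ ⋯ w_k` of the walk with increments `w`. -/
def walkPosition {G : Type*} [Group G] {n : ℕ} (w : Fin n → G) (k : ℕ) : G :=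
  ((List.ofFn w).take k).prod

/-- The probability that `max_{1 ≤ k ≤ n} |W_k| ≤ r` for the simple random walk. -/
noncomputable def probConfined {G : Type*} [Group G] (S : Finset G) (n : ℕ) (r : ℝ) : ℝ :=
  (({w | w ∈ walkIncrements S n ∧
      ∀ k : ℕ, 1 ≤ k → k ≤ n → (wordLength S (walkPosition w k) : ℝ) ≤ r}.ncard : ℕ) : ℝ) /
    ((walkIncrements S n).ncard : ℝ)

/-- Simple random walk with respect to `S` is cautious (along an infinite subsequence). -/
def IsCautious {G : Type*} [Group G] (S : Finset G) : Prop :=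
  ∀ c : ℝ, 0 < c →
    0 < Filter.limsup (fun n : ℕ => probConfined S n (c * Real.sqrt n)) Filter.atTop

section Cohomology

variable {G : Type*} [Group G] {H : Type*} [NormedAddCommGroup H] [InnerProductSpace ℝ H]

/-- The space `Z¹(G, π)` of `1`-cocycles of an orthogonal representation. -/
def oneCocycles (π : G →* (H ≃ₗᵢ[ℝ] H)) : Submodule ℝ (G → H) where
  carrier := {b | ∀ g h : G, b (g * h) = b g + π g (b h)}
  add_mem' := by
    intro a b ha hb g h
    change ∀ g h, a (g * h) = a g + π g (a h) at ha
    change ∀ g h, b (g * h) = b g + π g (b h) at hb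
    simp only [Pi.add_apply, ha g h, hb g h, map_add]
    abel
  zero_mem' := by
    intro g h
    simp
  smul_mem' := by
    intro r b hb g h
    change ∀ g h, b (g * h) = b g + π g (b h) at hb
    simp [hb g h, smul_add]

/-- The space `B¹(G, π)` of `1`-coboundaries `g ↦ π(g) v - v`. -/
def oneCoboundaries (π : G →* (H ≃ₗᵢ[ℝ] H)) : Submodule ℝ (G → H) where
  carrier := {b | ∃ v : H, ∀ g : G, b g = π g v - v}
  add_mem' := by
    rintro a b ⟨v, hv⟩ ⟨w, hw⟩
    refine ⟨v + w, fun g => ?_⟩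
    simp only [Pi.add_apply, hv g, hw g, map_add]
    abel
  zero_mem' := ⟨0, fun g => by simp⟩
  smul_mem' := by
    rintro r b ⟨v, hv⟩
    refine ⟨r • v, fun g => ?_⟩
    simp [hv g, smul_sub]

/-- The reduced first cohomology, the quotient of `Z¹(G, π)` by the closure of `B¹(G, π)` in the
topology of pointwise convergence, is non-zero. -/
def ReducedCohomologyNonzero (π : G →* (H ≃ₗᵢ[ℝ] H)) : Prop :=
  ¬ oneCocycles π ≤ (oneCoboundaries π).topologicalClosure

/-- `π` has a non-zero finite-dimensional subrepresentation. -/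
def HasFiniteDimensionalSubrep (π : G →* (H ≃ₗᵢ[ℝ] H)) : Prop :=
  ∃ W : Submodule ℝ H, W ≠ ⊥ ∧ FiniteDimensional ℝ W ∧ ∀ g : G, ∀ x ∈ W, π g x ∈ W

end Cohomology

/-- Shalom's property `H_FD`: every orthogonal representation on a real Hilbert space with non-zero
reduced first cohomology has a non-zero finite-dimensional subrepresentation. -/
def PropertyHFD (G : Type) [Group G] : Prop :=
  ∀ (H : Type u) [NormedAddCommGroup H] [InnerProductSpace ℝ H] [CompleteSpace H]
    (π : G →* (H ≃ₗᵢ[ℝ] H)), ReducedCohomologyNonzero π → HasFiniteDimensionalSubrep π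

section
open Filter Topology RealInnerProductSpace Module.End

/-! ### Positive operators of finite trace and their top eigenspace -/

section CompactOperators

variable {H : Type*} [NormedAddCommGroup H] [InnerProductSpace ℝ H]

/-! The groups. Write `c = d + 1` and let `Q` be the dihedral group of order `2 ^ (d + 2)`, with two
involutions `a`, `b` such that the commutator `[a, b, ..., b]` with `d` entries `b` is non-trivial.
Inside a large power of `Q` take the subgroup generated by the integer translates of one family `e`.
Its class is at most that of `Q`, and together with the translation it is generated by two elements.
One coordinate of `e` only records the parity with which each generator was used (the lamps). All
others come in levels. Level `l` has a scale `n = n l` and `m ^ d` coordinates, `m = m l`, indexed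
by `v : Fin d → ℕ` with entries below `m`. In coordinate `v`, the values `a, b, ..., b` stand at `d
+ 1` places that encode `v`, at mutual distance at least `4 n`, repeated with period `10 n (d + 1)`;
all other values are `1`.

Two opposite effects result. Generators from a window shorter than `4 n` meet at most one
non-trivial value in any coordinate of the level, so the lamps already determine this level
(`lampSubgroup_apply_eq_one`). On the other hand, a `d`-fold commutator of generators at distance
`O(n)` is visible in exactly one coordinate of the level modulo its period, because only a complete
pattern gives a non-trivial commutator (`eq_of_forall_levelGen_ne_one`). Take `n` minimal with `2 ^
l ≤ τ n` and `m ≤ n` with `n * m ^ d` comparable to `2 ^ l`. The bound `τ n ≤ n ^ (d + 1)` makes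
this possible, except when `2 ^ l` is at most a multiple of `n`, where the linear term suffices.

Følner function. Lamps and cursor in an interval of length `4 N` form a Følner set. Its entropy is
linear in `N` plus the contribution of the levels of scale at most `N`, a geometric sum of powers of
two below `τ N`. Conversely, if many short elements each change exactly one of as many coordinates,
a set with small boundary contains a subset in which every point moves in a quarter of these
directions, so its cardinality is exponential (`two_pow_le_card_of_small_boundary`).

Caution. If the levels have a large gap in scale, then on the square-root time scale inside the gap
the walk sees the lamps and a fixed finite collection of coordinates, so its length is controlled by
the range of the cursor, a walk on `ℤ`. Distributing the levels alternately over two factors gives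
both factors arbitrarily large gaps and leaves every level in the product.

Property `H_FD`. Non-zero reduced cohomology yields a non-zero harmonic cocycle `b`. Without
finite-dimensional subrepresentations, matrix coefficients tend to zero in mean square along the
walk: otherwise a limit of averaged rank-one operators is a non-zero positive trace-class operator
whose top eigenspace is finite-dimensional and invariant. Then `‖b (W_k)‖ ^ 2 / k` concentrates at a
positive constant, whereas caution keeps it small with probability bounded below along a
subsequence. For a product of two groups, a Laplacian identity shows that each restriction of `b`
takes values fixed by the other factor, which reduces to one factor. -/

theorem inner_sq_le_of_positive {T : H →L[ℝ] H} (hsym : ∀ x y, ⟪T x, y⟫ = ⟪T y, x⟫)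
    (hpos : ∀ x, 0 ≤ ⟪T x, x⟫) (x y : H) : ⟪T x, y⟫ ^ 2 ≤ ⟪T x, x⟫ * ⟪T y, y⟫ := by
  have h : ∀ t : ℝ, 0 ≤ ⟪T y, y⟫ * (t * t) + (2 * ⟪T x, y⟫) * t + ⟪T x, x⟫ := by
    intro t
    have := hpos (x + t • y)
    simp only [map_add, map_smul, inner_add_left, inner_add_right, inner_smul_left,
      inner_smul_right, hsym y x, RCLike.conj_to_real] at this
    linarith
  have := discrim_le_zero h
  simp only [discrim] at this
  nlinarith

/-- Cauchy–Schwarz for the semi-inner product of `T`, with `y = T x`. It converts smallness of the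
quadratic form on a subspace into smallness of the operator norm there. -/
theorem norm_sq_apply_le_of_positive {T : H →L[ℝ] H} (hsym : ∀ x y, ⟪T x, y⟫ = ⟪T y, x⟫)
    (hpos : ∀ x, 0 ≤ ⟪T x, x⟫) (x : H) : ‖T x‖ ^ 2 ≤ ‖T‖ * ⟪T x, x⟫ := by
  have h := inner_sq_le_of_positive hsym hpos x (T x)
  rw [real_inner_self_eq_norm_sq] at h
  have h2 : ⟪T (T x), T x⟫ ≤ ‖T‖ * ‖T x‖ ^ 2 := by
    calc _ ≤ ‖T (T x)‖ * ‖T x‖ := real_inner_le_norm _ _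
      _ ≤ (‖T‖ * ‖T x‖) * ‖T x‖ := by gcongr; exact T.le_opNorm _
      _ = _ := by ring
  rcases eq_or_lt_of_le (norm_nonneg (T x)) with h0 | h0
  · rw [← h0]
    have := mul_nonneg (norm_nonneg T) (hpos x)
    simpa using this
  · have h3 : (‖T x‖ ^ 2) * ‖T x‖ ^ 2 ≤ (‖T‖ * ⟪T x, x⟫) * ‖T x‖ ^ 2 := by
      nlinarith [mul_le_mul_of_nonneg_left h2 (hpos x)]
    exact le_of_mul_le_mul_right h3 (by positivity)

/-- A positive operator of finite trace is compact. -/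
theorem isCompactOperator_of_trace_le [CompleteSpace H] {T : H →L[ℝ] H}
    (hsym : ∀ x y, ⟪T x, y⟫ = ⟪T y, x⟫)
    (hpos : ∀ x, 0 ≤ ⟪T x, x⟫) (C : ℝ)
    (htr : ∀ E : Finset H, Orthonormal ℝ ((↑) : E → H) → ∑ x ∈ E, ⟪T x, x⟫ ≤ C) :
    IsCompactOperator T := by
  classical
  have hcl : (T : H →L[ℝ] H) ∈ closure {S : H →L[ℝ] H | IsCompactOperator S} := by
    rw [Metric.mem_closure_iff]
    intro ε hε
    let A : Set ℝ := {t | ∃ E : Finset H, Orthonormal ℝ ((↑) : E → H) ∧ ∑ x ∈ E, ⟪T x, x⟫ = t}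
    have hne : A.Nonempty := ⟨0, ∅, by simp [Orthonormal], by simp⟩
    have hbd : BddAbove A := ⟨C, by rintro t ⟨E, hE, rfl⟩; exact htr E hE⟩
    -- An orthonormal `E` whose partial trace is within `δ` of the supremum leaves at most `δ` for
    -- any unit vector orthogonal to it. The choice of `δ` makes the restriction of `T` to that
    -- complement have norm at most `ε / 2`.
    set δ : ℝ := (ε / 2) ^ 2 / (‖T‖ + 1) with hδ
    have hT1 : 0 < ‖T‖ + 1 := by positivity
    have hδ0 : 0 < δ := by positivity
    obtain ⟨t, ⟨E, hE, rfl⟩, hlt⟩ := exists_lt_of_lt_csSup hne (sub_lt_self (sSup A) hδ0)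
    let U : Submodule ℝ H := Submodule.span ℝ (E : Set H)
    have hfd : FiniteDimensional ℝ U := FiniteDimensional.span_finset ℝ E
    have hunit : ∀ y ∈ Uᗮ, ‖y‖ = 1 → ⟪T y, y⟫ ≤ δ := by
      intro y hy hy1
      have hyE : ∀ x ∈ E, ⟪x, y⟫ = 0 := fun x hx =>
        (Submodule.mem_orthogonal U y).1 hy x (Submodule.subset_span hx)
      have hynot : y ∉ E := by
        intro h
        have := hyE y h
        rw [real_inner_self_eq_norm_sq, hy1] at this
        norm_num at this
      have hor : Orthonormal ℝ (Subtype.val : {x // x ∈ insert y E} → H) := by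
        constructor
        · rintro ⟨x, hx⟩
          rcases Finset.mem_insert.1 hx with rfl | hx
          · exact hy1
          · exact hE.1 ⟨x, hx⟩
        · rintro ⟨x, hx⟩ ⟨z, hz⟩ hxz
          have hxz' : x ≠ z := fun h => hxz (Subtype.ext h)
          rcases Finset.mem_insert.1 hx with rfl | hxE
          · rcases Finset.mem_insert.1 hz with h | hz
            · exact absurd h.symm hxz'
            · change ⟪x, z⟫ = 0
              rw [real_inner_comm]; exact hyE z hz
          · rcases Finset.mem_insert.1 hz with h | hz
            · subst h
              exact hyE x hxE
            · exact hE.2 (i := ⟨x, hxE⟩) (j := ⟨z, hz⟩) (fun h => hxz' (Subtype.ext_iff.1 h))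
      have := le_csSup hbd ⟨insert y E, hor, rfl⟩
      rw [Finset.sum_insert hynot] at this
      linarith
    have hperp : ∀ y ∈ Uᗮ, ⟪T y, y⟫ ≤ δ * ‖y‖ ^ 2 := by
      intro y hy
      rcases eq_or_ne y 0 with rfl | h0
      · simp
      have hn : ‖y‖ ≠ 0 := norm_ne_zero_iff.2 h0
      have := hunit (‖y‖⁻¹ • y) (Uᗮ.smul_mem _ hy) (by rw [norm_smul]; simp [hn])
      simp only [map_smul, inner_smul_left, inner_smul_right, RCLike.conj_to_real] at this
      have h2 : ‖y‖⁻¹ * (‖y‖⁻¹ * ⟪T y, y⟫) * ‖y‖ ^ 2 = ⟪T y, y⟫ := by field_simp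
      nlinarith [sq_nonneg ‖y‖]
    refine ⟨T ∘L U.starProjection, ?_, ?_⟩
    · have hfin : IsCompactOperator (U.orthogonalProjectionOnto : H →L[ℝ] U) :=
        haveI : ProperSpace U := FiniteDimensional.proper ℝ U
        isCompactOperator_of_locallyCompactSpace_dom U.orthogonalProjectionOnto
      exact hfin.clm_comp (T ∘L U.subtypeL)
    · rw [dist_eq_norm]
      refine lt_of_le_of_lt (ContinuousLinearMap.opNorm_le_bound _ (by positivity) ?_)
        (half_lt_self hε)
      intro x
      have hx : (T - T ∘L U.starProjection) x = T (x - U.starProjection x) := by simp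
      set y := x - U.starProjection x with hy
      have hyU : y ∈ Uᗮ := U.sub_starProjection_mem_orthogonal x
      have hyx : ‖y‖ ≤ ‖x‖ := by
        have h1 : y = Uᗮ.starProjection x := by
          rw [hy, Submodule.starProjection_orthogonal']; simp
        rw [h1]
        exact Uᗮ.norm_starProjection_apply_le x
      rw [hx]
      have h1 := norm_sq_apply_le_of_positive hsym hpos y
      have h2 := hperp y hyU
      have h3 : ‖T y‖ ^ 2 ≤ (ε / 2 * ‖x‖) ^ 2 := by
        calc ‖T y‖ ^ 2 ≤ ‖T‖ * (δ * ‖y‖ ^ 2) := h1.trans (by gcongr)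
          _ ≤ (‖T‖ + 1) * (δ * ‖x‖ ^ 2) := by gcongr; linarith
          _ = _ := by rw [hδ]; field_simp
      exact (sq_le_sq₀ (norm_nonneg _) (by positivity)).1 h3
  rwa [(isClosed_setOfPred_isCompactOperator (𝕜₁ := ℝ) (𝕜₂ := ℝ) (σ₁₂ := RingHom.id ℝ)
    (M₁ := H) (M₂ := H)).closure_eq] at hcl

/-- The top eigenspace of a positive compact operator that is preserved by the average of the
conjugations by isometries is preserved by these isometries. -/
theorem exists_finiteDimensional_invariant_of_average [CompleteSpace H] {T : H →L[ℝ] H}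
    (hsym : ∀ x y, ⟪T x, y⟫ = ⟪T y, x⟫) (hpos : ∀ x, 0 ≤ ⟪T x, x⟫)
    (hcomp : IsCompactOperator T) (hT : T ≠ 0) {ι : Type*} (L : Finset ι)
    (σ : ι → H ≃ₗᵢ[ℝ] H)
    (havg : ∀ x, ∑ i ∈ L, ⟪T (σ i x), σ i x⟫ = L.card * ⟪T x, x⟫) :
    ∃ W : Submodule ℝ H, W ≠ ⊥ ∧ FiniteDimensional ℝ W ∧ ∀ i ∈ L, ∀ x ∈ W, σ i x ∈ W := by
  have hTs : T.IsSymmetric := fun x y => by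
    change ⟪T x, y⟫ = ⟪x, T y⟫
    rw [hsym, real_inner_comm]
  have hn0 : ‖T‖ ≠ 0 := norm_ne_zero_iff.2 hT
  have hnt : Nontrivial H := by
    by_contra h
    rw [not_nontrivial_iff_subsingleton] at h
    exact hT (Subsingleton.elim _ _)
  have hray : ∀ x, 0 ≤ T.rayleighQuotient x := fun x => by
    rw [ContinuousLinearMap.rayleighQuotient, ContinuousLinearMap.reApplyInnerSelf_apply]
    have := hpos x
    simp only [RCLike.re_to_real]
    positivity
  -- Fredholm alternative at `‖T‖`: if this were in the resolvent set, the Rayleigh quotients would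
  -- stay a fixed distance below `‖T‖`, which is their supremum.
  have hev : HasEigenvalue (T : Module.End ℝ H) ‖T‖ := by
    rcases hcomp.hasEigenvalue_or_mem_resolventSet hn0 with h | h
    · exact h
    · exfalso
      obtain ⟨ε, hε, hle⟩ := T.rayleighQuotient_le_of_norm_mem_resolventSet (𝕜 := ℝ) h
      have h1 := T.norm_eq_iSup_rayleighQuotient hTs
      have h2 : (⨆ x, |T.rayleighQuotient x|) ≤ ‖T‖ - ε :=
        ciSup_le fun x => by rw [abs_of_nonneg (hray x)]; exact hle x
      linarith
  have hquad : ∀ x, ⟪T x, x⟫ ≤ ‖T‖ * ‖x‖ ^ 2 := fun x => by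
    calc _ ≤ ‖T x‖ * ‖x‖ := real_inner_le_norm _ _
      _ ≤ (‖T‖ * ‖x‖) * ‖x‖ := by gcongr; exact T.le_opNorm _
      _ = _ := by ring
  have hchar : ∀ x, ⟪T x, x⟫ = ‖T‖ * ‖x‖ ^ 2 → T x = ‖T‖ • x := by
    intro x hx
    have h1 : ‖T x - ‖T‖ • x‖ ^ 2 ≤ 0 := by
      rw [norm_sub_sq_real, inner_smul_right, hx, norm_smul, norm_norm]
      have := T.le_opNorm x
      nlinarith [norm_nonneg (T x), norm_nonneg T, norm_nonneg x,
        mul_nonneg (norm_nonneg T) (norm_nonneg x)]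
    have h2 : ‖T x - ‖T‖ • x‖ = 0 := by
      have := sq_nonneg ‖T x - ‖T‖ • x‖
      exact pow_eq_zero_iff (two_ne_zero) |>.1 (le_antisymm h1 this)
    exact sub_eq_zero.1 (norm_eq_zero.1 h2)
  refine ⟨eigenspace (T : Module.End ℝ H) ‖T‖, hev, ?_, ?_⟩
  · exact ContinuousLinearMap.finite_dimensional_eigenspace hcomp _ hn0
  · intro i hi x hx
    rw [mem_eigenspace_iff] at hx ⊢
    have hx' : T x = ‖T‖ • x := hx
    apply hchar
    have htop : ⟪T x, x⟫ = ‖T‖ * ‖x‖ ^ 2 := by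
      rw [hx', inner_smul_left, real_inner_self_eq_norm_sq]; simp
    have hle : ∀ j ∈ L, ⟪T (σ j x), σ j x⟫ ≤ ‖T‖ * ‖x‖ ^ 2 := fun j _ => by
      have := hquad (σ j x)
      rwa [LinearIsometryEquiv.norm_map] at this
    -- The average of the values at `σ j x` equals the maximal possible value, so every single value
    -- is maximal, and maximality characterises the eigenspace (`hchar`).
    have hsum : ∑ j ∈ L, ⟪T (σ j x), σ j x⟫ = ∑ j ∈ L, ‖T‖ * ‖x‖ ^ 2 := by
      rw [havg, htop, Finset.sum_const, nsmul_eq_mul]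
    rw [LinearIsometryEquiv.norm_map]
    exact (Finset.sum_eq_sum_iff_of_le hle).1 hsum i hi

end CompactOperators

end

section
open Filter Topology RealInnerProductSpace Module.End

/-! ### Markov operators and Cesàro means along the walk -/

section Markov

variable {G : Type*} [Group G]

/-- The Markov operator of the random walk with uniform steps in `L`. -/
noncomputable def markov (L : Finset G) : (G → ℝ) →ₗ[ℝ] (G → ℝ) where
  toFun f := fun g => (∑ s ∈ L, f (g * s)) / L.card
  map_add' f h := by
    ext g; simp only [Pi.add_apply, Finset.sum_add_distrib, add_div]
  map_smul' r f := by
    ext g; simp only [Pi.smul_apply, smul_eq_mul, ← Finset.mul_sum, mul_div_assoc, RingHom.id_apply]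

/-- The Markov operator of the walk that multiplies from the left. -/
noncomputable def leftMarkov (L : Finset G) (f : G → ℝ) : G → ℝ :=
  fun g => (∑ s ∈ L, f (s * g)) / L.card

theorem markov_apply (L : Finset G) (f : G → ℝ) (g : G) :
    markov L f g = (∑ s ∈ L, f (g * s)) / L.card := rfl

theorem markov_pow_succ (L : Finset G) (j : ℕ) (f : G → ℝ) :
    (markov L ^ (j + 1)) f = (markov L ^ j) (markov L f) := by
  rw [pow_succ, Module.End.mul_apply]

theorem markov_pow_succ' (L : Finset G) (j : ℕ) (f : G → ℝ) :
    (markov L ^ (j + 1)) f = markov L ((markov L ^ j) f) := by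
  rw [pow_succ', Module.End.mul_apply]

theorem markov_mono (L : Finset G) {f h : G → ℝ} (hfh : f ≤ h) : markov L f ≤ markov L h := by
  intro g
  rw [markov_apply, markov_apply]
  gcongr with s _
  exact hfh _

theorem markov_pow_mono (L : Finset G) (j : ℕ) {f h : G → ℝ} (hfh : f ≤ h) :
    (markov L ^ j) f ≤ (markov L ^ j) h := by
  induction j with
  | zero => simpa using hfh
  | succ j ih => rw [markov_pow_succ', markov_pow_succ']; exact markov_mono L ih

theorem markov_const {L : Finset G} (hL : L.Nonempty) (c : ℝ) :
    markov L (fun _ => c) = fun _ => c := by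
  have h : (L.card : ℝ) ≠ 0 := by exact_mod_cast hL.card_pos.ne'
  ext g
  rw [markov_apply, Finset.sum_const, nsmul_eq_mul]
  field_simp

theorem markov_pow_const {L : Finset G} (hL : L.Nonempty) (j : ℕ) (c : ℝ) :
    (markov L ^ j) (fun _ => c) = fun _ => c := by
  induction j with
  | zero => simp
  | succ j ih => rw [markov_pow_succ, markov_const hL, ih]

theorem markov_leftMarkov (L : Finset G) (f : G → ℝ) :
    markov L (leftMarkov L f) = leftMarkov L (markov L f) := by
  ext g
  simp only [markov_apply, leftMarkov]
  rw [← Finset.sum_div, ← Finset.sum_div, Finset.sum_comm]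
  simp only [mul_assoc]

theorem markov_pow_leftMarkov (L : Finset G) (j : ℕ) (f : G → ℝ) :
    (markov L ^ j) (leftMarkov L f) = leftMarkov L ((markov L ^ j) f) := by
  induction j generalizing f with
  | zero => simp
  | succ j ih => rw [markov_pow_succ, markov_leftMarkov, ih, markov_pow_succ]

/-- Left and right steps commute, and at the identity a left step is the same as a right step; hence
prefixing a step to the walk amounts to running it one step longer. -/
theorem markov_pow_leftMarkov_one (L : Finset G) (j : ℕ) (f : G → ℝ) :
    (markov L ^ j) (leftMarkov L f) 1 = (markov L ^ (j + 1)) f 1 := by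
  rw [markov_pow_leftMarkov, markov_pow_succ', markov_apply, leftMarkov]
  simp

/-- For symmetric steps, the inverse of the position of the walk has the law of the position. -/
theorem markov_pow_comp_inv {L : Finset G} (hinv : ∀ s ∈ L, s⁻¹ ∈ L) (j : ℕ) (f : G → ℝ) :
    (markov L ^ j) (fun g => f g⁻¹) 1 = (markov L ^ j) f 1 := by
  induction j generalizing f with
  | zero => simp
  | succ j ih =>
    have h : leftMarkov L (fun g => f g⁻¹) = fun g => markov L f g⁻¹ := by
      ext g
      simp only [leftMarkov, markov_apply]
      congr 1
      refine Finset.sum_nbij' (fun s => s⁻¹) (fun s => s⁻¹) hinv hinv ?_ ?_ ?_ <;> simp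
    rw [← markov_pow_leftMarkov_one, h, ih, ← markov_pow_succ]

/-- The Cesàro mean of the expectations of `f` at the first `k` positions of the walk. -/
noncomputable def cesaroMean (L : Finset G) (k : ℕ) : (G → ℝ) →ₗ[ℝ] ℝ where
  toFun f := (∑ j ∈ Finset.range k, (markov L ^ j) f 1) / k
  map_add' f h := by simp [Finset.sum_add_distrib, add_div]
  map_smul' r f := by simp [← Finset.mul_sum, mul_div_assoc]

theorem cesaroMean_apply (L : Finset G) (k : ℕ) (f : G → ℝ) :
    cesaroMean L k f = (∑ j ∈ Finset.range k, (markov L ^ j) f 1) / k := rfl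

theorem cesaroMean_mono (L : Finset G) (k : ℕ) {f h : G → ℝ} (hfh : f ≤ h) :
    cesaroMean L k f ≤ cesaroMean L k h := by
  rw [cesaroMean_apply, cesaroMean_apply]
  gcongr with j _
  exact markov_pow_mono L j hfh 1

theorem cesaroMean_const_le {L : Finset G} (hL : L.Nonempty) (k : ℕ) {c : ℝ} (hc : 0 ≤ c) :
    cesaroMean L k (fun _ => c) ≤ c := by
  rw [cesaroMean_apply]
  simp only [markov_pow_const hL, Finset.sum_const, Finset.card_range, nsmul_eq_mul]
  rcases Nat.eq_zero_or_pos k with rfl | hk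
  · simpa using hc
  · have : (k : ℝ) ≠ 0 := by positivity
    field_simp; exact le_rfl

theorem cesaroMean_nonneg (L : Finset G) (k : ℕ) {f : G → ℝ} (hf : 0 ≤ f) :
    0 ≤ cesaroMean L k f := by
  simpa using cesaroMean_mono L k hf

theorem abs_cesaroMean_le {L : Finset G} (hL : L.Nonempty) (k : ℕ) {f : G → ℝ} {c : ℝ}
    (hf : ∀ g, |f g| ≤ c) : |cesaroMean L k f| ≤ c := by
  have hc : 0 ≤ c := (abs_nonneg _).trans (hf 1)
  rw [abs_le]
  constructor
  · have h1 : cesaroMean L k (fun g => -f g) ≤ cesaroMean L k (fun _ => c) :=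
      cesaroMean_mono L k fun g => (neg_le_abs _).trans (hf g)
    have h2 : cesaroMean L k (fun g => -f g) = - cesaroMean L k f := map_neg (cesaroMean L k) f
    linarith [cesaroMean_const_le hL k hc]
  · have h1 : cesaroMean L k f ≤ cesaroMean L k (fun _ => c) :=
      cesaroMean_mono L k fun g => (le_abs_self _).trans (hf g)
    linarith [cesaroMean_const_le hL k hc]

/-- The difference of the two means telescopes to a bounded quantity divided by `k`. Thus limits of
Cesàro means are invariant under averaging over left translation by the steps. -/
theorem tendsto_cesaroMean_leftMarkov_sub {L : Finset G} (hL : L.Nonempty) {f : G → ℝ} {c : ℝ}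
    (hf : ∀ g, |f g| ≤ c) :
    Tendsto (fun k => cesaroMean L k (leftMarkov L f) - cesaroMean L k f) atTop (𝓝 0) := by
  have hc : 0 ≤ c := (abs_nonneg _).trans (hf 1)
  have hpow : ∀ k, |(markov L ^ k) f 1| ≤ c := by
    intro k
    rw [abs_le]
    constructor
    · have := markov_pow_mono L k (f := fun _ => -c) (h := f) (fun g => (abs_le.1 (hf g)).1) 1
      rwa [markov_pow_const hL] at this
    · have := markov_pow_mono L k (f := f) (h := fun _ => c) (fun g => (abs_le.1 (hf g)).2) 1
      rwa [markov_pow_const hL] at this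
  have heq : ∀ k : ℕ, cesaroMean L k (leftMarkov L f) - cesaroMean L k f
      = ((markov L ^ k) f 1 - f 1) / k := by
    intro k
    rw [cesaroMean_apply, cesaroMean_apply, ← sub_div, ← Finset.sum_sub_distrib]
    simp only [markov_pow_leftMarkov_one]
    rw [Finset.sum_range_sub (fun j => (markov L ^ j) f 1)]
    simp
  simp only [heq]
  refine squeeze_zero_norm (a := fun k : ℕ => (2 * c) / k) (fun k => ?_)
    (tendsto_const_div_atTop_nhds_zero_nat _)
  rw [norm_div, Real.norm_eq_abs, Real.norm_natCast]
  gcongr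
  have h1 := abs_le.1 (hpow k)
  have h2 := abs_le.1 (hf 1)
  rw [abs_le]
  constructor <;> linarith

end Markov

/-! ### Mean-square decay of matrix coefficients -/

section Ergodic

variable {G : Type*} [Group G] {H : Type*} [NormedAddCommGroup H] [InnerProductSpace ℝ H]

theorem hasFiniteDimensionalSubrep_of_generators (π : G →* (H ≃ₗᵢ[ℝ] H)) {L : Finset G}
    (hinv : ∀ s ∈ L, s⁻¹ ∈ L) (hgen : Subgroup.closure (L : Set G) = ⊤) {W : Submodule ℝ H}
    (hW : W ≠ ⊥) (hfin : FiniteDimensional ℝ W) (hWL : ∀ s ∈ L, ∀ x ∈ W, π s x ∈ W) :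
    HasFiniteDimensionalSubrep π := by
  refine ⟨W, hW, hfin, fun g => ?_⟩
  have hg : g ∈ Subgroup.closure (L : Set G) := hgen ▸ Subgroup.mem_top g
  suffices h : (∀ x ∈ W, π g x ∈ W) ∧ (∀ x ∈ W, π g⁻¹ x ∈ W) from h.1
  induction hg using Subgroup.closure_induction with
  | mem s hs => exact ⟨hWL s hs, hWL _ (hinv s hs)⟩
  | one => simp
  | mul a b _ _ ha hb =>
    constructor
    · intro x hx
      rw [map_mul]; exact ha.1 _ (hb.1 x hx)
    · intro x hx
      rw [mul_inv_rev, map_mul]; exact hb.2 _ (ha.2 x hx)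
  | inv a _ ha => exact ⟨ha.2, by simpa using ha.1⟩

theorem inner_map_inv (π : G →* (H ≃ₗᵢ[ℝ] H)) (g : G) (x y : H) :
    ⟪π g⁻¹ x, y⟫ = ⟪x, π g y⟫ := by
  rw [← (π g).inner_map_map (π g⁻¹ x) y]
  congr 1
  have : π g (π g⁻¹ x) = (π (g * g⁻¹)) x := by rw [map_mul]; rfl
  rw [this]; simp

/-- Without finite-dimensional subrepresentations, the matrix coefficients along the random walk
tend to zero in mean square. -/
theorem tendsto_cesaroMean_inner_sq [CompleteSpace H] {L : Finset G} (hL : L.Nonempty)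
    (hinv : ∀ s ∈ L, s⁻¹ ∈ L) (hgen : Subgroup.closure (L : Set G) = ⊤)
    (π : G →* (H ≃ₗᵢ[ℝ] H)) (hπ : ¬ HasFiniteDimensionalSubrep π) (u v : H) :
    Tendsto (fun k => cesaroMean L k (fun g => ⟪π g u, v⟫ ^ 2)) atTop (𝓝 0) := by
  by_contra hnot
  have hq0 : ∀ k (x : H), 0 ≤ cesaroMean L k (fun g => ⟪π g u, x⟫ ^ 2) := fun k x =>
    cesaroMean_nonneg L k fun g => sq_nonneg _
  obtain ⟨ε, hε, hfreq⟩ : ∃ ε > 0, ∃ᶠ k in atTop,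
      ε ≤ cesaroMean L k (fun g => ⟪π g u, v⟫ ^ 2) := by
    by_contra hcon
    push Not at hcon
    apply hnot
    rw [Metric.tendsto_nhds]
    intro ε hε
    filter_upwards [hcon ε hε] with k hk
    rw [Real.dist_eq, sub_zero, abs_of_nonneg (hq0 k v)]
    exact hk
  have hne : (atTop ⊓ 𝓟 {k : ℕ | ε ≤ cesaroMean L k (fun g => ⟪π g u, v⟫ ^ 2)}).NeBot :=
    frequently_mem_iff_neBot.1 hfreq
  -- An ultrafilter containing the times at which the mean is at least `ε`: all the forms `⟪π g u,
  -- x⟫ * ⟪π g u, y⟫` then have limits of their means simultaneously, and the limit form is non-zero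
  -- at `v`.
  let U := Ultrafilter.of (atTop ⊓ 𝓟 {k : ℕ | ε ≤ cesaroMean L k (fun g => ⟪π g u, v⟫ ^ 2)})
  have hU : (U : Filter ℕ) ≤ _ := Ultrafilter.of_le _
  have hUtop : (U : Filter ℕ) ≤ atTop := hU.trans inf_le_left
  have hUε : ∀ᶠ k in (U : Filter ℕ), ε ≤ cesaroMean L k (fun g => ⟪π g u, v⟫ ^ 2) :=
    hU (mem_inf_of_right (mem_principal_self _))
  have hbd : ∀ (x y : H) (g : G), |⟪π g u, x⟫ * ⟪π g u, y⟫| ≤ ‖u‖ ^ 2 * ‖x‖ * ‖y‖ := by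
    intro x y g
    rw [abs_mul]
    have h1 := abs_real_inner_le_norm (π g u) x
    have h2 := abs_real_inner_le_norm (π g u) y
    rw [LinearIsometryEquiv.norm_map] at h1 h2
    calc _ ≤ (‖u‖ * ‖x‖) * (‖u‖ * ‖y‖) := by gcongr
      _ = _ := by ring
  have hlim : ∀ x y : H, ∃ c : ℝ,
      Tendsto (fun k => cesaroMean L k (fun g => ⟪π g u, x⟫ * ⟪π g u, y⟫)) U (𝓝 c) := by
    intro x y
    have hc : IsCompact (Set.Icc (-(‖u‖ ^ 2 * ‖x‖ * ‖y‖)) (‖u‖ ^ 2 * ‖x‖ * ‖y‖)) := isCompact_Icc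
    obtain ⟨c, _, hc'⟩ := hc.ultrafilter_le_nhds
      (U.map (fun k => cesaroMean L k (fun g => ⟪π g u, x⟫ * ⟪π g u, y⟫))) (by
        rw [Ultrafilter.coe_map, le_principal_iff, mem_map]
        exact univ_mem' fun k => abs_le.1 (abs_cesaroMean_le hL k (hbd x y)))
    exact ⟨c, hc'⟩
  choose B hB using hlim
  have hBadd : ∀ x x' y, B (x + x') y = B x y + B x' y := by
    intro x x' y
    refine tendsto_nhds_unique (hB (x + x') y) (((hB x y).add (hB x' y)).congr fun k => ?_)
    rw [← map_add]
    congr 1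
    ext g
    simp only [Pi.add_apply, inner_add_right]; ring
  have hBsmul : ∀ (r : ℝ) x y, B (r • x) y = r * B x y := by
    intro r x y
    refine tendsto_nhds_unique (hB (r • x) y) (((hB x y).const_mul r).congr fun k => ?_)
    rw [← smul_eq_mul, ← map_smul]
    congr 1
    ext g
    simp only [Pi.smul_apply, inner_smul_right, smul_eq_mul]; ring
  have hBsymm : ∀ x y, B x y = B y x := by
    intro x y
    refine tendsto_nhds_unique (hB x y) ((hB y x).congr fun k => ?_)
    simp only [mul_comm]
  have hBle : ∀ x y, ‖B x y‖ ≤ ‖u‖ ^ 2 * ‖x‖ * ‖y‖ := by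
    intro x y
    refine le_of_tendsto (hB x y).norm (Eventually.of_forall fun k => ?_)
    exact abs_cesaroMean_le hL k (hbd x y)
  have hBpos : ∀ x, 0 ≤ B x x := by
    intro x
    refine ge_of_tendsto (hB x x) (Eventually.of_forall fun k => ?_)
    exact cesaroMean_nonneg L k fun g => mul_self_nonneg _
  let β : H →ₗ[ℝ] H →ₗ[ℝ] ℝ := LinearMap.mk₂ ℝ B hBadd hBsmul
    (fun x y y' => by rw [hBsymm, hBadd, hBsymm y, hBsymm y'])
    (fun r x y => by rw [hBsymm, hBsmul, hBsymm y]; rfl)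
  let T : H →L[ℝ] H := InnerProductSpace.continuousLinearMapOfBilin (𝕜 := ℝ)
    (β.mkContinuous₂ (‖u‖ ^ 2) hBle)
  have hTB : ∀ x y, ⟪T x, y⟫ = B x y := fun x y =>
    InnerProductSpace.continuousLinearMapOfBilin_apply (𝕜 := ℝ) _ x y
  have hsym : ∀ x y, ⟪T x, y⟫ = ⟪T y, x⟫ := fun x y => by rw [hTB, hTB, hBsymm]
  have hpos : ∀ x, 0 ≤ ⟪T x, x⟫ := fun x => by rw [hTB]; exact hBpos x
  -- Each averaged operator has rank one and trace at most `‖u‖ ^ 2` by Bessel's inequality; the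
  -- bound passes to the limit.
  have hcomp : IsCompactOperator T := by
    refine isCompactOperator_of_trace_le hsym hpos (‖u‖ ^ 2) fun E hE => ?_
    simp only [hTB]
    refine le_of_tendsto (tendsto_finsetSum E fun x _ => hB x x) (Eventually.of_forall fun k => ?_)
    rw [← map_sum]
    refine (cesaroMean_mono L k (h := fun _ => ‖u‖ ^ 2) fun g => ?_).trans
      (cesaroMean_const_le hL k (by positivity))
    have := hE.sum_inner_products_le (s := Finset.univ) (π g u)
    rw [LinearIsometryEquiv.norm_map] at this
    refine le_trans (le_of_eq ?_) this
    rw [Finset.sum_apply, ← Finset.sum_coe_sort E]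
    refine Finset.sum_congr rfl fun x _ => ?_
    rw [real_inner_comm, Real.norm_eq_abs, sq_abs, sq]
  have hT : T ≠ 0 := by
    intro h0
    have h1 : ε ≤ B v v := by
      refine ge_of_tendsto (hB v v) ?_
      filter_upwards [hUε] with k hk
      simpa only [sq] using hk
    rw [← hTB, h0] at h1
    simp at h1
    linarith
  -- Asymptotic left invariance of the means becomes invariance of `T` on average over conjugation
  -- by the steps; symmetry of `L` exchanges `s` with its inverse.
  have havg : ∀ x, ∑ s ∈ L, ⟪T (π s x), π s x⟫ = L.card * ⟪T x, x⟫ := by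
    intro x
    simp only [hTB]
    have hcard : (L.card : ℝ) ≠ 0 := by exact_mod_cast hL.card_pos.ne'
    have h1 : Tendsto (fun k => ∑ s ∈ L, cesaroMean L k
        (fun g => ⟪π g u, π s x⟫ * ⟪π g u, π s x⟫)) U (𝓝 (∑ s ∈ L, B (π s x) (π s x))) :=
      tendsto_finsetSum L fun s _ => hB _ _
    have h2 := ((tendsto_cesaroMean_leftMarkov_sub hL (hbd x x)).mono_left hUtop).add (hB x x)
    simp only [sub_add_cancel, zero_add] at h2
    have h3 := h2.const_mul (L.card : ℝ)
    refine tendsto_nhds_unique h1 (h3.congr fun k => ?_)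
    rw [← smul_eq_mul, ← map_smul, ← map_sum]
    congr 1
    ext g
    simp only [Pi.smul_apply, leftMarkov, smul_eq_mul, Finset.sum_apply]
    field_simp
    refine Finset.sum_nbij' (fun s => s⁻¹) (fun s => s⁻¹) hinv hinv (by simp) (by simp) ?_
    intro s _
    have : ⟪π (s * g) u, x⟫ = ⟪π g u, π s⁻¹ x⟫ := by
      rw [map_mul, real_inner_comm, real_inner_comm (π s⁻¹ x), inner_map_inv]
      rfl
    rw [this]
  obtain ⟨W, hW, hfin, hWL⟩ :=
    exists_finiteDimensional_invariant_of_average hsym hpos hcomp hT L (fun s => π s) havg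
  exact hπ (hasFiniteDimensionalSubrep_of_generators π hinv hgen hW hfin hWL)

end Ergodic

end

section
open Filter Topology RealInnerProductSpace Module.End

/-! ### Words, and the walk as a count of words -/

section Words

variable {G : Type*} [Group G]

theorem finite_genLetters (S : Finset G) : (genLetters S).Finite := by
  have : genLetters S ⊆ (S : Set G) ∪ (fun x => x⁻¹) '' (S : Set G) := by
    rintro x (hx | hx)
    · exact Or.inl hx
    · exact Or.inr ⟨x⁻¹, hx, inv_inv x⟩
  exact (S.finite_toSet.union (S.finite_toSet.image _)).subset this

/-- The set of letters as a finset. -/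
noncomputable def letterFinset (S : Finset G) : Finset G := (finite_genLetters S).toFinset

theorem mem_letterFinset {S : Finset G} {x : G} : x ∈ letterFinset S ↔ x ∈ genLetters S :=
  (finite_genLetters S).mem_toFinset

theorem inv_mem_genLetters {S : Finset G} {x : G} (hx : x ∈ genLetters S) :
    x⁻¹ ∈ genLetters S := by
  rcases hx with h | h
  · exact Or.inr (by simpa using h)
  · exact Or.inl h

theorem inv_mem_letterFinset {S : Finset G} : ∀ x ∈ letterFinset S, x⁻¹ ∈ letterFinset S := by
  intro x hx
  rw [mem_letterFinset] at hx ⊢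
  exact inv_mem_genLetters hx

theorem closure_letterFinset {S : Finset G} (hS : Generates S) :
    Subgroup.closure (letterFinset S : Set G) = ⊤ := by
  rw [eq_top_iff, ← hS]
  apply Subgroup.closure_mono
  intro x hx
  exact mem_letterFinset.2 (Or.inl hx)

theorem exists_list_of_mem_closure_letters {S : Finset G} {g : G}
    (hg : g ∈ Subgroup.closure (S : Set G)) :
    ∃ l : List G, (∀ x ∈ l, x ∈ genLetters S) ∧ l.prod = g := by
  induction hg using Subgroup.closure_induction with
  | mem s hs => exact ⟨[s], by simp only [List.mem_singleton, forall_eq]; exact Or.inl hs, by simp⟩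
  | one => exact ⟨[], by simp, rfl⟩
  | mul a b _ _ ha hb =>
    obtain ⟨l, hl, rfl⟩ := ha
    obtain ⟨l', hl', rfl⟩ := hb
    exact ⟨l ++ l', fun x hx => (List.mem_append.1 hx).elim (hl x) (hl' x), by simp⟩
  | inv a _ ha =>
    obtain ⟨l, hl, rfl⟩ := ha
    refine ⟨(l.map (·⁻¹)).reverse, fun x hx => ?_, (List.prod_inv_reverse l).symm⟩
    obtain ⟨y, hy, rfl⟩ := List.mem_map.1 (List.mem_reverse.1 hx)
    exact inv_mem_genLetters (hl y hy)

theorem exists_word {S : Finset G} (hS : Generates S) (g : G) :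
    ∃ l : List G, l.length = wordLength S g ∧ (∀ x ∈ l, x ∈ genLetters S) ∧ l.prod = g := by
  have hg : g ∈ Subgroup.closure (S : Set G) := hS ▸ Subgroup.mem_top g
  obtain ⟨l, hl, hp⟩ := exists_list_of_mem_closure_letters hg
  exact Nat.sInf_mem (s := {n : ℕ | ∃ l : List G, l.length = n ∧ (∀ x ∈ l, x ∈ genLetters S) ∧
    l.prod = g}) ⟨l.length, l, rfl, hl, hp⟩

theorem wordLength_le_length {S : Finset G} (l : List G) (hl : ∀ x ∈ l, x ∈ genLetters S) :
    wordLength S l.prod ≤ l.length := Nat.sInf_le ⟨l, rfl, hl, rfl⟩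

end Words

section Walk

variable {G : Type*} [Group G]

theorem ncard_walkIncrements_inter (S : Finset G) (n : ℕ) (P : (Fin n → G) → Prop)
    [DecidablePred P] :
    {w | w ∈ walkIncrements S n ∧ P w}.ncard =
      (Finset.univ.filter (fun w : Fin n → letterFinset S => P (fun i => w i))).card := by
  have h : {w | w ∈ walkIncrements S n ∧ P w} =
      (fun w : Fin n → letterFinset S => (fun i => (w i : G))) ''
        (Finset.univ.filter (fun w : Fin n → letterFinset S => P (fun i => w i)) : Finset _) := by
    ext w
    simp only [Set.mem_ofPred_eq, Finset.coe_filter, Finset.mem_univ, true_and, Set.mem_image]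
    constructor
    · rintro ⟨hw, hP⟩
      exact ⟨fun i => ⟨w i, mem_letterFinset.2 (hw i)⟩, hP, rfl⟩
    · rintro ⟨w', hP, rfl⟩
      exact ⟨fun i => mem_letterFinset.1 (w' i).2, hP⟩
  rw [h, Set.ncard_image_of_injective, Set.ncard_coe_finset]
  intro w w' hww
  ext i
  exact congrFun hww i

theorem ncard_walkIncrements (S : Finset G) (n : ℕ) :
    (walkIncrements S n).ncard = (letterFinset S).card ^ n := by
  have := ncard_walkIncrements_inter S n (fun _ => True)
  simpa using this

/-- Bridge between the two descriptions of the walk: powers of the Markov operator, and the counting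
measure on sequences of increments. -/
theorem card_pow_mul_markov_pow {L : Finset G} (hL : L.Nonempty) (n : ℕ) (f : G → ℝ) (g : G) :
    (L.card : ℝ) ^ n * (markov L ^ n) f g =
      ∑ w : Fin n → L, f (g * (List.ofFn (fun i => (w i : G))).prod) := by
  have hcard : (L.card : ℝ) ≠ 0 := by exact_mod_cast hL.card_pos.ne'
  induction n generalizing g with
  | zero => simp
  | succ n ih =>
    rw [markov_pow_succ', markov_apply, ← (Fin.consEquiv (fun _ => L)).sum_comp,
      Fintype.sum_prod_type, pow_succ]
    have : (L.card : ℝ) ^ n * L.card * ((∑ s ∈ L, (markov L ^ n) f (g * s)) / L.card) =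
        ∑ s ∈ L, (L.card : ℝ) ^ n * (markov L ^ n) f (g * s) := by
      rw [← Finset.mul_sum]; field_simp
    rw [this, ← Finset.sum_coe_sort L]
    refine Finset.sum_congr rfl fun s _ => ?_
    rw [ih]
    refine Finset.sum_congr rfl fun w _ => ?_
    simp [Fin.consEquiv, List.ofFn_succ, mul_assoc]

theorem walkPosition_self {n : ℕ} (w : Fin n → G) :
    walkPosition w n = (List.ofFn w).prod := by
  rw [walkPosition, List.take_of_length_le (by simp)]

open Classical in
-- Only the constraint at the final time `n` is kept.
theorem probConfined_le_markov {S : Finset G} (hL : (letterFinset S).Nonempty) {n : ℕ}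
    (hn : 1 ≤ n) (r : ℝ) :
    probConfined S n r ≤
      (markov (letterFinset S) ^ n) (fun g => if (wordLength S g : ℝ) ≤ r then 1 else 0) 1 := by
  have hcard : (0 : ℝ) < (letterFinset S).card := by exact_mod_cast hL.card_pos
  rw [probConfined, ncard_walkIncrements, ncard_walkIncrements_inter S n
    (fun w => ∀ k : ℕ, 1 ≤ k → k ≤ n → (wordLength S (walkPosition w k) : ℝ) ≤ r), Nat.cast_pow,
    div_le_iff₀' (by positivity), card_pow_mul_markov_pow hL]
  simp only [one_mul, Finset.sum_boole]
  norm_cast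
  apply Finset.card_le_card
  intro w hw
  simp only [Finset.mem_filter, Finset.mem_univ, true_and] at hw ⊢
  rw [← walkPosition_self]
  exact hw n hn le_rfl

theorem probConfined_nonneg (S : Finset G) (n : ℕ) (r : ℝ) : 0 ≤ probConfined S n r := by
  unfold probConfined; positivity

end Walk

/-! ### Concentration of harmonic cocycles -/

section Harmonic

variable {G : Type*} [Group G] {H : Type*} [NormedAddCommGroup H] [InnerProductSpace ℝ H]
  {π : G →* (H ≃ₗᵢ[ℝ] H)} {b : G → H}

theorem cocycle_one (hb : b ∈ oneCocycles π) : b 1 = 0 := by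
  have := hb 1 1
  simpa using this

theorem cocycle_inv (hb : b ∈ oneCocycles π) (g : G) : π g (b g⁻¹) = - b g := by
  have := hb g g⁻¹
  rw [mul_inv_cancel, cocycle_one hb] at this
  exact (neg_eq_of_add_eq_zero_right this.symm).symm

theorem norm_cocycle_prod_le (hb : b ∈ oneCocycles π) {S : Finset G} {C : ℝ}
    (hC : ∀ s ∈ genLetters S, ‖b s‖ ≤ C) (l : List G) (hl : ∀ x ∈ l, x ∈ genLetters S) :
    ‖b l.prod‖ ≤ C * l.length := by
  induction l with
  | nil => simp [cocycle_one hb]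
  | cons a l ih =>
    rw [List.prod_cons, hb a l.prod]
    have h1 := hC a (hl a List.mem_cons_self)
    have h2 := ih fun x hx => hl x (List.mem_cons_of_mem _ hx)
    calc _ ≤ ‖b a‖ + ‖π a (b l.prod)‖ := norm_add_le _ _
      _ ≤ C + C * l.length := by rw [LinearIsometryEquiv.norm_map]; gcongr
      _ = _ := by push_cast [List.length_cons]; ring

variable {L : Finset G}

theorem sum_inner_map_cocycle (hharm : ∑ s ∈ L, b s = 0) (g : G) (v : H) :
    ∑ s ∈ L, ⟪π g (b s), v⟫ = 0 := by
  rw [← sum_inner, ← map_sum, hharm]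
  simp

/-- Along the walk `b` is a martingale: harmonicity removes the cross term, and only the mean square
of the increments is added. -/
theorem markov_inner_sq (hL : L.Nonempty) (hb : b ∈ oneCocycles π) (hharm : ∑ s ∈ L, b s = 0)
    (v : H) : markov L (fun g => ⟪b g, v⟫ ^ 2) =
      (fun g => ⟪b g, v⟫ ^ 2) + (L.card : ℝ)⁻¹ • ∑ s ∈ L, fun g => ⟪π g (b s), v⟫ ^ 2 := by
  have hcard : (L.card : ℝ) ≠ 0 := by exact_mod_cast hL.card_pos.ne'
  ext g
  simp only [markov_apply, Pi.add_apply, Pi.smul_apply, Finset.sum_apply, smul_eq_mul]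
  have h : ∀ s ∈ L, ⟪b (g * s), v⟫ ^ 2 =
      ⟪b g, v⟫ ^ 2 + ⟪π g (b s), v⟫ ^ 2 + 2 * ⟪b g, v⟫ * ⟪π g (b s), v⟫ := by
    intro s _
    rw [hb g s, inner_add_left]; ring
  rw [Finset.sum_congr rfl h, Finset.sum_add_distrib, Finset.sum_add_distrib, ← Finset.mul_sum,
    sum_inner_map_cocycle hharm, Finset.sum_const, nsmul_eq_mul]
  field_simp
  ring

theorem markov_pow_inner_sq (hL : L.Nonempty) (hb : b ∈ oneCocycles π)
    (hharm : ∑ s ∈ L, b s = 0) (v : H) (k : ℕ) :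
    (markov L ^ k) (fun g => ⟪b g, v⟫ ^ 2) 1 =
      k * ((L.card : ℝ)⁻¹ * ∑ s ∈ L, cesaroMean L k (fun g => ⟪π g (b s), v⟫ ^ 2)) := by
  have h : ∀ k : ℕ, (markov L ^ k) (fun g => ⟪b g, v⟫ ^ 2) 1 = (L.card : ℝ)⁻¹ *
      ∑ s ∈ L, ∑ j ∈ Finset.range k, (markov L ^ j) (fun g => ⟪π g (b s), v⟫ ^ 2) 1 := by
    intro k
    induction k with
    | zero => simp [cocycle_one hb]
    | succ k ih =>
      rw [markov_pow_succ, markov_inner_sq hL hb hharm, map_add, map_smul, map_sum]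
      simp only [Pi.add_apply, Pi.smul_apply, Finset.sum_apply, smul_eq_mul, ih,
        Finset.sum_range_succ, Finset.sum_add_distrib]
      ring
  rcases Nat.eq_zero_or_pos k with rfl | hk
  · simp [cocycle_one hb]
  rw [h]
  have hk' : (k : ℝ) ≠ 0 := by positivity
  simp only [cesaroMean_apply, ← Finset.sum_div]
  field_simp

theorem tendsto_markov_pow_inner_sq_div [CompleteSpace H] (hL : L.Nonempty)
    (hinv : ∀ s ∈ L, s⁻¹ ∈ L) (hgen : Subgroup.closure (L : Set G) = ⊤)
    (hπ : ¬ HasFiniteDimensionalSubrep π) (hb : b ∈ oneCocycles π)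
    (hharm : ∑ s ∈ L, b s = 0) (v : H) :
    Tendsto (fun k : ℕ => (markov L ^ k) (fun g => ⟪b g, v⟫ ^ 2) 1 / k) atTop (𝓝 0) := by
  have h : Tendsto (fun k : ℕ => (L.card : ℝ)⁻¹ * ∑ s ∈ L,
      cesaroMean L k (fun g => ⟪π g (b s), v⟫ ^ 2)) atTop
      (𝓝 ((L.card : ℝ)⁻¹ * ∑ s ∈ L, 0)) :=
    (tendsto_finsetSum L fun s _ =>
      tendsto_cesaroMean_inner_sq hL hinv hgen π hπ (b s) v).const_mul _
  simp only [Finset.sum_const_zero, mul_zero] at h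
  refine h.congr' ?_
  filter_upwards [eventually_gt_atTop 0] with k hk
  have hk' : (k : ℝ) ≠ 0 := by positivity
  rw [markov_pow_inner_sq hL hb hharm]
  field_simp

/-- The mean square of the inner product of the position of the cocycle with its increment. -/
noncomputable def incrementCorrelation (L : Finset G) (π : G →* (H ≃ₗᵢ[ℝ] H)) (b : G → H) (g : G) :
    ℝ :=
  (L.card : ℝ)⁻¹ * ∑ s ∈ L, ⟪b g, π g (b s)⟫ ^ 2

/-- Since `π g⁻¹ (b g) = -b g⁻¹`, the correlation with the next increment is, up to sign, `⟪b g⁻¹, b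
s⟫`. Inversion preserves the law of the walk, so this reduces to fixed vectors `b s`. -/
theorem tendsto_incrementCorrelation [CompleteSpace H] (hL : L.Nonempty)
    (hinv : ∀ s ∈ L, s⁻¹ ∈ L) (hgen : Subgroup.closure (L : Set G) = ⊤)
    (hπ : ¬ HasFiniteDimensionalSubrep π) (hb : b ∈ oneCocycles π) (hharm : ∑ s ∈ L, b s = 0) :
    Tendsto (fun k : ℕ => (markov L ^ k) (incrementCorrelation L π b) 1 / k) atTop (𝓝 0) := by
  have h : Tendsto (fun k : ℕ => (L.card : ℝ)⁻¹ * ∑ s ∈ L,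
      (markov L ^ k) (fun g => ⟪b g, b s⟫ ^ 2) 1 / k) atTop (𝓝 ((L.card : ℝ)⁻¹ * ∑ s ∈ L, 0)) :=
    (tendsto_finsetSum L fun s _ =>
      tendsto_markov_pow_inner_sq_div hL hinv hgen hπ hb hharm (b s)).const_mul _
  simp only [Finset.sum_const_zero, mul_zero] at h
  refine h.congr fun k => ?_
  have h1 : incrementCorrelation L π b = fun g =>
      ((L.card : ℝ)⁻¹ • ∑ s ∈ L, fun g => ⟪b g, b s⟫ ^ 2) g⁻¹ := by
    ext g
    simp only [incrementCorrelation, Pi.smul_apply, Finset.sum_apply, smul_eq_mul]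
    congr 1
    refine Finset.sum_congr rfl fun s _ => ?_
    rw [← inner_map_inv]
    have := cocycle_inv hb g⁻¹
    rw [inv_inv] at this
    rw [this, inner_neg_left, neg_sq]
  rw [h1, markov_pow_comp_inv hinv, map_smul, map_sum]
  simp only [Pi.smul_apply, Finset.sum_apply, smul_eq_mul, ← Finset.sum_div]
  ring

theorem sum_norm_sq_sum_inner (hb : b ∈ oneCocycles π) (g s : G) :
    ‖b (g * s)‖ ^ 2 = ‖b g‖ ^ 2 + ‖b s‖ ^ 2 + 2 * ⟪b g, π g (b s)⟫ := by
  rw [hb g s, norm_add_sq_real, LinearIsometryEquiv.norm_map]; ring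

/-- The mean of `‖b‖ ^ p` over the steps. -/
noncomputable def stepMoment (L : Finset G) (b : G → H) (p : ℕ) : ℝ :=
  (L.card : ℝ)⁻¹ * ∑ s ∈ L, ‖b s‖ ^ p

theorem sum_inner_cocycle_map (hharm : ∑ s ∈ L, b s = 0) (g : G) (v : H) :
    ∑ s ∈ L, ⟪v, π g (b s)⟫ = 0 := by
  simp only [real_inner_comm _ v]
  exact sum_inner_map_cocycle hharm g v

theorem markov_norm_sq (hL : L.Nonempty) (hb : b ∈ oneCocycles π) (hharm : ∑ s ∈ L, b s = 0) :
    markov L (fun g => ‖b g‖ ^ 2) =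
      (fun g => ‖b g‖ ^ 2) + fun _ => stepMoment L b 2 := by
  have hcard : (L.card : ℝ) ≠ 0 := by exact_mod_cast hL.card_pos.ne'
  ext g
  rw [markov_apply]
  simp only [sum_norm_sq_sum_inner hb, Finset.sum_add_distrib, ← Finset.mul_sum,
    sum_inner_cocycle_map hharm, Finset.sum_const, nsmul_eq_mul, Pi.add_apply, stepMoment]
  field_simp
  ring

theorem markov_pow_norm_sq (hL : L.Nonempty) (hb : b ∈ oneCocycles π)
    (hharm : ∑ s ∈ L, b s = 0) (k : ℕ) :
    (markov L ^ k) (fun g => ‖b g‖ ^ 2) 1 = k * stepMoment L b 2 := by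
  induction k with
  | zero => simp [cocycle_one hb]
  | succ k ih =>
    rw [markov_pow_succ, markov_norm_sq hL hb hharm, map_add, markov_pow_const hL, Pi.add_apply, ih]
    push_cast; ring

/-- Square `‖b g‖ ^ 2 + ‖b s‖ ^ 2 + 2 * q`, `q = ⟪b g, π g (b s)⟫`. The term in `‖b g‖ ^ 2 * q`
averages to zero by harmonicity and `4 * ‖b s‖ ^ 2 * q` is split by the arithmetic-geometric mean,
whence the constants `3` and `6`. -/
theorem markov_norm_pow_four_le (hL : L.Nonempty) (hb : b ∈ oneCocycles π)
    (hharm : ∑ s ∈ L, b s = 0) :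
    markov L (fun g => (‖b g‖ ^ 2) ^ 2) ≤
      (fun g => (‖b g‖ ^ 2) ^ 2) + (2 * stepMoment L b 2) • (fun g => ‖b g‖ ^ 2) +
      (fun _ => 3 * stepMoment L b 4) + (6 : ℝ) • incrementCorrelation L π b := by
  have hcard : (L.card : ℝ) ≠ 0 := by exact_mod_cast hL.card_pos.ne'
  have hcard' : (0 : ℝ) < L.card := by exact_mod_cast hL.card_pos
  intro g
  rw [markov_apply, div_le_iff₀ hcard']
  have h : ∀ s ∈ L, (‖b (g * s)‖ ^ 2) ^ 2 ≤ (‖b g‖ ^ 2) ^ 2 + 2 * ‖b g‖ ^ 2 * ‖b s‖ ^ 2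
      + 3 * ‖b s‖ ^ 4 + 6 * ⟪b g, π g (b s)⟫ ^ 2 + 4 * ‖b g‖ ^ 2 * ⟪b g, π g (b s)⟫ := by
    intro s _
    rw [sum_norm_sq_sum_inner hb]
    nlinarith [sq_nonneg (‖b s‖ ^ 2 - ⟪b g, π g (b s)⟫)]
  refine (Finset.sum_le_sum h).trans (le_of_eq ?_)
  simp only [Finset.sum_add_distrib, ← Finset.mul_sum, sum_inner_cocycle_map hharm,
    Finset.sum_const, nsmul_eq_mul, Pi.add_apply, Pi.smul_apply, smul_eq_mul, stepMoment,
    incrementCorrelation]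
  field_simp
  ring

theorem markov_pow_norm_pow_four_le (hL : L.Nonempty) (hb : b ∈ oneCocycles π)
    (hharm : ∑ s ∈ L, b s = 0) (k : ℕ) :
    (markov L ^ k) (fun g => (‖b g‖ ^ 2) ^ 2) 1 ≤ (k * stepMoment L b 2) ^ 2 +
      3 * stepMoment L b 4 * k +
      6 * ∑ j ∈ Finset.range k, (markov L ^ j) (incrementCorrelation L π b) 1 := by
  induction k with
  | zero => simp [cocycle_one hb]
  | succ k ih =>
    rw [markov_pow_succ]
    refine (markov_pow_mono L k (markov_norm_pow_four_le hL hb hharm) 1).trans ?_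
    rw [map_add, map_add, map_add, map_smul, map_smul, markov_pow_const hL]
    simp only [Pi.add_apply, Pi.smul_apply, smul_eq_mul, markov_pow_norm_sq hL hb hharm,
      Finset.sum_range_succ]
    push_cast
    nlinarith [sq_nonneg (stepMoment L b 2)]

/-- The leading term of the fourth moment is the square of the mean of `‖b‖ ^ 2` and cancels; what
remains is linear in time apart from the increment correlations. -/
theorem markov_pow_variance_le (hL : L.Nonempty) (hb : b ∈ oneCocycles π)
    (hharm : ∑ s ∈ L, b s = 0) (k : ℕ) :
    (markov L ^ k) (fun g => (‖b g‖ ^ 2 - k * stepMoment L b 2) ^ 2) 1 ≤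
      3 * stepMoment L b 4 * k +
      6 * ∑ j ∈ Finset.range k, (markov L ^ j) (incrementCorrelation L π b) 1 := by
  have h : (fun g => (‖b g‖ ^ 2 - k * stepMoment L b 2) ^ 2) =
      (fun g => (‖b g‖ ^ 2) ^ 2) - (2 * (k * stepMoment L b 2)) • (fun g => ‖b g‖ ^ 2) +
      fun _ => (k * stepMoment L b 2) ^ 2 := by
    ext g
    simp only [Pi.add_apply, Pi.sub_apply, Pi.smul_apply, smul_eq_mul]; ring
  rw [h, map_add, map_sub, map_smul, markov_pow_const hL]
  simp only [Pi.add_apply, Pi.sub_apply, Pi.smul_apply, smul_eq_mul,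
    markov_pow_norm_sq hL hb hharm]
  have := markov_pow_norm_pow_four_le hL hb hharm k
  linarith

/-- Sums of terms that are `o(k)` are `o(n ^ 2)`, by comparison with the Cesàro means of `x k / k`.
-/
theorem tendsto_sum_range_div_sq {x : ℕ → ℝ} (hx : ∀ k, 0 ≤ x k) (hx0 : x 0 = 0)
    (h : Tendsto (fun k : ℕ => x k / k) atTop (𝓝 0)) :
    Tendsto (fun n : ℕ => (∑ k ∈ Finset.range n, x k) / (n : ℝ) ^ 2) atTop (𝓝 0) := by
  refine squeeze_zero (fun n => div_nonneg (Finset.sum_nonneg fun k _ => hx k) (by positivity))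
    (fun n => ?_) h.cesaro
  rcases Nat.eq_zero_or_pos n with rfl | hn
  · simp
  have hn' : (n : ℝ) ≠ 0 := by positivity
  have hcancel : ∀ y : ℝ, (n : ℝ)⁻¹ * y * (n : ℝ) ^ 2 = y * n := fun y => by field_simp
  rw [div_le_iff₀ (by positivity), hcancel, Finset.sum_mul]
  refine Finset.sum_le_sum fun k hk => ?_
  rcases Nat.eq_zero_or_pos k with rfl | hk0
  · simp [hx0]
  have hk' : (0 : ℝ) < k := by positivity
  rw [div_mul_eq_mul_div, le_div_iff₀ hk']
  have : (k : ℝ) ≤ n := by exact_mod_cast (Finset.mem_range.1 hk).le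
  exact mul_le_mul_of_nonneg_left this (hx k)

/-- Concentration of a harmonic cocycle along the walk. -/
theorem tendsto_markov_pow_variance_div [CompleteSpace H] (hL : L.Nonempty)
    (hinv : ∀ s ∈ L, s⁻¹ ∈ L) (hgen : Subgroup.closure (L : Set G) = ⊤)
    (hπ : ¬ HasFiniteDimensionalSubrep π) (hb : b ∈ oneCocycles π) (hharm : ∑ s ∈ L, b s = 0) :
    Tendsto (fun k : ℕ => (markov L ^ k) (fun g => (‖b g‖ ^ 2 - k * stepMoment L b 2) ^ 2) 1 /
      (k : ℝ) ^ 2) atTop (𝓝 0) := by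
  have hc : ∀ k, 0 ≤ (markov L ^ k) (incrementCorrelation L π b) 1 := fun k => by
    have := markov_pow_mono L k (f := 0) (h := incrementCorrelation L π b)
      (fun g => by simp only [incrementCorrelation, Pi.zero_apply]; positivity) 1
    simpa using this
  have h1 := (tendsto_sum_range_div_sq hc (by simp [incrementCorrelation, cocycle_one hb])
    (tendsto_incrementCorrelation hL hinv hgen hπ hb hharm)).const_mul 6
  have h2 := (tendsto_const_div_atTop_nhds_zero_nat (3 * stepMoment L b 4)).add h1
  simp only [mul_zero, add_zero] at h2
  refine squeeze_zero (fun k => ?_) (fun k => ?_) h2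
  · refine div_nonneg ?_ (by positivity)
    have := markov_pow_mono L k (f := 0)
      (h := fun g => (‖b g‖ ^ 2 - k * stepMoment L b 2) ^ 2) (fun g => sq_nonneg _) 1
    simpa using this
  · rcases Nat.eq_zero_or_pos k with rfl | hk
    · simp
    have hk' : (0 : ℝ) < k := by positivity
    rw [div_le_iff₀ (by positivity)]
    refine (markov_pow_variance_le hL hb hharm k).trans (le_of_eq ?_)
    field_simp

theorem cocycle_eq_zero_of_letters {S : Finset G} (hS : Generates S) (hb : b ∈ oneCocycles π)
    (h : ∀ s ∈ genLetters S, b s = 0) : b = 0 := by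
  ext g
  obtain ⟨l, -, hl, rfl⟩ := exists_word hS g
  have := norm_cocycle_prod_le hb (C := 0) (fun s hs => by simp [h s hs]) l hl
  rw [zero_mul] at this
  simpa using this

/-- A non-zero harmonic cocycle of a group with cautious simple random walk lives in a
representation with a finite-dimensional subrepresentation. -/
theorem hasFiniteDimensionalSubrep_of_harmonic [CompleteSpace H] {S : Finset G}
    (hS : Generates S) (hcaut : IsCautious S) (hb : b ∈ oneCocycles π)
    (hharm : ∑ s ∈ letterFinset S, b s = 0) (hne : b ≠ 0) : HasFiniteDimensionalSubrep π := by
  classical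
  by_contra hπ
  set L := letterFinset S with hLdef
  obtain ⟨s₀, hs₀, hbs₀⟩ : ∃ s ∈ genLetters S, b s ≠ 0 := by
    by_contra hcon
    push Not at hcon
    exact hne (cocycle_eq_zero_of_letters hS hb hcon)
  have hs₀L : s₀ ∈ L := mem_letterFinset.2 hs₀
  have hL : L.Nonempty := ⟨s₀, hs₀L⟩
  have hcard' : (0 : ℝ) < L.card := by exact_mod_cast hL.card_pos
  set σ := stepMoment L b 2 with hσ
  have hσ0 : 0 < σ := by
    rw [hσ, stepMoment]
    refine mul_pos (by positivity) (Finset.sum_pos' (fun s _ => by positivity) ⟨s₀, hs₀L, ?_⟩)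
    have := norm_pos_iff.2 hbs₀
    positivity
  set Λ := ∑ s ∈ L, ‖b s‖ with hΛ
  have hΛ0 : 0 ≤ Λ := Finset.sum_nonneg fun _ _ => norm_nonneg _
  have hΛb : ∀ s ∈ genLetters S, ‖b s‖ ≤ Λ := fun s hs =>
    Finset.single_le_sum (f := fun s => ‖b s‖) (fun _ _ => norm_nonneg _) (mem_letterFinset.2 hs)
  have hlen : ∀ g, ‖b g‖ ≤ Λ * wordLength S g := by
    intro g
    obtain ⟨l, hl, hlS, rfl⟩ := exists_word hS g
    rw [← hl]
    exact norm_cocycle_prod_le hb hΛb l hlS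
  -- Confinement to the ball of radius `c * √n` now forces `‖b‖ ^ 2 ≤ σ * n / 2`, half of the value
  -- `σ * n` at which `‖b‖ ^ 2` concentrates.
  set c := Real.sqrt (σ / 2) / (Λ + 1) with hc
  have hc0 : 0 < c := by positivity
  have hcσ : (Λ * c) ^ 2 ≤ σ / 2 := by
    have h1 : Λ * c ≤ Real.sqrt (σ / 2) := by
      rw [hc, mul_div_assoc', div_le_iff₀ (by positivity), mul_comm]
      gcongr
      linarith
    calc (Λ * c) ^ 2 ≤ Real.sqrt (σ / 2) ^ 2 := by gcongr
      _ = σ / 2 := Real.sq_sqrt (by positivity)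
  have hvar := tendsto_markov_pow_variance_div hL inv_mem_letterFinset (closure_letterFinset hS)
    hπ hb hharm
  have hprob : Tendsto (fun n : ℕ => probConfined S n (c * Real.sqrt n)) atTop (𝓝 0) := by
    have h4 := hvar.const_mul (4 / σ ^ 2)
    rw [mul_zero] at h4
    refine squeeze_zero' (Eventually.of_forall fun n => probConfined_nonneg S n _) ?_ h4
    filter_upwards [eventually_ge_atTop 1] with n hn
    have hn' : (0 : ℝ) < n := by exact_mod_cast hn
    refine (probConfined_le_markov hL hn _).trans ?_
    -- Chebyshev's inequality: confinement implies a deviation of at least `n * σ / 2`.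
    have hle : (fun g => if (wordLength S g : ℝ) ≤ c * Real.sqrt n then (1 : ℝ) else 0) ≤
        (4 / (σ ^ 2 * (n : ℝ) ^ 2)) • fun g => (‖b g‖ ^ 2 - n * σ) ^ 2 := by
      intro g
      simp only [Pi.smul_apply, smul_eq_mul]
      split_ifs with hg
      · have h1 : ‖b g‖ ≤ Λ * c * Real.sqrt n := by
          calc _ ≤ Λ * wordLength S g := hlen g
            _ ≤ Λ * (c * Real.sqrt n) := by gcongr
            _ = _ := by ring
        have h2 : ‖b g‖ ^ 2 ≤ σ / 2 * n := by
          calc ‖b g‖ ^ 2 ≤ (Λ * c * Real.sqrt n) ^ 2 := by gcongr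
            _ = (Λ * c) ^ 2 * n := by rw [mul_pow, Real.sq_sqrt hn'.le]
            _ ≤ _ := by gcongr
        rw [div_mul_eq_mul_div, le_div_iff₀ (by positivity)]
        have h3 : n * σ / 2 ≤ n * σ - ‖b g‖ ^ 2 := by linarith
        have h5 : (n * σ / 2) ^ 2 ≤ (n * σ - ‖b g‖ ^ 2) ^ 2 := by gcongr
        nlinarith
      · positivity
    refine (markov_pow_mono L n hle 1).trans (le_of_eq ?_)
    rw [map_smul]
    simp only [Pi.smul_apply, smul_eq_mul]
    rw [← hσ]
    ring
  have := hcaut c hc0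
  rw [hprob.limsup_eq] at this
  exact lt_irrefl _ this

end Harmonic

end

section
open Filter Topology RealInnerProductSpace

/-! ### Harmonic representatives of reduced cohomology -/

section ReducedCohomology

variable {G : Type*} [Group G] {H : Type*} [NormedAddCommGroup H] [InnerProductSpace ℝ H]
  {π : G →* (H ≃ₗᵢ[ℝ] H)}

theorem coboundary_mem_cocycles : oneCoboundaries π ≤ oneCocycles π := by
  rintro b ⟨v, hv⟩ g h
  simp [hv, map_mul]

/-- The values of a cocycle on a finite family of group elements. -/
noncomputable def cocycleValues {ι : Type*} [Fintype ι] (s : ι → G) :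
    (G → H) →ₗ[ℝ] PiLp 2 (fun _ : ι => H) where
  toFun b := WithLp.toLp 2 fun i => b (s i)
  map_add' _ _ := rfl
  map_smul' _ _ := rfl

/-- If the values of a sequence of cocycles converge on generators, the cocycles converge. -/
theorem exists_tendsto_cocycles [CompleteSpace H] {ι : Type*} {s : ι → G}
    (hgen : Subgroup.closure (Set.range s) = ⊤) {β : ℕ → G → H} (hβ : ∀ n, β n ∈ oneCocycles π)
    (hlim : ∀ i, ∃ y, Tendsto (fun n => β n (s i)) atTop (𝓝 y)) :
    ∃ b ∈ oneCocycles π, Tendsto β atTop (𝓝 b) := by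
  have h : ∀ g, ∃ y, Tendsto (fun n => β n g) atTop (𝓝 y) := by
    intro g
    have hg : g ∈ Subgroup.closure (Set.range s) := hgen ▸ Subgroup.mem_top g
    induction hg using Subgroup.closure_induction with
    | mem x hx => obtain ⟨i, rfl⟩ := hx; exact hlim i
    | one => exact ⟨0, by simp [cocycle_one (hβ _)]⟩
    | mul x z _ _ hx hz =>
      obtain ⟨y, hy⟩ := hx
      obtain ⟨y', hy'⟩ := hz
      refine ⟨y + π x y', (hy.add (((π x).continuous.tendsto y').comp hy')).congr fun n => ?_⟩
      exact (hβ n x z).symm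
    | inv x _ hx =>
      obtain ⟨y, hy⟩ := hx
      refine ⟨-(π x⁻¹ y), (((π x⁻¹).continuous.tendsto y).comp hy).neg.congr fun n => ?_⟩
      have := cocycle_inv (hβ n) x⁻¹
      rw [inv_inv] at this
      rw [Function.comp_apply, this, neg_neg]
  choose b hb using h
  refine ⟨b, fun g h => ?_, tendsto_pi_nhds.2 hb⟩
  refine tendsto_nhds_unique (hb (g * h))
    (((hb g).add (((π g).continuous.tendsto _).comp (hb h))).congr fun n => ?_)
  exact (hβ n g h).symm

/-- Non-zero reduced cohomology is represented by a non-zero harmonic cocycle. -/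
theorem exists_harmonic_cocycle [CompleteSpace H] {ι : Type*} [Fintype ι] {s : ι → G}
    (hgen : Subgroup.closure (Set.range s) = ⊤)
    (hsymm : ∀ f : G → H, ∑ i, f (s i)⁻¹ = ∑ i, f (s i)) (hπ : ReducedCohomologyNonzero π) :
    ∃ b ∈ oneCocycles π, b ≠ 0 ∧ ∑ i, b (s i) = 0 := by
  obtain ⟨b, hb, hbcl⟩ := Set.not_subset.1 hπ
  let Φ : (G → H) →ₗ[ℝ] PiLp 2 (fun _ : ι => H) := cocycleValues s
  -- Cocycles are determined by their values on generators, so the closure of the coboundaries can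
  -- be taken in the Hilbert space of these values. The harmonic representative is `b` minus its
  -- orthogonal projection to `K`.
  let K : Submodule ℝ (PiLp 2 (fun _ : ι => H)) :=
    ((oneCoboundaries π).map Φ).topologicalClosure
  have hKc : IsClosed (K : Set (PiLp 2 (fun _ : ι => H))) :=
    Submodule.isClosed_topologicalClosure _
  have : CompleteSpace K := hKc.completeSpace_coe
  obtain ⟨x, hx, hxlim⟩ : ∃ x : ℕ → PiLp 2 (fun _ : ι => H),
      (∀ n, x n ∈ (oneCoboundaries π).map Φ) ∧
      Tendsto x atTop (𝓝 (K.starProjection (Φ b))) := by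
    have hmem : K.starProjection (Φ b) ∈
        closure ((oneCoboundaries π).map Φ : Set (PiLp 2 (fun _ : ι => H))) :=
      K.starProjection_apply_mem (Φ b)
    exact mem_closure_iff_seq_limit.1 hmem
  choose β hβ hβx using hx
  have hβc : ∀ n, β n ∈ oneCocycles π := fun n => coboundary_mem_cocycles (hβ n)
  have hcoord : ∀ i, Tendsto (fun n => β n (s i)) atTop (𝓝 (K.starProjection (Φ b) i)) := by
    intro i
    have := ((PiLp.continuous_apply 2 (fun _ : ι => H) i).tendsto _).comp hxlim
    refine this.congr fun n => ?_
    rw [Function.comp_apply, ← hβx]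
    rfl
  obtain ⟨b₁, hb₁, hb₁lim⟩ := exists_tendsto_cocycles hgen hβc fun i => ⟨_, hcoord i⟩
  have hb₁cl : b₁ ∈ (oneCoboundaries π).topologicalClosure :=
    mem_closure_of_tendsto hb₁lim (Eventually.of_forall hβ)
  have hΦb₁ : Φ b₁ = K.starProjection (Φ b) := by
    ext i
    exact tendsto_nhds_unique ((tendsto_pi_nhds.1 hb₁lim) (s i)) (hcoord i)
  have hd : b - b₁ ∈ oneCocycles π := Submodule.sub_mem _ hb hb₁
  refine ⟨b - b₁, hd, ?_, ?_⟩
  · intro h0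
    rw [sub_eq_zero] at h0
    exact hbcl (h0 ▸ hb₁cl)
  · have horth : ∀ v : H, ∑ i, ⟪(b - b₁) (s i), π (s i) v - v⟫ = 0 := by
      intro v
      have h1 : Φ (b - b₁) ∈ Kᗮ := by
        rw [map_sub, hΦb₁]
        exact K.sub_starProjection_mem_orthogonal _
      have h2 : Φ (fun g => π g v - v) ∈ K :=
        Submodule.le_topologicalClosure _ (Submodule.mem_map_of_mem ⟨v, fun g => rfl⟩)
      have h3 := (Submodule.mem_orthogonal' K _).1 h1 _ h2
      rw [PiLp.inner_apply] at h3
      exact h3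
    -- Orthogonality to all coboundaries is harmonicity: by symmetry of the generators the terms at
    -- `s` and its inverse add up to twice the sum.
    have h4 : ∀ v : H, ⟪(2 : ℝ) • ∑ i, (b - b₁) (s i), v⟫ = 0 := by
      intro v
      have h5 := horth v
      have h6 : ∀ i, ⟪(b - b₁) (s i), π (s i) v - v⟫ =
          -⟪(b - b₁) (s i)⁻¹, v⟫ - ⟪(b - b₁) (s i), v⟫ := by
        intro i
        rw [inner_sub_right, ← inner_map_inv]
        have := cocycle_inv hd (s i)⁻¹
        rw [inv_inv] at this
        rw [this, inner_neg_left]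
      simp only [h6] at h5
      rw [Finset.sum_sub_distrib, Finset.sum_neg_distrib, ← sum_inner, ← sum_inner,
        hsymm (b - b₁)] at h5
      rw [inner_smul_left]
      simp only [RCLike.conj_to_real]
      linarith
    have h7 := h4 ((2 : ℝ) • ∑ i, (b - b₁) (s i))
    rw [inner_self_eq_zero] at h7
    simpa using h7

end ReducedCohomology

/-! ### Property `H_FD` for cautious groups and for products of two of them -/

section PropertyHFD

theorem sum_letterFinset_inv {G : Type*} [Group G] (S : Finset G) {M : Type*} [AddCommMonoid M]
    (f : G → M) : ∑ s ∈ letterFinset S, f s⁻¹ = ∑ s ∈ letterFinset S, f s :=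
  Finset.sum_nbij' (fun s => s⁻¹) (fun s => s⁻¹) inv_mem_letterFinset inv_mem_letterFinset
    (by simp) (by simp) (by simp)

theorem IsCautious.propertyHFD {G : Type} [Group G] {S : Finset G} (hS : Generates S)
    (hc : IsCautious S) : PropertyHFD.{u} G := by
  intro H _ _ _ π hπ
  have hrange : Set.range (Subtype.val : letterFinset S → G) = letterFinset S := by simp
  obtain ⟨b, hb, hne, hharm⟩ := exists_harmonic_cocycle (ι := letterFinset S) (s := Subtype.val)
    (by rw [hrange]; exact closure_letterFinset hS)
    (fun f => by
      rw [Finset.sum_coe_sort (letterFinset S) (fun s => f s⁻¹),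
        Finset.sum_coe_sort (letterFinset S) f]
      exact sum_letterFinset_inv S f) hπ
  rw [Finset.sum_coe_sort (letterFinset S) b] at hharm
  exact hasFiniteDimensionalSubrep_of_harmonic hS hc hb hharm hne

variable {H : Type*} [NormedAddCommGroup H] [InnerProductSpace ℝ H]

/-- The subspace of vectors fixed by all `ρ k`. -/
def fixedVectors {K : Type*} [Group K] (ρ : K →* (H ≃ₗᵢ[ℝ] H)) : Submodule ℝ H where
  carrier := {x | ∀ k, ρ k x = x}
  add_mem' ha hb k := by rw [map_add, ha k, hb k]
  zero_mem' k := by simp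
  smul_mem' r x hx k := by rw [map_smul, hx k]

theorem isClosed_fixedVectors {K : Type*} [Group K] (ρ : K →* (H ≃ₗᵢ[ℝ] H)) :
    IsClosed (fixedVectors ρ : Set H) := by
  have : (fixedVectors ρ : Set H) = ⋂ k, {x | ρ k x = x} := by
    ext x; simp [fixedVectors]
  rw [this]
  exact isClosed_iInter fun k => isClosed_eq (ρ k).continuous continuous_id

/-- The restriction of a representation to an invariant subspace. -/
noncomputable def restrictRep {G : Type*} [Group G] (π : G →* (H ≃ₗᵢ[ℝ] H)) (W : Submodule ℝ H)
    (hW : ∀ g, ∀ x ∈ W, π g x ∈ W) : G →* (W ≃ₗᵢ[ℝ] W) where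
  toFun g :=
    { toFun := fun x => ⟨π g x, hW g x x.2⟩
      invFun := fun x => ⟨π g⁻¹ x, hW g⁻¹ x x.2⟩
      left_inv := fun x => Subtype.ext (by simp)
      right_inv := fun x => Subtype.ext (by simp)
      map_add' := fun x y => Subtype.ext (by simp)
      map_smul' := fun r x => Subtype.ext (by simp)
      norm_map' := fun x => (π g).norm_map x }
  map_one' := by ext x; simp
  map_mul' g h := by ext x; simp

/-- A vector moved on average by zero in its own direction is fixed. -/
theorem eq_of_sum_inner_eq {ι : Type*} (L : Finset ι) (σ : ι → H ≃ₗᵢ[ℝ] H) (x : H)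
    (h : ∑ i ∈ L, ⟪x - σ i x, x⟫ = 0) : ∀ i ∈ L, σ i x = x := by
  have hterm : ∀ i, ⟪x - σ i x, x⟫ = ‖x - σ i x‖ ^ 2 / 2 := by
    intro i
    rw [norm_sub_sq_real, LinearIsometryEquiv.norm_map, inner_sub_left,
      real_inner_self_eq_norm_sq, real_inner_comm x]
    ring
  have hnn : ∀ i ∈ L, 0 ≤ ⟪x - σ i x, x⟫ := fun i _ => by rw [hterm]; positivity
  intro i hi
  have h0 := (Finset.sum_eq_zero_iff_of_nonneg hnn).1 h i hi
  rw [hterm] at h0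
  have h1 : ‖x - σ i x‖ = 0 := by
    have : ‖x - σ i x‖ ^ 2 = 0 := by linarith
    exact pow_eq_zero_iff two_ne_zero |>.1 this
  exact (sub_eq_zero.1 (norm_eq_zero.1 h1)).symm

theorem map_eq_of_generators {G : Type*} [Group G] {S : Finset G} (hS : Generates S)
    (ρ : G →* (H ≃ₗᵢ[ℝ] H)) {x : H} (h : ∀ s ∈ letterFinset S, ρ s x = x) (g : G) : ρ g x = x := by
  have hg : g ∈ Subgroup.closure (letterFinset S : Set G) :=
    closure_letterFinset hS ▸ Subgroup.mem_top g
  induction hg using Subgroup.closure_induction with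
  | mem s hs => exact h s hs
  | one => simp
  | mul a b _ _ ha hb => rw [map_mul, LinearIsometryEquiv.coe_mul, Function.comp_apply, hb, ha]
  | inv a _ ha =>
    have : ρ a⁻¹ (ρ a x) = x := by simp
    rwa [ha] at this

/-- A cautious group `K` acting through `ρ`, commuting with the action `ρ'` of another group `K'`,
with a non-zero harmonic cocycle consisting of vectors fixed by `K'`. -/
theorem exists_finiteDimensional_of_harmonic_fixed [CompleteSpace H] {K K' : Type*} [Group K]
    [Group K'] {S : Finset K} (hS : Generates S) (hc : IsCautious S) (ρ : K →* (H ≃ₗᵢ[ℝ] H))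
    (ρ' : K' →* (H ≃ₗᵢ[ℝ] H)) (hcomm : ∀ k k' x, ρ k (ρ' k' x) = ρ' k' (ρ k x)) {b : K → H}
    (hb : b ∈ oneCocycles ρ) (hharm : ∑ s ∈ letterFinset S, b s = 0) (hne : b ≠ 0)
    (hfix : ∀ g, b g ∈ fixedVectors ρ') :
    ∃ W : Submodule ℝ H, W ≠ ⊥ ∧ FiniteDimensional ℝ W ∧ (∀ k, ∀ x ∈ W, ρ k x ∈ W) ∧
      ∀ k', ∀ x ∈ W, ρ' k' x ∈ W := by
  have hW : ∀ g, ∀ x ∈ fixedVectors ρ', ρ g x ∈ fixedVectors ρ' := by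
    intro g x hx k'
    rw [← hcomm, hx k']
  have : CompleteSpace (fixedVectors ρ') := (isClosed_fixedVectors ρ').completeSpace_coe
  obtain ⟨V, hV, hVfin, hVinv⟩ := hasFiniteDimensionalSubrep_of_harmonic hS hc
    (π := restrictRep ρ _ hW) (b := fun g => ⟨b g, hfix g⟩)
    (fun g h => Subtype.ext (hb g h))
    (by
      apply Subtype.ext
      rw [AddSubmonoidClass.coe_finsetSum]
      exact hharm)
    (by
      intro h0
      apply hne
      ext g
      exact congrArg Subtype.val (congrFun h0 g))
  refine ⟨V.map (fixedVectors ρ').subtype, ?_, inferInstance, ?_, ?_⟩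
  · intro h0
    apply hV
    apply Submodule.map_injective_of_injective (Submodule.subtype_injective (fixedVectors ρ'))
    rw [h0, Submodule.map_bot]
  · rintro k _ ⟨x, hx, rfl⟩
    exact ⟨_, hVinv k x hx, rfl⟩
  · rintro k' _ ⟨x, hx, rfl⟩
    refine ⟨x, hx, ?_⟩
    exact (x.2 k').symm

/-- The product walk itself is not used. A cocycle harmonic for the product has restrictions `b₁`,
`b₂` whose step sums `x₁`, `x₂` only cancel. Commutation shows that `x₁` is invariant, hence zero;
so both restrictions are harmonic, and each takes values fixed by the other factor. A non-zero
restriction then contradicts the result for a single cautious factor. -/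
theorem propertyHFD_prod {G₁ G₂ : Type} [Group G₁] [Group G₂] {S₁ : Finset G₁} {S₂ : Finset G₂}
    (hS₁ : Generates S₁) (hS₂ : Generates S₂) (hc₁ : IsCautious S₁) (hc₂ : IsCautious S₂) :
    PropertyHFD.{u} (G₁ × G₂) := by
  intro H _ _ _ π hπ
  by_contra hno
  let s : letterFinset S₁ ⊕ letterFinset S₂ → G₁ × G₂ :=
    Sum.elim (fun x => (x, 1)) (fun x => (1, x))
  have hgen : Subgroup.closure (Set.range s) = ⊤ := by
    rw [eq_top_iff]
    have h1 : ∀ g : G₁, ((g, 1) : G₁ × G₂) ∈ Subgroup.closure (Set.range s) := by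
      intro g
      have hg : g ∈ Subgroup.closure (letterFinset S₁ : Set G₁) :=
        closure_letterFinset hS₁ ▸ Subgroup.mem_top g
      have : Subgroup.closure (letterFinset S₁ : Set G₁) ≤
          (Subgroup.closure (Set.range s)).comap (MonoidHom.inl G₁ G₂) := by
        rw [Subgroup.closure_le]
        intro x hx
        exact Subgroup.subset_closure ⟨Sum.inl ⟨x, hx⟩, rfl⟩
      exact this hg
    have h2 : ∀ g : G₂, ((1, g) : G₁ × G₂) ∈ Subgroup.closure (Set.range s) := by
      intro g
      have hg : g ∈ Subgroup.closure (letterFinset S₂ : Set G₂) :=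
        closure_letterFinset hS₂ ▸ Subgroup.mem_top g
      have : Subgroup.closure (letterFinset S₂ : Set G₂) ≤
          (Subgroup.closure (Set.range s)).comap (MonoidHom.inr G₁ G₂) := by
        rw [Subgroup.closure_le]
        intro x hx
        exact Subgroup.subset_closure ⟨Sum.inr ⟨x, hx⟩, rfl⟩
      exact this hg
    rintro ⟨g, h⟩ -
    have := mul_mem (h1 g) (h2 h)
    simpa using this
  obtain ⟨b, hb, hne, hharm⟩ := exists_harmonic_cocycle hgen (fun f => by
    rw [Fintype.sum_sum_type, Fintype.sum_sum_type]
    simp only [s, Sum.elim_inl, Sum.elim_inr]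
    rw [Finset.sum_coe_sort (letterFinset S₁) (fun x => f (x, 1)⁻¹),
      Finset.sum_coe_sort (letterFinset S₁) (fun x => f (x, 1)),
      Finset.sum_coe_sort (letterFinset S₂) (fun x => f (1, x)⁻¹),
      Finset.sum_coe_sort (letterFinset S₂) (fun x => f (1, x))]
    have e1 := sum_letterFinset_inv S₁ (fun x => f (x, 1))
    have e2 := sum_letterFinset_inv S₂ (fun x => f (1, x))
    simp only [Prod.inv_mk, inv_one, e1, e2]) hπ
  let ρ₁ : G₁ →* (H ≃ₗᵢ[ℝ] H) := π.comp (MonoidHom.inl G₁ G₂)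
  let ρ₂ : G₂ →* (H ≃ₗᵢ[ℝ] H) := π.comp (MonoidHom.inr G₁ G₂)
  have hcomm : ∀ g h x, ρ₁ g (ρ₂ h x) = ρ₂ h (ρ₁ g x) := by
    intro g h x
    have e : π (g, 1) * π (1, h) = π (1, h) * π (g, 1) := by
      rw [← map_mul, ← map_mul]; simp
    exact congrArg (fun u : H ≃ₗᵢ[ℝ] H => u x) e
  let b₁ : G₁ → H := fun g => b (g, 1)
  let b₂ : G₂ → H := fun h => b (1, h)
  have hb₁ : b₁ ∈ oneCocycles ρ₁ := fun g h => by
    have := hb (g, 1) (h, 1)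
    rwa [Prod.mk_mul_mk, mul_one] at this
  have hb₂ : b₂ ∈ oneCocycles ρ₂ := fun g h => by
    have := hb (1, g) (1, h)
    rwa [Prod.mk_mul_mk, mul_one] at this
  have hb12 : ∀ g h, b (g, h) = b₁ g + ρ₁ g (b₂ h) := fun g h => by
    have := hb (g, 1) (1, h)
    rwa [Prod.mk_mul_mk, mul_one, one_mul] at this
  have hb21 : ∀ g h, b (g, h) = b₂ h + ρ₂ h (b₁ g) := fun g h => by
    have := hb (1, h) (g, 1)
    rwa [Prod.mk_mul_mk, mul_one, one_mul] at this
  have hswap : ∀ g h, b₂ h - ρ₁ g (b₂ h) = b₁ g - ρ₂ h (b₁ g) := fun g h => by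
    have := (hb12 g h).symm.trans (hb21 g h)
    rw [sub_eq_sub_iff_add_eq_add, ← this, add_comm]
  set x₁ := ∑ s ∈ letterFinset S₁, b₁ s with hx₁
  set x₂ := ∑ s ∈ letterFinset S₂, b₂ s with hx₂
  have hx12 : x₁ + x₂ = 0 := by
    rw [Fintype.sum_sum_type] at hharm
    simp only [s, Sum.elim_inl, Sum.elim_inr] at hharm
    rwa [Finset.sum_coe_sort (letterFinset S₁) (fun x => b (x, 1)),
      Finset.sum_coe_sort (letterFinset S₂) (fun x => b (1, x))] at hharm
  have hs1 : ∀ h, ∑ s ∈ letterFinset S₁, (b₂ h - ρ₁ s (b₂ h)) = x₁ - ρ₂ h x₁ := by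
    intro h
    simp only [hswap, Finset.sum_sub_distrib, hx₁, map_sum]
  have hs2 : ∀ g, ∑ s ∈ letterFinset S₂, (b₁ g - ρ₂ s (b₁ g)) = x₂ - ρ₁ g x₂ := by
    intro g
    simp only [← hswap, Finset.sum_sub_distrib, hx₂, map_sum]
  -- The two unnormalised Laplacians satisfy `Δ₁ x₂ = Δ₂ x₁`, by summing `hswap` over both sets of
  -- letters. With `x₂ = -x₁` this says `(Δ₁ + Δ₂) x₁ = 0`, and positivity makes `x₁` fixed by all
  -- letters.
  have hkey : ∑ s ∈ letterFinset S₁, (x₂ - ρ₁ s x₂) = ∑ s ∈ letterFinset S₂, (x₁ - ρ₂ s x₁) := by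
    simp only [← hs1, ← hs2]
    rw [Finset.sum_comm]
    simp only [hswap]
  have hx2 : x₂ = -x₁ := (neg_eq_of_add_eq_zero_right hx12).symm
  have hA : ∑ s ∈ letterFinset S₁, ⟪x₁ - ρ₁ s x₁, x₁⟫ +
      ∑ s ∈ letterFinset S₂, ⟪x₁ - ρ₂ s x₁, x₁⟫ = 0 := by
    rw [← sum_inner, ← sum_inner, ← hkey, hx2, ← inner_add_left, ← Finset.sum_add_distrib]
    simp
  have hnn : ∀ σ : H ≃ₗᵢ[ℝ] H, 0 ≤ ⟪x₁ - σ x₁, x₁⟫ := by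
    intro σ
    rw [inner_sub_left, real_inner_self_eq_norm_sq]
    have := real_inner_le_norm (σ x₁) x₁
    rw [LinearIsometryEquiv.norm_map] at this
    nlinarith
  have hn1 := Finset.sum_nonneg fun s (_ : s ∈ letterFinset S₁) => hnn (ρ₁ s)
  have hn2 := Finset.sum_nonneg fun s (_ : s ∈ letterFinset S₂) => hnn (ρ₂ s)
  have hf1 : ∀ g, ρ₁ g x₁ = x₁ := map_eq_of_generators hS₁ ρ₁
    (eq_of_sum_inner_eq (letterFinset S₁) (fun s => ρ₁ s) x₁ (by linarith))
  have hf2 : ∀ g, ρ₂ g x₁ = x₁ := map_eq_of_generators hS₂ ρ₂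
    (eq_of_sum_inner_eq (letterFinset S₂) (fun s => ρ₂ s) x₁ (by linarith))
  have hdecomp : ∀ g h x, π (g, h) x = ρ₁ g (ρ₂ h x) := by
    intro g h x
    have e : π (g, h) = π (g, 1) * π (1, h) := by rw [← map_mul]; simp
    rw [e]; rfl
  have hx0 : x₁ = 0 := by
    by_contra hx0
    refine hno ⟨Submodule.span ℝ {x₁}, by simpa using hx0, inferInstance, ?_⟩
    rintro ⟨g, h⟩ x hx
    obtain ⟨r, rfl⟩ := Submodule.mem_span_singleton.1 hx
    rw [map_smul, hdecomp, hf2, hf1]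
    exact hx
  have hx0' : x₂ = 0 := by rw [hx2, hx0, neg_zero]
  have hfix2 : ∀ h, b₂ h ∈ fixedVectors ρ₁ := by
    intro h
    refine map_eq_of_generators hS₁ ρ₁ (eq_of_sum_inner_eq (letterFinset S₁) (fun s => ρ₁ s) _ ?_)
    rw [← sum_inner, hs1, hx0]; simp
  have hfix1 : ∀ g, b₁ g ∈ fixedVectors ρ₂ := by
    intro g
    refine map_eq_of_generators hS₂ ρ₂ (eq_of_sum_inner_eq (letterFinset S₂) (fun s => ρ₂ s) _ ?_)
    rw [← sum_inner, hs2, hx0']; simp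
  rcases eq_or_ne b₁ 0 with h1 | h1
  · rcases eq_or_ne b₂ 0 with h2 | h2
    · apply hne
      ext ⟨g, h⟩
      rw [hb12, h1, h2]; simp
    · obtain ⟨W, hW, hfin, hW2, hW1⟩ := exists_finiteDimensional_of_harmonic_fixed hS₂ hc₂ ρ₂ ρ₁
        (fun k k' x => (hcomm k' k x).symm) hb₂ hx0' h2 hfix2
      refine hno ⟨W, hW, hfin, ?_⟩
      rintro ⟨g, h⟩ x hx
      rw [hdecomp]
      exact hW1 g _ (hW2 h x hx)
  · obtain ⟨W, hW, hfin, hW1, hW2⟩ := exists_finiteDimensional_of_harmonic_fixed hS₁ hc₁ ρ₁ ρ₂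
      hcomm hb₁ hx0 h1 hfix1
    refine hno ⟨W, hW, hfin, ?_⟩
    rintro ⟨g, h⟩ x hx
    rw [hdecomp]
    exact hW1 g _ (hW2 h x hx)

end PropertyHFD

end

section
-- Lower bounds for the Følner function from independent directions
section FolnerGeneral

variable {G : Type*} [Group G]

theorem mem_wordBoundary_of_mul_notMem {S : Finset G} {V : Set G} {v s : G} (hv : v ∈ V)
    (hs : s ∈ genLetters S) (hvs : v * s ∉ V) : v ∈ wordBoundary S V := by
  refine ⟨hv, v * s, hvs, ?_⟩
  have h1 : wordDist S v (v * s) = wordLength S s := by simp [wordDist]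
  rw [h1]
  have h2 : wordLength S s ≤ 1 := by
    simpa using wordLength_le_length [s] (by simpa using hs)
  have h3 : wordLength S s ≠ 0 := by
    intro h0
    rcases Nat.sInf_eq_zero.1 h0 with ⟨l, hl, -, hp⟩ | hempty
    · rw [List.length_eq_zero_iff] at hl
      subst hl
      apply hvs
      rw [← hp]; simpa using hv
    · have hmem : 1 ∈ {n : ℕ | ∃ l : List G, l.length = n ∧ (∀ x ∈ l, x ∈ genLetters S) ∧
          l.prod = s} := ⟨[s], rfl, by simpa using hs, by simp⟩
      rw [hempty] at hmem
      exact hmem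
  omega

theorem exists_letter_of_mem_wordBoundary {S : Finset G} {V : Set G} {v : G}
    (hv : v ∈ wordBoundary S V) : v ∈ V ∧ ∃ s ∈ genLetters S, v * s ∉ V := by
  obtain ⟨hvV, w, hw, hd⟩ := hv
  refine ⟨hvV, v⁻¹ * w, ?_, by simpa using hw⟩
  have hd' : sInf {n : ℕ | ∃ l : List G, l.length = n ∧ (∀ x ∈ l, x ∈ genLetters S) ∧
      l.prod = v⁻¹ * w} = 1 := hd
  have hne : {n : ℕ | ∃ l : List G, l.length = n ∧ (∀ x ∈ l, x ∈ genLetters S) ∧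
      l.prod = v⁻¹ * w}.Nonempty := by
    by_contra h
    rw [Set.not_nonempty_iff_eq_empty] at h
    rw [h] at hd'
    simp at hd'
  have hmem := Nat.sInf_mem hne
  rw [hd'] at hmem
  obtain ⟨l, hl, hlS, hp⟩ := hmem
  obtain ⟨a, rfl⟩ := List.length_eq_one_iff.1 hl
  rw [← hp]
  simpa using hlS

theorem folnerFunction_le_card {S : Finset G} {V : Finset G} (hV : V.Nonempty) {n : ℕ}
    (h : ((wordBoundary S (V : Set G)).ncard : ℝ) / V.card ≤ 1 / n) :
    folnerFunction S n ≤ V.card :=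
  Nat.sInf_le ⟨V, hV, rfl, h⟩

theorem exists_card_eq_folnerFunction {S : Finset G} {n : ℕ}
    (hne : ∃ V : Finset G, V.Nonempty ∧
      ((wordBoundary S (V : Set G)).ncard : ℝ) / V.card ≤ 1 / n) :
    ∃ V : Finset G, V.Nonempty ∧ V.card = folnerFunction S n ∧
      ((wordBoundary S (V : Set G)).ncard : ℝ) / V.card ≤ 1 / n := by
  obtain ⟨V, hV, h⟩ := hne
  exact Nat.sInf_mem (s := {m : ℕ | ∃ V : Finset G, V.Nonempty ∧ V.card = m ∧
    ((wordBoundary S (V : Set G)).ncard : ℝ) / (V.card : ℝ) ≤ 1 / (n : ℝ)}) ⟨_, V, hV, rfl, h⟩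

theorem finite_wordBoundary (S : Finset G) (V : Finset G) :
    (wordBoundary S (V : Set G)).Finite :=
  V.finite_toSet.subset fun _ h => h.1

open Classical in
-- A path that leaves `V` crosses the boundary at one of its steps, and for each step right
-- translation is injective.
theorem card_exit_le (S : Finset G) (V : Finset G) (l : List G)
    (hl : ∀ x ∈ l, x ∈ genLetters S) :
    (V.filter fun v => v * l.prod ∉ V).card ≤
      l.length * (wordBoundary S (V : Set G)).ncard := by
  induction l with
  | nil => simp [Finset.card_eq_zero, Finset.filter_eq_empty_iff]
  | cons a l ih =>
    have ih' := ih fun x hx => hl x (List.mem_cons_of_mem _ hx)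
    have hsub : (V.filter fun v => v * (a :: l).prod ∉ V) ⊆
        (finite_wordBoundary S V).toFinset ∪
          ((V.filter fun v => v * l.prod ∉ V).image fun v => v * a⁻¹) := by
      intro v hv
      rw [Finset.mem_filter, List.prod_cons, ← mul_assoc] at hv
      rw [Finset.mem_union]
      by_cases h : v * a ∈ V
      · right
        exact Finset.mem_image.2 ⟨v * a, Finset.mem_filter.2 ⟨h, hv.2⟩, by simp⟩
      · left
        rw [Set.Finite.mem_toFinset]
        exact mem_wordBoundary_of_mul_notMem (S := S) (Finset.mem_coe.2 hv.1)
          (hl a List.mem_cons_self) (by simpa using h)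
    calc _ ≤ _ := Finset.card_le_card hsub
      _ ≤ _ := Finset.card_union_le _ _
      _ ≤ (wordBoundary S (V : Set G)).ncard + l.length * (wordBoundary S (V : Set G)).ncard := by
        rw [← Set.ncard_eq_toFinset_card _ (finite_wordBoundary S V)]
        exact add_le_add le_rfl (Finset.card_image_le.trans ih')
      _ = _ := by rw [List.length_cons]; ring

open Classical in
/-- A finite set in which every point has neighbours in at least `D` independent directions has
at least `2 ^ D` points. -/
theorem two_pow_le_card_of_directions {X J Q : Type*} [Fintype J] (c : J → X → Q) (D : ℕ)
    (A : Finset X) (hA : A.Nonempty)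
    (h : ∀ x ∈ A, D ≤ (Finset.univ.filter fun i => ∃ y ∈ A, ∀ j, c j y = c j x ↔ j ≠ i).card) :
    2 ^ D ≤ A.card := by
  induction D generalizing A with
  | zero => simpa using hA.card_pos
  | succ D ih =>
    obtain ⟨x, hx⟩ := hA
    have hpos : 0 < (Finset.univ.filter fun i => ∃ y ∈ A, ∀ j, c j y = c j x ↔ j ≠ i).card :=
      lt_of_lt_of_le (Nat.succ_pos D) (h x hx)
    obtain ⟨i, hi⟩ := Finset.card_pos.1 hpos
    obtain ⟨y, hy, hyx⟩ := (Finset.mem_filter.1 hi).2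
    have hne : c i y ≠ c i x := fun he => (hyx i).1 he rfl
    -- Fixing the value of coordinate `i` costs each point at most the direction `i`, so each fibre
    -- is covered by the induction hypothesis; moving in direction `i` provides a second, disjoint
    -- fibre.
    have hpart : ∀ z ∈ A, 2 ^ D ≤ (A.filter fun a => c i a = c i z).card := by
      intro z hz
      refine ih _ ⟨z, Finset.mem_filter.2 ⟨hz, rfl⟩⟩ ?_
      intro a ha
      rw [Finset.mem_filter] at ha
      have h1 := h a ha.1
      have h2 : (Finset.univ.filter fun k => ∃ y ∈ A, ∀ j, c j y = c j a ↔ j ≠ k).erase i ⊆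
          Finset.univ.filter fun k => ∃ y ∈ A.filter fun a => c i a = c i z,
            ∀ j, c j y = c j a ↔ j ≠ k := by
        intro k hk
        rw [Finset.mem_erase, Finset.mem_filter] at hk
        obtain ⟨hki, -, w, hw, hwa⟩ := hk
        refine Finset.mem_filter.2 ⟨Finset.mem_univ _, w, Finset.mem_filter.2 ⟨hw, ?_⟩, hwa⟩
        rw [(hwa i).2 (Ne.symm hki), ha.2]
      have h3 := Finset.card_le_card h2
      have h4 := Finset.pred_card_le_card_erase
        (s := Finset.univ.filter fun k => ∃ y ∈ A, ∀ j, c j y = c j a ↔ j ≠ k) (a := i)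
      omega
    have hdisj : Disjoint (A.filter fun a => c i a = c i x) (A.filter fun a => c i a = c i y) := by
      rw [Finset.disjoint_filter]
      intro a _ h1 h2
      exact hne (h2.symm.trans h1)
    have hle : (A.filter fun a => c i a = c i x).card + (A.filter fun a => c i a = c i y).card ≤
        A.card := by
      rw [← Finset.card_union_of_disjoint hdisj]
      exact Finset.card_le_card
        (Finset.union_subset (Finset.filter_subset _ _) (Finset.filter_subset _ _))
    have e1 := hpart x hx
    have e2 := hpart y hy
    rw [pow_succ]; omega

open Classical in
-- Each `u i` keeps more than half of `V` inside `V`, so the graph with edges from `v` to `v * u i`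
-- has average degree above half the number of directions, counting outgoing edges. A minimal subset
-- with this density has large degree at every point, hence exponentially many points.
theorem two_pow_le_card_of_small_boundary {S : Finset G} {J Q : Type*} [Fintype J] (u : J → G)
    (c : J → G → Q) (hc : ∀ i j g, c j (g * u i) = c j g ↔ j ≠ i) {r : ℕ}
    (hword : ∀ i, ∃ l : List G, l.length ≤ r ∧ (∀ x ∈ l, x ∈ genLetters S) ∧ l.prod = u i)
    {V : Finset G} (hV : V.Nonempty)
    (hbd : 2 * (r * (wordBoundary S (V : Set G)).ncard) < V.card) :
    (2 : ℝ) ^ ((Fintype.card J : ℝ) / 4) ≤ V.card := by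
  set M := Fintype.card J with hM
  rcases Nat.eq_zero_or_pos M with h0 | hMpos
  · rw [h0]
    simpa using hV.card_pos
  let E : Finset G → ℕ := fun A => ∑ i, (A.filter fun v => v * u i ∈ A).card
  have hEV : M * V.card < 2 * E V := by
    have hi : ∀ i, V.card < 2 * (V.filter fun v => v * u i ∈ V).card := by
      intro i
      obtain ⟨l, hlr, hlS, hp⟩ := hword i
      have h1 := card_exit_le S V l hlS
      rw [hp] at h1
      have h2 := Finset.card_filter_add_card_filter_not (s := V) (fun v => v * u i ∈ V)
      have h3 := Nat.mul_le_mul_right (wordBoundary S (V : Set G)).ncard hlr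
      omega
    have hsum : ∑ _i : J, V.card < ∑ i, 2 * (V.filter fun v => v * u i ∈ V).card :=
      Finset.sum_lt_sum_of_nonempty (Finset.univ_nonempty_iff.2 (Fintype.card_pos_iff.1 hMpos))
        fun i _ => hi i
    simpa [E, Finset.mul_sum, hM] using hsum
  -- In a subset of least cardinality with the density bound, deleting a point `x` must destroy the
  -- bound, so the incoming and outgoing edges at `x` number more than `M / 2` together. One of the
  -- two kinds gives at least `⌈M / 4⌉` directions.
  let F := V.powerset.filter fun A => M * A.card < 2 * E A
  have hF : F.Nonempty :=
    ⟨V, Finset.mem_filter.2 ⟨Finset.mem_powerset.2 (Finset.Subset.refl _), hEV⟩⟩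
  obtain ⟨A, hAF, hmin⟩ := Finset.exists_min_image F Finset.card hF
  obtain ⟨hAV, hEA⟩ := Finset.mem_filter.1 hAF
  rw [Finset.mem_powerset] at hAV
  have hAne : A.Nonempty := by
    rw [Finset.nonempty_iff_ne_empty]
    rintro rfl
    simp [E] at hEA
  have hdeg : ∀ x ∈ A, (M + 3) / 4 ≤
      (Finset.univ.filter fun i => ∃ y ∈ A, ∀ j, c j y = c j x ↔ j ≠ i).card := by
    intro x hx
    have hlt : (A.erase x).card < A.card := Finset.card_erase_lt_of_mem hx
    have hnot : ¬ (M * (A.erase x).card < 2 * E (A.erase x)) := by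
      intro hcon
      have := hmin _ (Finset.mem_filter.2
        ⟨Finset.mem_powerset.2 ((Finset.erase_subset _ _).trans hAV), hcon⟩)
      omega
    set out := (Finset.univ.filter fun i => x * u i ∈ A).card with hout
    set inn := (Finset.univ.filter fun i => x * (u i)⁻¹ ∈ A).card with hinn
    have hE : E A ≤ E (A.erase x) + (out + inn) := by
      simp only [hout, hinn, Finset.card_filter _ Finset.univ, E]
      rw [← Finset.sum_add_distrib, ← Finset.sum_add_distrib]
      refine Finset.sum_le_sum fun i _ => ?_
      have hsub : (A.filter fun v => v * u i ∈ A) ⊆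
          ((A.erase x).filter fun v => v * u i ∈ A.erase x) ∪
            ((if x * u i ∈ A then {x} else ∅) ∪
              (if x * (u i)⁻¹ ∈ A then {x * (u i)⁻¹} else ∅)) := by
        intro v hv
        rw [Finset.mem_filter] at hv
        simp only [Finset.mem_union, Finset.mem_filter, Finset.mem_erase]
        by_cases hvx : v = x
        · subst hvx
          right; left
          rw [if_pos hv.2]; simp
        · by_cases hvu : v * u i = x
          · right; right
            have hv' : v = x * (u i)⁻¹ := by rw [← hvu]; simp
            rw [← hv', if_pos hv.1]; simp
          · left
            exact ⟨⟨hvx, hv.1⟩, hvu, hv.2⟩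
      refine (Finset.card_le_card hsub).trans ((Finset.card_union_le _ _).trans
        (add_le_add le_rfl ((Finset.card_union_le _ _).trans (add_le_add ?_ ?_))))
      · split_ifs <;> simp
      · split_ifs <;> simp
    have hcardA : A.card = (A.erase x).card + 1 := (Finset.card_erase_add_one hx).symm
    rw [hcardA] at hEA
    have h1 : out ≤ (Finset.univ.filter fun i => ∃ y ∈ A, ∀ j, c j y = c j x ↔ j ≠ i).card := by
      refine Finset.card_le_card fun i hi => ?_
      rw [Finset.mem_filter] at hi ⊢
      exact ⟨hi.1, _, hi.2, fun j => hc i j x⟩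
    have h2 : inn ≤ (Finset.univ.filter fun i => ∃ y ∈ A, ∀ j, c j y = c j x ↔ j ≠ i).card := by
      refine Finset.card_le_card fun i hi => ?_
      rw [Finset.mem_filter] at hi ⊢
      refine ⟨hi.1, _, hi.2, fun j => ?_⟩
      have := hc i j (x * (u i)⁻¹)
      rw [inv_mul_cancel_right] at this
      rw [← this, eq_comm]
    have h3 : M * ((A.erase x).card + 1) = M * (A.erase x).card + M := by ring
    omega
  have h2 := two_pow_le_card_of_directions c _ A hAne hdeg
  have h3 := h2.trans (Finset.card_le_card hAV)
  calc (2 : ℝ) ^ ((M : ℝ) / 4) ≤ (2 : ℝ) ^ (((M + 3) / 4 : ℕ) : ℝ) := by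
        apply Real.rpow_le_rpow_of_exponent_le (by norm_num)
        have : M ≤ (M + 3) / 4 * 4 := by omega
        have h' : (M : ℝ) ≤ ((M + 3) / 4 : ℕ) * 4 := by exact_mod_cast this
        linarith
    _ = (2 : ℝ) ^ ((M + 3) / 4) := Real.rpow_natCast _ _
    _ ≤ V.card := by exact_mod_cast h3

/-- Lower bound for the Følner function by the number of independent directions given by short
words. -/
theorem two_rpow_le_folnerFunction {S : Finset G} {J Q : Type*} [Fintype J] (u : J → G)
    (c : J → G → Q) (hc : ∀ i j g, c j (g * u i) = c j g ↔ j ≠ i) {r n : ℕ}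
    (hword : ∀ i, ∃ l : List G, l.length ≤ r ∧ (∀ x ∈ l, x ∈ genLetters S) ∧ l.prod = u i)
    (hrn : 2 * r < n) (hne : ∃ V : Finset G, V.Nonempty ∧
      ((wordBoundary S (V : Set G)).ncard : ℝ) / V.card ≤ 1 / n) :
    (2 : ℝ) ^ ((Fintype.card J : ℝ) / 4) ≤ folnerFunction S n := by
  obtain ⟨V, hV, hcard, hbd⟩ := exists_card_eq_folnerFunction hne
  rw [← hcard]
  refine two_pow_le_card_of_small_boundary u c hc hword hV ?_
  have hV' : (0 : ℝ) < V.card := by exact_mod_cast hV.card_pos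
  have hn : (0 : ℝ) < n := by exact_mod_cast (by omega : 0 < n)
  rw [div_le_div_iff₀ hV' hn, one_mul] at hbd
  have hbd' : (wordBoundary S (V : Set G)).ncard * n ≤ V.card := by exact_mod_cast hbd
  rcases Nat.eq_zero_or_pos (wordBoundary S (V : Set G)).ncard with h0 | h0
  · rw [h0]; simpa using hV.card_pos
  · calc 2 * (r * (wordBoundary S (V : Set G)).ncard) =
        (wordBoundary S (V : Set G)).ncard * (2 * r) := by ring
      _ < (wordBoundary S (V : Set G)).ncard * n := Nat.mul_lt_mul_of_pos_left hrn h0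
      _ ≤ _ := hbd'

theorem two_le_folnerFunction {S : Finset G} (hS : ∃ s ∈ genLetters S, s ≠ 1) {n : ℕ} (hn : 2 ≤ n)
    (hne : ∃ V : Finset G, V.Nonempty ∧
      ((wordBoundary S (V : Set G)).ncard : ℝ) / V.card ≤ 1 / n) :
    2 ≤ folnerFunction S n := by
  obtain ⟨V, hV, hcard, hbd⟩ := exists_card_eq_folnerFunction hne
  rw [← hcard]
  by_contra hlt
  have h1 : V.card = 1 := by have := hV.card_pos; omega
  obtain ⟨v, rfl⟩ := Finset.card_eq_one.1 h1
  obtain ⟨s, hs, hs1⟩ := hS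
  have hmem : v ∈ wordBoundary S (({v} : Finset G) : Set G) :=
    mem_wordBoundary_of_mul_notMem (by simp) hs (by simpa using hs1)
  have hpos : 1 ≤ (wordBoundary S (({v} : Finset G) : Set G)).ncard :=
    (Set.ncard_pos (finite_wordBoundary S {v})).2 ⟨v, hmem⟩
  have hpos' : (1 : ℝ) ≤ (wordBoundary S (({v} : Finset G) : Set G)).ncard := by
    exact_mod_cast hpos
  have hn' : (2 : ℝ) ≤ n := by exact_mod_cast hn
  rw [h1, Nat.cast_one, div_one, le_div_iff₀ (by linarith)] at hbd
  nlinarith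

end FolnerGeneral

end

section
open scoped commutatorElement

/-! ### Word lengths and iterated commutators -/

section HasWord

variable {G : Type*} [Group G]

/-- `g` is represented by a word of length at most `k`. -/
def HasWord (S : Finset G) (k : ℕ) (g : G) : Prop :=
  ∃ l : List G, l.length ≤ k ∧ (∀ x ∈ l, x ∈ genLetters S) ∧ l.prod = g

theorem HasWord.mono {S : Finset G} {k k' : ℕ} {g : G} (h : HasWord S k g) (hk : k ≤ k') :
    HasWord S k' g := by
  obtain ⟨l, hl, h1, h2⟩ := h
  exact ⟨l, hl.trans hk, h1, h2⟩

theorem HasWord.one (S : Finset G) : HasWord S 0 (1 : G) := ⟨[], by simp, by simp, rfl⟩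

theorem HasWord.letter {S : Finset G} {s : G} (hs : s ∈ genLetters S) : HasWord S 1 s :=
  ⟨[s], by simp, by simpa using hs, by simp⟩

theorem HasWord.mul {S : Finset G} {k k' : ℕ} {g g' : G} (h : HasWord S k g)
    (h' : HasWord S k' g') : HasWord S (k + k') (g * g') := by
  obtain ⟨l, hl, h1, rfl⟩ := h
  obtain ⟨l', hl', h1', rfl⟩ := h'
  exact ⟨l ++ l', by simpa using add_le_add hl hl',
    fun x hx => (List.mem_append.1 hx).elim (h1 x) (h1' x), by simp⟩

theorem HasWord.inv {S : Finset G} {k : ℕ} {g : G} (h : HasWord S k g) : HasWord S k g⁻¹ := by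
  obtain ⟨l, hl, h1, rfl⟩ := h
  refine ⟨(l.map (·⁻¹)).reverse, by simpa using hl, fun x hx => ?_,
    (List.prod_inv_reverse l).symm⟩
  obtain ⟨y, hy, rfl⟩ := List.mem_map.1 (List.mem_reverse.1 hx)
  exact inv_mem_genLetters (h1 y hy)

theorem HasWord.pow {S : Finset G} {k : ℕ} {g : G} (h : HasWord S k g) (n : ℕ) :
    HasWord S (n * k) (g ^ n) := by
  induction n with
  | zero => simpa using HasWord.one S
  | succ n ih => rw [pow_succ, Nat.succ_mul]; exact ih.mul h

theorem HasWord.zpow {S : Finset G} {k : ℕ} {g : G} (h : HasWord S k g) (n : ℤ) :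
    HasWord S (n.natAbs * k) (g ^ n) := by
  rcases Int.natAbs_eq n with hn | hn
  · have := h.pow n.natAbs
    rwa [← zpow_natCast, ← hn] at this
  · have := (h.pow n.natAbs).inv
    rwa [← zpow_natCast, ← zpow_neg, ← hn] at this

theorem HasWord.wordLength_le {S : Finset G} {k : ℕ} {g : G} (h : HasWord S k g) :
    wordLength S g ≤ k := by
  obtain ⟨l, hl, h1, rfl⟩ := h
  exact (wordLength_le_length l h1).trans hl

/-- A commutator with an element no longer than the current one at most quadruples the length bound.
-/
theorem HasWord.commutator_foldl {S : Finset G} {k w : ℕ} (hkw : w ≤ k) {g : G}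
    (h : HasWord S k g) (l : List G) (hl : ∀ x ∈ l, HasWord S w x) :
    HasWord S (4 ^ l.length * k) (l.foldl (fun x y => ⁅x, y⁆) g) := by
  induction l generalizing k g with
  | nil => simpa using h
  | cons y l ih =>
    have hy := hl y List.mem_cons_self
    have h1 : HasWord S (4 * k) ⁅g, y⁆ := by
      rw [commutatorElement_def]
      exact (((h.mul hy).mul h.inv).mul hy.inv).mono (by omega)
    have := ih (by omega) h1 fun x hx => hl x (List.mem_cons_of_mem _ hx)
    rw [List.foldl_cons]
    refine this.mono ?_
    rw [List.length_cons, pow_succ, mul_assoc]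

theorem HasWord.map {Γ : Type*} [Group Γ] {S : Finset G} {S' : Finset Γ} (j : G →* Γ)
    (hj : ∀ s ∈ genLetters S, j s ∈ genLetters S') {k : ℕ} {g : G} (h : HasWord S k g) :
    HasWord S' k (j g) := by
  obtain ⟨l, hl, h1, rfl⟩ := h
  refine ⟨l.map j, by simpa using hl, fun x hx => ?_, (map_list_prod j l).symm⟩
  obtain ⟨y, hy, rfl⟩ := List.mem_map.1 hx
  exact hj y (h1 y hy)

theorem generates_of_hasWord {S : Finset G} (h : ∀ g : G, ∃ k, HasWord S k g) : Generates S := by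
  rw [Generates, eq_top_iff]
  rintro g -
  obtain ⟨k, l, -, hl, rfl⟩ := h g
  refine Subgroup.list_prod_mem _ fun x hx => ?_
  rcases hl x hx with h | h
  · exact Subgroup.subset_closure h
  · exact (Subgroup.inv_mem_iff _).1 (Subgroup.subset_closure h)

theorem map_commutator_foldl {Γ : Type*} [Group Γ] (p : G →* Γ) (g : G) (l : List G) :
    p (l.foldl (fun x y => ⁅x, y⁆) g) = (l.map p).foldl (fun x y => ⁅x, y⁆) (p g) := by
  induction l generalizing g with
  | nil => rfl
  | cons y l ih => rw [List.foldl_cons, ih, map_commutatorElement, List.map_cons, List.foldl_cons]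

theorem commutator_foldl_one (l : List G) : l.foldl (fun x y => ⁅x, y⁆) (1 : G) = 1 := by
  induction l with
  | nil => rfl
  | cons y l ih => rw [List.foldl_cons, commutatorElement_one_left, ih]

theorem commutator_foldl_of_mem_one (l : List G) (h : (1 : G) ∈ l) (g : G) :
    l.foldl (fun x y => ⁅x, y⁆) g = 1 := by
  induction l generalizing g with
  | nil => simp at h
  | cons y l ih =>
    rw [List.foldl_cons]
    rcases List.mem_cons.1 h with h1 | h1
    · subst h1
      rw [commutatorElement_one_right, commutator_foldl_one]
    · exact ih h1 _

end HasWord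

/-! ### Lamp groups extended by translation, and their Følner sets -/

section ShiftGroup

variable {I Q : Type} [Group Q]

/-- The `i`-th translate of the family `e`. -/
def lampGen (e : I → ℤ → Q) (i : ℤ) : I → ℤ → Q := fun ι r => e ι (i + r)

/-- The group generated by the translates of `e`. -/
def lampGroup (e : I → ℤ → Q) : Subgroup (I → ℤ → Q) :=
  Subgroup.closure (Set.range (lampGen e))

/-- The subgroup generated by the translates with index in `A`. -/
def lampSubgroup (e : I → ℤ → Q) (A : Set ℤ) : Subgroup (I → ℤ → Q) :=
  Subgroup.closure (lampGen e '' A)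

theorem lampGen_mem (e : I → ℤ → Q) (i : ℤ) : lampGen e i ∈ lampGroup e :=
  Subgroup.subset_closure ⟨i, rfl⟩

theorem lampGen_mem_lampSubgroup (e : I → ℤ → Q) {A : Set ℤ} {i : ℤ} (hi : i ∈ A) :
    lampGen e i ∈ lampSubgroup e A :=
  Subgroup.subset_closure ⟨i, hi, rfl⟩

theorem lampSubgroup_le (e : I → ℤ → Q) (A : Set ℤ) : lampSubgroup e A ≤ lampGroup e :=
  Subgroup.closure_mono (Set.image_subset_range _ _)

/-- Translation of families. -/
def shiftHom (I Q : Type) [Group Q] (k : ℤ) : (I → ℤ → Q) →* (I → ℤ → Q) where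
  toFun f := fun ι r => f ι (r + k)
  map_one' := rfl
  map_mul' _ _ := rfl

theorem shiftHom_apply (k : ℤ) (f : I → ℤ → Q) (ι : I) (r : ℤ) :
    shiftHom I Q k f ι r = f ι (r + k) := rfl

theorem shiftHom_lampGen (e : I → ℤ → Q) (k i : ℤ) :
    shiftHom I Q k (lampGen e i) = lampGen e (i + k) := by
  ext ι r
  rw [shiftHom_apply, lampGen, lampGen]
  congr 1; ring

theorem shiftHom_mem {e : I → ℤ → Q} (k : ℤ) {f : I → ℤ → Q} (hf : f ∈ lampGroup e) :
    shiftHom I Q k f ∈ lampGroup e := by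
  have : lampGroup e ≤ (lampGroup e).comap (shiftHom I Q k) := by
    rw [lampGroup, Subgroup.closure_le]
    rintro _ ⟨i, rfl⟩
    rw [SetLike.mem_coe, Subgroup.mem_comap, shiftHom_lampGen]
    exact lampGen_mem e _
  exact this hf

/-- The action of `ℤ` on the lamp group by translation. -/
def lampShift (e : I → ℤ → Q) : Multiplicative ℤ →* MulAut (lampGroup e) where
  toFun k :=
    { toFun := fun f => ⟨shiftHom I Q k.toAdd f, shiftHom_mem _ f.2⟩
      invFun := fun f => ⟨shiftHom I Q (-k.toAdd) f, shiftHom_mem _ f.2⟩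
      left_inv := fun f => by
        ext ι r; simp [shiftHom_apply]
      right_inv := fun f => by
        ext ι r; simp [shiftHom_apply]
      map_mul' := fun f g => Subtype.ext (map_mul _ _ _) }
  map_one' := by
    ext f ι r; simp [shiftHom_apply]
  map_mul' k l := by
    ext f ι r
    simp [shiftHom_apply, add_assoc]

/-- The semidirect product of the lamp group with `ℤ`. -/
abbrev ShiftGroup (e : I → ℤ → Q) := lampGroup e ⋊[lampShift e] Multiplicative ℤ

variable {e : I → ℤ → Q}

theorem coe_lampShift_apply (k : Multiplicative ℤ) (f : lampGroup e) :
    (lampShift e k f : I → ℤ → Q) = shiftHom I Q k.toAdd f := rfl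

/-- The lamp element with index `i`. -/
def lampElt (e : I → ℤ → Q) (i : ℤ) : lampGroup e := ⟨lampGen e i, lampGen_mem e i⟩

theorem lampShift_lampElt (k : ℤ) (i : ℤ) :
    lampShift e (Multiplicative.ofAdd k) (lampElt e i) = lampElt e (i + k) :=
  Subtype.ext (shiftHom_lampGen e k i)

/-- The element of `ℤ`. -/
def cursor (e : I → ℤ → Q) (k : ℤ) : ShiftGroup e :=
  SemidirectProduct.inr (Multiplicative.ofAdd k)

/-- An element of the lamp group in the semidirect product. -/
def lampIncl (e : I → ℤ → Q) : lampGroup e →* ShiftGroup e := SemidirectProduct.inl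

/-- The position of the cursor. -/
def pos (g : ShiftGroup e) : ℤ := g.right.toAdd

/-- The generating set consisting of one lamp and one translation. -/
noncomputable def shiftGens (e : I → ℤ → Q) : Finset (ShiftGroup e) :=
  letI := Classical.decEq (ShiftGroup e)
  {lampIncl e (lampElt e 0), cursor e 1}

theorem mem_shiftGens {x : ShiftGroup e} :
    x ∈ shiftGens e ↔ x = lampIncl e (lampElt e 0) ∨ x = cursor e 1 := by
  rw [shiftGens, @Finset.mem_insert _ (Classical.decEq (ShiftGroup e)), Finset.mem_singleton]

theorem cursor_add (k l : ℤ) : cursor e (k + l) = cursor e k * cursor e l := by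
  simp [cursor, ofAdd_add]

theorem cursor_neg (k : ℤ) : cursor e (-k) = (cursor e k)⁻¹ := by
  simp [cursor, ofAdd_neg]

theorem cursor_eq_zpow (k : ℤ) : cursor e k = cursor e 1 ^ k := by
  rw [cursor, cursor, ← map_zpow, ← ofAdd_zsmul]; simp

theorem hasWord_cursor (k : ℤ) : HasWord (shiftGens e) k.natAbs (cursor e k) := by
  rw [cursor_eq_zpow]
  have : HasWord (shiftGens e) 1 (cursor e 1) :=
    HasWord.letter (Or.inl (mem_shiftGens.2 (Or.inr rfl)))
  simpa using this.zpow k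

theorem lampIncl_lampElt (i : ℤ) :
    lampIncl e (lampElt e i) = cursor e i * lampIncl e (lampElt e 0) * cursor e (-i) := by
  have := SemidirectProduct.inl_aut (φ := lampShift e) (Multiplicative.ofAdd i) (lampElt e 0)
  rw [lampShift_lampElt, zero_add] at this
  rw [cursor_neg]
  simpa [cursor, lampIncl] using this

theorem hasWord_lampElt (i : ℤ) :
    HasWord (shiftGens e) (2 * i.natAbs + 1) (lampIncl e (lampElt e i)) := by
  rw [lampIncl_lampElt]
  have : HasWord (shiftGens e) 1 (lampIncl e (lampElt e 0)) :=
    HasWord.letter (Or.inl (mem_shiftGens.2 (Or.inl rfl)))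
  exact (((hasWord_cursor i).mul this).mul (hasWord_cursor (-i))).mono (by
    rw [Int.natAbs_neg]; omega)

theorem eq_lampIncl_mul_cursor (g : ShiftGroup e) : g = lampIncl e g.left * cursor e (pos g) :=
  (SemidirectProduct.inl_left_mul_inr_right g).symm

theorem generates_shiftGens (e : I → ℤ → Q) : Generates (shiftGens e) := by
  apply generates_of_hasWord
  intro g
  have h : ∀ f (hf : f ∈ lampGroup e), ∃ k, HasWord (shiftGens e) k (lampIncl e ⟨f, hf⟩) := by
    intro f hf
    induction hf using Subgroup.closure_induction with
    | mem x hx =>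
      obtain ⟨i, rfl⟩ := hx
      exact ⟨_, hasWord_lampElt i⟩
    | one => exact ⟨0, HasWord.one _⟩
    | mul x y hx hy h1 h2 =>
      obtain ⟨k, hk⟩ := h1
      obtain ⟨k', hk'⟩ := h2
      exact ⟨k + k', by
        have := hk.mul hk'
        rwa [← map_mul] at this⟩
    | inv x hx h1 =>
      obtain ⟨k, hk⟩ := h1
      exact ⟨k, by
        have := hk.inv
        rwa [← map_inv] at this⟩
  obtain ⟨k, hk⟩ := h g.left g.left.2
  rw [eq_lampIncl_mul_cursor g]
  exact ⟨_, hk.mul (hasWord_cursor (pos g))⟩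

/-- The coordinates of an element in the frame of the cursor. -/
def coord (j : I × ℤ) (g : ShiftGroup e) : Q := (g.left : I → ℤ → Q) j.1 (j.2 - pos g)

/-- In the frame of the cursor, right multiplication by a lamp element acts coordinatewise and
independently of the cursor position. This is what makes coordinates into independent directions. -/
theorem coord_mul_lampIncl (j : I × ℤ) (g : ShiftGroup e) (u : lampGroup e) :
    coord j (g * lampIncl e u) = coord j g * (u : I → ℤ → Q) j.1 j.2 := by
  have h1 : pos (g * lampIncl e u) = pos g := by simp [pos, lampIncl]
  have h2 : ((g * lampIncl e u).left : I → ℤ → Q) =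
      (g.left : I → ℤ → Q) * shiftHom I Q (pos g) u := by
    simp [lampIncl, SemidirectProduct.mul_left, coe_lampShift_apply, pos]
  rw [coord, h1, h2, coord]
  simp [shiftHom_apply]

/-- The retraction `p` with section `j` covers both the group itself and a direct product having it
as a factor. -/
theorem two_rpow_le_folnerFunction_of_coordinates {Γ : Type*} [Group Γ] {S : Finset Γ}
    (p : Γ →* ShiftGroup e) (j : ShiftGroup e →* Γ) (hpj : ∀ g, p (j g) = g)
    (hj : ∀ s ∈ genLetters (shiftGens e), j s ∈ genLetters S) {J : Type*} [Fintype J]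
    (u : J → lampGroup e) (x : J → I × ℤ)
    (hux : ∀ i k, (u i : I → ℤ → Q) (x k).1 (x k).2 = 1 ↔ k ≠ i) {r n : ℕ}
    (hword : ∀ i, HasWord (shiftGens e) r (lampIncl e (u i)))
    (hrn : 2 * r < n) (hne : ∃ V : Finset Γ, V.Nonempty ∧
      ((wordBoundary S (V : Set Γ)).ncard : ℝ) / V.card ≤ 1 / n) :
    (2 : ℝ) ^ ((Fintype.card J : ℝ) / 4) ≤ folnerFunction S n := by
  refine two_rpow_le_folnerFunction (fun i => j (lampIncl e (u i))) (fun k g => coord (x k) (p g))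
    ?_ (fun i => (hword i).map j hj) hrn hne
  intro i k g
  rw [map_mul, hpj, coord_mul_lampIncl, mul_eq_left, hux]

theorem genLetters_shiftGens {x : ShiftGroup e} (hx : x ∈ genLetters (shiftGens e)) :
    x = lampIncl e (lampElt e 0) ∨ x = (lampIncl e (lampElt e 0))⁻¹ ∨
      x = cursor e 1 ∨ x = cursor e (-1) := by
  rcases hx with h | h
  · rcases mem_shiftGens.1 h with h | h
    · exact Or.inl h
    · exact Or.inr (Or.inr (Or.inl h))
  · rcases mem_shiftGens.1 h with h | h
    · right; left; rw [← h, inv_inv]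
    · right; right; right; rw [cursor_neg, ← h, inv_inv]

/-- The Følner sets: lamps and cursor in the interval `[0, W)`. -/
theorem exists_folnerSet (e : I → ℤ → Q) {W : ℕ} (hW : 0 < W)
    [Finite (lampSubgroup e (Set.Ico 0 W))] :
    ∃ V : Finset (ShiftGroup e), V.Nonempty ∧
      V.card = W * Nat.card (lampSubgroup e (Set.Ico 0 W)) ∧
      (wordBoundary (shiftGens e) (V : Set (ShiftGroup e))).ncard ≤
        2 * Nat.card (lampSubgroup e (Set.Ico 0 W)) := by
  classical
  set B := lampSubgroup e (Set.Ico 0 W) with hB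
  have := Fintype.ofFinite B
  let Ψ : B × ℕ → ShiftGroup e := fun y =>
    ⟨⟨y.1, lampSubgroup_le e _ y.1.2⟩, Multiplicative.ofAdd (y.2 : ℤ)⟩
  have hΨ : Function.Injective Ψ := by
    rintro ⟨f, a⟩ ⟨f', a'⟩ h
    have h1 := congrArg SemidirectProduct.left h
    have h2 := congrArg (fun g => Multiplicative.toAdd (SemidirectProduct.right g)) h
    have h3 : f = f' := Subtype.ext (congrArg (fun g : lampGroup e => (g : I → ℤ → Q)) h1)
    have h4 : (a : ℤ) = a' := h2
    rw [h3, Nat.cast_injective h4]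
  let V : Finset (ShiftGroup e) := (Finset.univ ×ˢ Finset.range W).image Ψ
  have hmem : ∀ g : ShiftGroup e, (g.left : I → ℤ → Q) ∈ B → 0 ≤ pos g → pos g < W → g ∈ V := by
    intro g h1 h2 h3
    refine Finset.mem_image.2 ⟨(⟨_, h1⟩, (pos g).toNat), ?_, ?_⟩
    · simp only [Finset.mem_product, Finset.mem_univ, true_and, Finset.mem_range]
      omega
    · have h4 : Multiplicative.ofAdd (((pos g).toNat : ℤ)) = g.right := by
        rw [Int.toNat_of_nonneg h2]; rfl
      apply SemidirectProduct.ext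
      · rfl
      · exact h4
  have hcardB : Nat.card B = Fintype.card B := Nat.card_eq_fintype_card
  refine ⟨V, ⟨1, hmem 1 (one_mem _) le_rfl (by simpa [pos] using hW)⟩, ?_, ?_⟩
  · rw [Finset.card_image_of_injective _ hΨ, Finset.card_product, Finset.card_univ,
      Finset.card_range, hcardB, mul_comm]
  · have hsub : wordBoundary (shiftGens e) (V : Set (ShiftGroup e)) ⊆
        (((Finset.univ ×ˢ {0, W - 1}).image Ψ : Finset (ShiftGroup e)) : Set _) := by
      intro v hv
      obtain ⟨hvV, s, hs, hvs⟩ := exists_letter_of_mem_wordBoundary hv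
      obtain ⟨⟨f, a⟩, hfa, rfl⟩ := Finset.mem_image.1 (Finset.mem_coe.1 hvV)
      simp only [Finset.mem_product, Finset.mem_univ, true_and, Finset.mem_range] at hfa
      refine Finset.mem_coe.2 (Finset.mem_image.2 ⟨(f, a), ?_, rfl⟩)
      simp only [Finset.mem_product, Finset.mem_univ, true_and, Finset.mem_insert,
        Finset.mem_singleton]
      by_contra hcon
      push Not at hcon
      apply hvs
      rw [Finset.mem_coe]
      have hshift : shiftHom I Q (a : ℤ) (lampGen e 0) ∈ B := by
        rw [shiftHom_lampGen, zero_add]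
        exact lampGen_mem_lampSubgroup e ⟨by positivity, by exact_mod_cast hfa⟩
      rcases genLetters_shiftGens hs with rfl | rfl | rfl | rfl
      · refine hmem _ ?_ ?_ ?_
        · change (f : I → ℤ → Q) * shiftHom I Q (a : ℤ) (lampGen e 0) ∈ B
          exact mul_mem f.2 hshift
        · change (0 : ℤ) ≤ (a : ℤ) + 0
          omega
        · change (a : ℤ) + 0 < W
          omega
      · refine hmem _ ?_ ?_ ?_
        · rw [← map_inv]
          change (f : I → ℤ → Q) * shiftHom I Q (a : ℤ) (lampGen e 0)⁻¹ ∈ B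
          rw [map_inv]
          exact mul_mem f.2 (inv_mem hshift)
        · rw [← map_inv]
          change (0 : ℤ) ≤ (a : ℤ) + 0
          omega
        · rw [← map_inv]
          change (a : ℤ) + 0 < W
          omega
      · refine hmem _ ?_ ?_ ?_
        · change (f : I → ℤ → Q) * shiftHom I Q (a : ℤ) 1 ∈ B
          rw [map_one, mul_one]
          exact f.2
        · change (0 : ℤ) ≤ (a : ℤ) + 1
          omega
        · change (a : ℤ) + 1 < W
          omega
      · refine hmem _ ?_ ?_ ?_
        · change (f : I → ℤ → Q) * shiftHom I Q (a : ℤ) 1 ∈ B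
          rw [map_one, mul_one]
          exact f.2
        · change (0 : ℤ) ≤ (a : ℤ) + (-1)
          omega
        · change (a : ℤ) + (-1) < W
          omega
    calc _ ≤ _ := Set.ncard_le_ncard hsub (Finset.finite_toSet _)
      _ = _ := Set.ncard_coe_finset _
      _ ≤ _ := Finset.card_image_le
      _ ≤ Fintype.card B * 2 := by
        rw [Finset.card_product, Finset.card_univ]
        exact Nat.mul_le_mul_left _ Finset.card_le_two
      _ = _ := by rw [hcardB, mul_comm]

/-- A subgroup of families that are determined by finitely many coordinates. -/
theorem finite_and_card_le_of_coordinates [Finite Q] (B : Subgroup (I → ℤ → Q))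
    (T : Finset (I × ℤ)) (hT : ∀ f ∈ B, (∀ j ∈ T, f j.1 j.2 = 1) → f = 1) :
    Finite B ∧ Nat.card B ≤ Nat.card Q ^ T.card := by
  let R : B → (T → Q) := fun f j => (f : I → ℤ → Q) j.1.1 j.1.2
  have hR : Function.Injective R := by
    intro f g hfg
    have h1 : (f⁻¹ * g : B) = 1 := by
      apply Subtype.ext
      refine hT _ (f⁻¹ * g).2 fun j hj => ?_
      have : (f : I → ℤ → Q) j.1 j.2 = (g : I → ℤ → Q) j.1 j.2 := congrFun hfg ⟨j, hj⟩
      simp [this]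
    exact (inv_mul_eq_one.1 h1)
  refine ⟨Finite.of_injective R hR, ?_⟩
  refine (Nat.card_le_card_of_injective R hR).trans (le_of_eq ?_)
  rw [Nat.card_fun]; simp

theorem apply_eq_one_of_forall_gen {A : Set ℤ} {ι : I} {ρ : ℤ} (h : ∀ i ∈ A, e ι (i + ρ) = 1)
    {f : I → ℤ → Q} (hf : f ∈ lampSubgroup e A) : f ι ρ = 1 := by
  induction hf using Subgroup.closure_induction with
  | mem x hx => obtain ⟨i, hi, rfl⟩ := hx; exact h i hi
  | one => rfl
  | mul x y _ _ hx hy => rw [Pi.mul_apply, Pi.mul_apply, hx, hy, one_mul]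
  | inv x _ hx => rw [Pi.inv_apply, Pi.inv_apply, hx, inv_one]

/-- If at most one generator of the window is visible in a coordinate, this coordinate is
controlled by the lamp configuration. -/
theorem apply_eq_one_of_lamp {o : I} {a : Q} (ha : a ≠ 1) (haa : a * a = 1)
    (ho : ∀ i, e o i = if i = 0 then a else 1) {A : Set ℤ} {ι : I} {ρ i₀ : ℤ}
    (hsq : e ι (i₀ + ρ) * e ι (i₀ + ρ) = 1) (h : ∀ i ∈ A, i ≠ i₀ → e ι (i + ρ) = 1)
    {f : I → ℤ → Q} (hf : f ∈ lampSubgroup e A) (hlamp : f o (-i₀) = 1) : f ι ρ = 1 := by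
  revert hlamp
  -- At most the generator `i₀` affects either coordinate, and it does so by an involution in each;
  -- hence the pair of values is a function of the parity of its number of uses.
  have key : (f o (-i₀) = 1 ∧ f ι ρ = 1) ∨ (f o (-i₀) = a ∧ f ι ρ = e ι (i₀ + ρ)) := by
    induction hf using Subgroup.closure_induction with
    | mem x hx =>
      obtain ⟨i, hi, rfl⟩ := hx
      by_cases hii : i = i₀
      · subst hii
        right
        simp [lampGen, ho]
      · left
        refine ⟨?_, h i hi hii⟩
        rw [lampGen, ho, if_neg]
        omega
    | one => left; exact ⟨rfl, rfl⟩
    | mul x y _ _ hx hy =>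
      simp only [Pi.mul_apply]
      rcases hx with ⟨h1, h2⟩ | ⟨h1, h2⟩ <;> rcases hy with ⟨h3, h4⟩ | ⟨h3, h4⟩ <;>
        simp [h1, h2, h3, h4, haa, hsq]
    | inv x _ hx =>
      simp only [Pi.inv_apply]
      rcases hx with ⟨h1, h2⟩ | ⟨h1, h2⟩
      · left; simp [h1, h2]
      · right
        rw [h1, h2]
        exact ⟨inv_eq_of_mul_eq_one_left haa, inv_eq_of_mul_eq_one_left hsq⟩
  intro hlamp
  rcases key with h1 | h1
  · exact h1.2
  · exact absurd (h1.1.symm.trans hlamp) ha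

end ShiftGroup

end

section
open Filter Topology

/-! ### Confinement of the cursor and a criterion for caution -/

section Confinement

variable {I Q : Type} [Group Q] {e : I → ℤ → Q}

theorem pos_mul (g h : ShiftGroup e) : pos (g * h) = pos g + pos h := rfl

theorem pos_one : pos (1 : ShiftGroup e) = 0 := rfl

theorem pos_lampIncl (u : lampGroup e) : pos (lampIncl e u) = 0 := rfl

theorem pos_cursor (k : ℤ) : pos (cursor e k) = k := rfl

theorem lampElt_inv (he : ∀ ι i, e ι i * e ι i = 1) (i : ℤ) : (lampElt e i)⁻¹ = lampElt e i := by
  apply inv_eq_of_mul_eq_one_left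
  apply Subtype.ext
  ext ι r
  exact he ι (i + r)

theorem mem_genLetters_shiftGens (he : ∀ ι i, e ι i * e ι i = 1) {x : ShiftGroup e} :
    x ∈ genLetters (shiftGens e) ↔
      x = lampIncl e (lampElt e 0) ∨ x = cursor e 1 ∨ x = cursor e (-1) := by
  constructor
  · intro hx
    rcases genLetters_shiftGens hx with h | h | h | h
    · exact Or.inl h
    · left; rw [h, ← map_inv, lampElt_inv he]
    · exact Or.inr (Or.inl h)
    · exact Or.inr (Or.inr h)
  · rintro (rfl | rfl | rfl)
    · exact Or.inl (mem_shiftGens.2 (Or.inl rfl))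
    · exact Or.inl (mem_shiftGens.2 (Or.inr rfl))
    · right
      rw [cursor_neg, inv_inv]
      exact mem_shiftGens.2 (Or.inr rfl)

open Classical in
-- The lamp generator is its own inverse and counts once, so the cursor performs the lazy walk with
-- three equally likely steps `0`, `1`, `-1`.
theorem letterFinset_shiftGens (he : ∀ ι i, e ι i * e ι i = 1) :
    letterFinset (shiftGens e) = {lampIncl e (lampElt e 0), cursor e 1, cursor e (-1)} := by
  ext x
  rw [mem_letterFinset, mem_genLetters_shiftGens he, Finset.mem_insert, Finset.mem_insert,
    Finset.mem_singleton]

theorem sum_letterFinset_shiftGens (he : ∀ ι i, e ι i * e ι i = 1) (F : ℤ → ℝ) :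
    ∑ s ∈ letterFinset (shiftGens e), F (pos s) = F 0 + (F 1 + F (-1)) := by
  classical
  have h1 : lampIncl e (lampElt e 0) ∉ ({cursor e 1, cursor e (-1)} : Finset (ShiftGroup e)) := by
    rw [Finset.mem_insert, Finset.mem_singleton]
    rintro (h | h)
    · have := congrArg pos h; rw [pos_lampIncl, pos_cursor] at this; omega
    · have := congrArg pos h; rw [pos_lampIncl, pos_cursor] at this; omega
  have h2 : cursor e 1 ∉ ({cursor e (-1)} : Finset (ShiftGroup e)) := by
    rw [Finset.mem_singleton]
    intro h
    have := congrArg pos h; rw [pos_cursor, pos_cursor] at this; omega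
  rw [letterFinset_shiftGens he, Finset.sum_insert h1, Finset.sum_insert h2,
    Finset.sum_singleton, pos_lampIncl, pos_cursor, pos_cursor]

theorem card_letterFinset_shiftGens (he : ∀ ι i, e ι i * e ι i = 1) :
    ((letterFinset (shiftGens e)).card : ℝ) = 3 := by
  have := sum_letterFinset_shiftGens he (fun _ => 1)
  simp only [Finset.sum_const, nsmul_eq_mul, mul_one] at this
  rw [this]; norm_num

theorem walkPosition_zero {G : Type*} [Group G] {n : ℕ} (w : Fin n → G) : walkPosition w 0 = 1 := by
  simp [walkPosition]

theorem walkPosition_cons {G : Type*} [Group G] {n : ℕ} (s : G) (w : Fin n → G) (k : ℕ) :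
    walkPosition (Fin.cons s w : Fin (n + 1) → G) (k + 1) = s * walkPosition w k := by
  simp [walkPosition, List.ofFn_succ]

theorem walkPosition_succ {G : Type*} [Group G] {n : ℕ} (w : Fin n → G) {k : ℕ} (hk : k < n) :
    walkPosition w (k + 1) = walkPosition w k * w ⟨k, hk⟩ := by
  rw [walkPosition, walkPosition, List.prod_take_succ _ _ (by simpa using hk)]
  simp

open Classical in
/-- The number of confined trajectories is bounded below by an eigenfunction. -/
theorem le_sum_confined (he : ∀ ι i, e ι i * e ι i = 1) (R n : ℕ) {θ : ℝ}
    (hθ : θ * (2 * (R + 1)) = Real.pi) (x : ℤ) (hx : |x| ≤ R + 1) :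
    (1 + 2 * Real.cos θ) ^ n * Real.cos (θ * x) ≤
      ∑ w : Fin n → letterFinset (shiftGens e),
        if ∀ k ≤ n, |x + pos (walkPosition (fun i => (w i : ShiftGroup e)) k)| ≤ (R : ℤ)
        then (1 : ℝ) else 0 := by
  have hθ0 : 0 < θ := by
    have := Real.pi_pos
    by_contra h
    push Not at h
    nlinarith [(Nat.cast_nonneg R : (0 : ℝ) ≤ R)]
  have hcosθ : 0 ≤ Real.cos θ := Real.cos_nonneg_of_mem_Icc
    ⟨by linarith [Real.pi_pos], by nlinarith [(Nat.cast_nonneg R : (0 : ℝ) ≤ R)]⟩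
  -- The cosine with `θ = π / (2 * (R + 1))` is the Dirichlet eigenfunction of the interval: it
  -- vanishes at `±(R + 1)`, where the walk is killed. Adding the three steps gives the factor `1 +
  -- 2 * cos θ`.
  have hedge : ∀ y : ℤ, |y| ≤ R + 1 → ¬ |y| ≤ (R : ℤ) → Real.cos (θ * y) = 0 := by
    intro y h1 h2
    have h3 : |y| = R + 1 := by omega
    have h4 : |(y : ℝ)| = R + 1 := by
      rw [← Int.cast_abs, h3]; push_cast; ring
    rw [← Real.cos_abs, abs_mul, h4, abs_of_pos hθ0]
    have : θ * ((R : ℝ) + 1) = Real.pi / 2 := by linarith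
    rw [this, Real.cos_pi_div_two]
  induction n generalizing x with
  | zero =>
    by_cases h : |x| ≤ (R : ℤ)
    · simp only [pow_zero, one_mul, nonpos_iff_eq_zero, forall_eq, walkPosition_zero, pos_one,
        add_zero, h, if_true]
      simpa using Real.cos_le_one _
    · rw [hedge x hx h]
      simp only [mul_zero]
      positivity
  | succ n ih =>
    by_cases h : |x| ≤ (R : ℤ)
    · rw [← (Fin.consEquiv (fun _ => letterFinset (shiftGens e))).sum_comp,
        Fintype.sum_prod_type]
      have hstep : ∀ s : letterFinset (shiftGens e), ∀ w : Fin n → letterFinset (shiftGens e),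
          (∀ k ≤ n + 1, |x + pos (walkPosition (fun i =>
            ((Fin.consEquiv (fun _ => letterFinset (shiftGens e))) (s, w) i : ShiftGroup e)) k)|
              ≤ (R : ℤ)) ↔
          ∀ k ≤ n, |(x + pos (s : ShiftGroup e)) +
            pos (walkPosition (fun i => (w i : ShiftGroup e)) k)| ≤ (R : ℤ) := by
        intro s w
        have hcons : (fun i => ((Fin.consEquiv (fun _ => letterFinset (shiftGens e))) (s, w) i :
            ShiftGroup e)) = Fin.cons (s : ShiftGroup e) (fun i => (w i : ShiftGroup e)) := by
          funext i
          refine Fin.cases ?_ (fun j => ?_) i <;> simp [Fin.consEquiv]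
        rw [hcons]
        constructor
        · intro hk k hkn
          have := hk (k + 1) (by omega)
          rwa [walkPosition_cons, pos_mul, ← add_assoc] at this
        · intro hk k hkn
          rcases k with _ | k
          · rw [walkPosition_zero, pos_one, add_zero]; exact h
          · rw [walkPosition_cons, pos_mul, ← add_assoc]
            exact hk k (by omega)
      simp only [hstep]
      rw [Finset.sum_coe_sort (letterFinset (shiftGens e)) (fun s : ShiftGroup e =>
        ∑ w : Fin n → letterFinset (shiftGens e),
          if ∀ k ≤ n, |(x + pos s) + pos (walkPosition (fun i => (w i : ShiftGroup e)) k)| ≤ (R : ℤ)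
          then (1 : ℝ) else 0)]
      rw [sum_letterFinset_shiftGens he (fun y => ∑ w : Fin n → letterFinset (shiftGens e),
          if ∀ k ≤ n, |(x + y) + pos (walkPosition (fun i => (w i : ShiftGroup e)) k)| ≤ (R : ℤ)
          then (1 : ℝ) else 0)]
      have h0 := ih (x + 0) (by simpa using hx)
      have habs := abs_le.1 h
      have h1 := ih (x + 1) (abs_le.2 ⟨by omega, by omega⟩)
      have h2 := ih (x + -1) (abs_le.2 ⟨by omega, by omega⟩)
      refine le_trans (le_of_eq ?_) (add_le_add h0 (add_le_add h1 h2))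
      push_cast
      rw [mul_add θ, mul_add θ, mul_add θ, mul_zero, add_zero, mul_one, mul_neg, mul_one,
        Real.cos_add, Real.cos_add, Real.cos_neg, Real.sin_neg]
      ring
    · rw [hedge x hx h]
      simp only [mul_zero]
      positivity

theorem left_walkPosition_mem (he : ∀ ι i, e ι i * e ι i = 1) {R n : ℕ}
    {w : Fin n → ShiftGroup e} (hw : w ∈ walkIncrements (shiftGens e) n)
    (hpos : ∀ k ≤ n, |pos (walkPosition w k)| ≤ (R : ℤ)) (k : ℕ) (hk : k ≤ n) :
    ((walkPosition w k).left : I → ℤ → Q) ∈ lampSubgroup e (Set.Icc (-R) R) := by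
  induction k with
  | zero => rw [walkPosition_zero]; exact one_mem _
  | succ k ih =>
    have ih' := ih (by omega)
    have hp := abs_le.1 (hpos k (by omega))
    rw [walkPosition_succ w (by omega)]
    have hleft : ∀ g h : ShiftGroup e, ((g * h).left : I → ℤ → Q) =
        (g.left : I → ℤ → Q) * shiftHom I Q (pos g) (h.left : I → ℤ → Q) := fun g h => rfl
    rw [hleft]
    refine mul_mem ih' ?_
    rcases (mem_genLetters_shiftGens he).1 (hw ⟨k, by omega⟩) with h | h | h
    · rw [h]
      change shiftHom I Q _ (lampGen e 0) ∈ _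
      rw [shiftHom_lampGen, zero_add]
      exact lampGen_mem_lampSubgroup e ⟨hp.1, hp.2⟩
    · rw [h]
      change shiftHom I Q _ 1 ∈ _
      rw [map_one]; exact one_mem _
    · rw [h]
      change shiftHom I Q _ 1 ∈ _
      rw [map_one]; exact one_mem _

/-- Confinement of the cursor to `[-R, R]` is enough for confinement in the group under `hr`. The
second alternative covers small `R`, where the base is negative and its powers say nothing. -/
theorem le_probConfined (he : ∀ ι i, e ι i * e ι i = 1) {R n : ℕ} {r : ℝ}
    (hr : ∀ g : ShiftGroup e, (g.left : I → ℤ → Q) ∈ lampSubgroup e (Set.Icc (-R) R) →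
      |pos g| ≤ (R : ℤ) → (wordLength (shiftGens e) g : ℝ) ≤ r) :
    (1 - (Real.pi / (2 * (R + 1))) ^ 2 / 3) ^ n ≤ probConfined (shiftGens e) n r ∨
      (1 - (Real.pi / (2 * (R + 1))) ^ 2 / 3) < 0 := by
  classical
  rw [or_iff_not_imp_right]
  intro hnn
  push Not at hnn
  set θ := Real.pi / (2 * (R + 1)) with hθ
  have hθ' : θ * (2 * (R + 1)) = Real.pi := by rw [hθ]; field_simp
  have h1 := le_sum_confined he R n hθ' 0 (by rw [abs_zero]; positivity)
  rw [Finset.sum_boole] at h1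
  simp only [Int.cast_zero, mul_zero, Real.cos_zero, mul_one, zero_add] at h1
  have hle : 1 - θ ^ 2 / 3 ≤ (1 + 2 * Real.cos θ) / 3 := by
    have := Real.one_sub_sq_div_two_le_cos (x := θ)
    linarith
  rw [probConfined, ncard_walkIncrements, ncard_walkIncrements_inter (shiftGens e) n
    (fun w => ∀ k : ℕ, 1 ≤ k → k ≤ n → (wordLength (shiftGens e) (walkPosition w k) : ℝ) ≤ r)]
  push_cast
  rw [card_letterFinset_shiftGens he]
  calc (1 - θ ^ 2 / 3) ^ n ≤ ((1 + 2 * Real.cos θ) / 3) ^ n := pow_le_pow_left₀ hnn hle n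
    _ = (1 + 2 * Real.cos θ) ^ n / 3 ^ n := div_pow _ _ _
    _ ≤ _ := by
      gcongr
      refine h1.trans ?_
      norm_cast
      refine Finset.card_le_card fun w hw => ?_
      rw [Finset.mem_filter] at hw ⊢
      refine ⟨hw.1, fun k _ hk => hr _ ?_ (hw.2 k hk)⟩
      exact left_walkPosition_mem he (fun i => mem_letterFinset.1 (w i).2) hw.2 k hk

theorem probConfined_le_one {G : Type*} [Group G] (S : Finset G) (n : ℕ) (r : ℝ) :
    probConfined S n r ≤ 1 := by
  classical
  rw [probConfined, ncard_walkIncrements_inter S n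
    (fun w => ∀ k : ℕ, 1 ≤ k → k ≤ n → (wordLength S (walkPosition w k) : ℝ) ≤ r),
    ncard_walkIncrements]
  apply div_le_one_of_le₀ _ (by positivity)
  norm_cast
  refine (Finset.card_filter_le _ _).trans ?_
  simp

/-- Keeping the cursor in an interval of length proportional to `√n` for `n` steps has probability
bounded below, so only a length bound over such an interval is needed, along a sequence of `n`. -/
theorem isCautious_of_wordLength_le (he : ∀ ι i, e ι i * e ι i = 1)
    (H : ∀ c : ℝ, 0 < c → ∃ δ : ℝ, 0 < δ ∧ ∃ᶠ n : ℕ in atTop, ∃ R : ℕ, δ * Real.sqrt n ≤ R + 1 ∧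
      ∀ g : ShiftGroup e, (g.left : I → ℤ → Q) ∈ lampSubgroup e (Set.Icc (-R) R) →
        |pos g| ≤ (R : ℤ) → (wordLength (shiftGens e) g : ℝ) ≤ c * Real.sqrt n) :
    IsCautious (shiftGens e) := by
  intro c hc
  obtain ⟨δ, hδ, hfreq⟩ := H c hc
  set K : ℝ := Real.pi ^ 2 / (12 * δ ^ 2) with hK
  have hK0 : 0 < K := by have := Real.pi_pos; positivity
  have hlim := Real.tendsto_one_add_div_pow_exp (-K)
  have hev : ∀ᶠ n : ℕ in atTop, Real.exp (-K) / 2 < (1 + -K / n) ^ n :=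
    hlim.eventually (lt_mem_nhds (half_lt_self (Real.exp_pos _)))
  have hbig : ∀ᶠ n : ℕ in atTop, K < n := tendsto_natCast_atTop_atTop.eventually_gt_atTop K
  have hfr : ∃ᶠ n : ℕ in atTop, Real.exp (-K) / 2 ≤
      probConfined (shiftGens e) n (c * Real.sqrt n) := by
    refine (hfreq.and_eventually (hev.and hbig)).mono ?_
    rintro n ⟨⟨R, hR, hlen⟩, h1, h2⟩
    have hn : (0 : ℝ) < n := hK0.trans h2
    have hθ : (Real.pi / (2 * (R + 1))) ^ 2 / 3 ≤ K / n := by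
      have hs : 0 < δ * Real.sqrt n := by positivity
      have : (Real.pi / (2 * (R + 1))) ^ 2 ≤ (Real.pi / (2 * (δ * Real.sqrt n))) ^ 2 := by
        have := Real.pi_pos
        gcongr
      calc _ ≤ (Real.pi / (2 * (δ * Real.sqrt n))) ^ 2 / 3 := by gcongr
        _ = K / n := by
          rw [hK, div_pow, mul_pow, mul_pow, Real.sq_sqrt hn.le]
          field_simp
          ring
    have hKn : K / n < 1 := by rwa [div_lt_one hn]
    rcases le_probConfined (n := n) he hlen with h | h
    · refine le_trans ?_ h
      refine h1.le.trans (pow_le_pow_left₀ ?_ ?_ n)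
      · rw [neg_div]; linarith
      · rw [neg_div]; linarith
    · linarith
  have hle := Filter.le_limsup_of_frequently_le hfr
    (isBoundedUnder_of ⟨1, fun n => probConfined_le_one _ _ _⟩)
  exact lt_of_lt_of_le (by positivity) hle

end Confinement

/-! ### Lengths of elements supported in a window -/

section LampLength

variable {I Q : Type} [Group Q] {e : I → ℤ → Q}

theorem lamp_values {o : I} {a : Q} (haa : a * a = 1) (ho : ∀ i, e o i = if i = 0 then a else 1)
    {f : I → ℤ → Q} (hf : f ∈ lampGroup e) (r : ℤ) : f o r = 1 ∨ f o r = a := by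
  induction hf using Subgroup.closure_induction with
  | mem x hx =>
    obtain ⟨i, rfl⟩ := hx
    rw [lampGen, ho]
    split_ifs
    · exact Or.inr rfl
    · exact Or.inl rfl
  | one => exact Or.inl rfl
  | mul x y _ _ hx hy =>
    simp only [Pi.mul_apply]
    rcases hx with h | h <;> rcases hy with h' | h' <;> simp [h, h', haa]
  | inv x _ hx =>
    simp only [Pi.inv_apply]
    rcases hx with h | h
    · left; simp [h]
    · right; rw [h]; exact inv_eq_of_mul_eq_one_left haa

theorem lamp_eq_one_of_notMem {o : I} {a : Q} (ho : ∀ i, e o i = if i = 0 then a else 1)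
    {A : Set ℤ} {f : I → ℤ → Q} (hf : f ∈ lampSubgroup e A) {i : ℤ} (hi : i ∉ A) :
    f o (-i) = 1 := by
  refine apply_eq_one_of_forall_gen (fun k hk => ?_) hf
  rw [ho, if_neg]
  rintro h
  have : k = i := by omega
  exact hi (this ▸ hk)

/-- The length of an element with lamps in `[-R, R]` when the elements with trivial lamps are
short. -/
theorem hasWord_of_window {o : I} {a : Q} (haa : a * a = 1)
    (ho : ∀ i, e o i = if i = 0 then a else 1) {R D : ℕ}
    (hD : ∀ u : lampGroup e, (u : I → ℤ → Q) ∈ lampSubgroup e (Set.Icc (-R) R) →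
      (∀ r, (u : I → ℤ → Q) o r = 1) → HasWord (shiftGens e) D (lampIncl e u))
    (g : ShiftGroup e) (hg : (g.left : I → ℤ → Q) ∈ lampSubgroup e (Set.Icc (-R) R))
    (hpos : |pos g| ≤ (R : ℤ)) : HasWord (shiftGens e) (7 * R + 3 + D) g := by
  -- One sweep of the cursor from `-R` to `R + 1` sets all lamps to those of `g` at cost `5 * R +
  -- 2`. The correction has trivial lamps and costs `D` after a return of `R + 1` steps; the final
  -- position costs at most `R`.
  have hstep : ∀ k : ℕ, k ≤ 2 * R + 1 → ∃ h : lampGroup e,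
      (h : I → ℤ → Q) ∈ lampSubgroup e (Set.Icc (-R) R) ∧
      (∀ i : ℤ, -R ≤ i → i < -R + k → (h : I → ℤ → Q) o (-i) = (g.left : I → ℤ → Q) o (-i)) ∧
      (∀ i : ℤ, -R + k ≤ i → (h : I → ℤ → Q) o (-i) = 1) ∧
      HasWord (shiftGens e) (R + 2 * k) (lampIncl e h * cursor e (-R + k)) := by
    intro k
    induction k with
    | zero =>
      intro _
      refine ⟨1, one_mem _, fun i h1 h2 => absurd h2 (by push_cast; omega), fun i _ => rfl, ?_⟩
      have := hasWord_cursor (e := e) (-R : ℤ)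
      rw [Int.natAbs_neg, Int.natAbs_natCast] at this
      simpa using this
    | succ k ih =>
      intro hk
      obtain ⟨h, h1, h2, h3, h4⟩ := ih (by omega)
      have hone : HasWord (shiftGens e) 1 (cursor e 1) := by
        simpa using hasWord_cursor (e := e) 1
      rcases lamp_values haa ho g.left.2 (-(-R + k : ℤ)) with hv | hv
      · refine ⟨h, h1, fun i hi1 hi2 => ?_, fun i hi => h3 i (by push_cast at hi; omega), ?_⟩
        · rcases eq_or_ne i (-R + k) with rfl | hne
          · rw [h3 _ le_rfl, hv]
          · exact h2 i hi1 (by push_cast at hi2; omega)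
        · have := h4.mul hone
          rw [mul_assoc, ← cursor_add] at this
          refine HasWord.mono ?_ (show R + 2 * k + 1 ≤ _ by omega)
          convert this using 3
          push_cast; ring
      · refine ⟨h * lampElt e (-R + k), ?_, fun i hi1 hi2 => ?_, fun i hi => ?_, ?_⟩
        · refine mul_mem h1 (lampGen_mem_lampSubgroup e ⟨by omega, by omega⟩)
        · change (h : I → ℤ → Q) o (-i) * e o ((-R + k) + -i) = _
          rw [ho]
          rcases eq_or_ne i (-R + k) with rfl | hne
          · rw [h3 _ le_rfl, hv, if_pos (by ring), one_mul]
          · rw [if_neg (by omega), mul_one]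
            exact h2 i hi1 (by push_cast at hi2; omega)
        · change (h : I → ℤ → Q) o (-i) * e o ((-R + k) + -i) = _
          push_cast at hi
          rw [ho, if_neg (by omega), mul_one]
          exact h3 i (by omega)
        · have hb : HasWord (shiftGens e) 1 (lampIncl e (lampElt e 0)) :=
            HasWord.letter (Or.inl (mem_shiftGens.2 (Or.inl rfl)))
          have := (h4.mul hb).mul hone
          refine HasWord.mono ?_ (show R + 2 * k + 1 + 1 ≤ _ by omega)
          convert this using 1
          rw [map_mul, lampIncl_lampElt, Nat.cast_succ, ← add_assoc, cursor_add _ 1, cursor_neg]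
          group
  obtain ⟨h, h1, h2, h3, h4⟩ := hstep (2 * R + 1) le_rfl
  have hlamps : ∀ i : ℤ, (h : I → ℤ → Q) o (-i) = (g.left : I → ℤ → Q) o (-i) := by
    intro i
    by_cases hi : i ∈ Set.Icc (-R : ℤ) R
    · exact h2 i hi.1 (by have := hi.2; push_cast; omega)
    · rw [lamp_eq_one_of_notMem ho h1 hi, lamp_eq_one_of_notMem ho hg hi]
  have hu := hD (h⁻¹ * g.left) (mul_mem (inv_mem h1) hg) (fun r => by
    change ((h : I → ℤ → Q) o r)⁻¹ * (g.left : I → ℤ → Q) o r = 1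
    have := hlamps (-r)
    rw [neg_neg] at this
    rw [this, inv_mul_cancel])
  have hw := ((h4.mul (hasWord_cursor (-(-R + (2 * R + 1 : ℕ) : ℤ)))).mul hu).mul
    (hasWord_cursor (pos g))
  have hg' : lampIncl e h * cursor e (-R + (2 * R + 1 : ℕ)) *
      cursor e (-(-R + (2 * R + 1 : ℕ) : ℤ)) * lampIncl e (h⁻¹ * g.left) * cursor e (pos g) = g := by
    rw [cursor_neg, map_mul, map_inv]
    conv_rhs => rw [eq_lampIncl_mul_cursor g]
    group
  rw [hg'] at hw
  refine hw.mono ?_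
  have := abs_le.1 hpos
  omega

end LampLength

end

section
open scoped commutatorElement

/-! ### Dihedral groups and the nilpotency class -/

section Dihedral

open DihedralGroup

/-- The commutator of a rotation with a reflection doubles the angle, so each further commutator
contributes a factor `2`. -/
theorem dihedral_lowerCentralSeries (N k : ℕ) {x : DihedralGroup N}
    (hx : x ∈ (⊤ : Subgroup (DihedralGroup N)).lowerCentralSeries (k + 1)) :
    ∃ i : ZMod N, x = r (2 ^ (k + 1) * i) := by
  let H : ℕ → Subgroup (DihedralGroup N) := fun k =>
    { carrier := {x | ∃ i : ZMod N, x = r (2 ^ (k + 1) * i)}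
      mul_mem' := by
        rintro _ _ ⟨i, rfl⟩ ⟨j, rfl⟩
        exact ⟨i + j, by rw [r_mul_r, mul_add]⟩
      one_mem' := ⟨0, by rw [mul_zero, r_zero]⟩
      inv_mem' := by
        rintro _ ⟨i, rfl⟩
        exact ⟨-i, by rw [inv_r, mul_neg]⟩ }
  have key : ∀ k, (⊤ : Subgroup (DihedralGroup N)).lowerCentralSeries (k + 1) ≤ H k := by
    intro k
    induction k with
    | zero =>
      rw [Subgroup.lowerCentralSeries_succ, Subgroup.commutator_le]
      rintro (i | i) - (j | j) -
      · exact ⟨0, by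
          rw [commutatorElement_def, inv_r, inv_r, r_mul_r, r_mul_r, r_mul_r]; congr 1; ring⟩
      · exact ⟨i, by
          rw [commutatorElement_def, inv_r, inv_sr, r_mul_sr, sr_mul_r, sr_mul_sr]; congr 1; ring⟩
      · exact ⟨-j, by
          rw [commutatorElement_def, inv_r, inv_sr, sr_mul_r, sr_mul_sr, r_mul_r]; congr 1; ring⟩
      · exact ⟨j - i, by
          rw [commutatorElement_def, inv_sr, inv_sr, sr_mul_sr, r_mul_sr, sr_mul_sr]
          congr 1; ring⟩
    | succ k ih =>
      rw [Subgroup.lowerCentralSeries_succ, Subgroup.commutator_le]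
      intro x hx y _
      obtain ⟨i, rfl⟩ := ih hx
      rcases y with j | j
      · exact ⟨0, by
          rw [commutatorElement_def, inv_r, inv_r, r_mul_r, r_mul_r, r_mul_r]; congr 1; ring⟩
      · exact ⟨i, by
          rw [commutatorElement_def, inv_r, inv_sr, r_mul_sr, sr_mul_r, sr_mul_sr]
          congr 1; ring⟩
  exact key k hx

theorem dihedral_commutator_foldl (N d : ℕ) (i : ZMod N) :
    (List.replicate d (sr 1 : DihedralGroup N)).foldl (fun x y => ⁅x, y⁆) (r i) =
      r (2 ^ d * i) := by
  induction d generalizing i with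
  | zero => simp
  | succ d ih =>
    have : ⁅(r i : DihedralGroup N), sr 1⁆ = r (2 * i) := by
      rw [commutatorElement_def, inv_r, inv_sr, r_mul_sr, sr_mul_r, sr_mul_sr]; congr 1; ring
    rw [List.replicate_succ, List.foldl_cons, this, ih]
    congr 1; ring

/-- There is a finite group of class at most `d + 1` in which an iterated commutator of two
involutions of length `d + 1` is non-trivial. -/
theorem exists_group_with_commutator (d : ℕ) : ∃ (Q : Type) (_ : Group Q) (a b : Q),
    Nat.card Q = 2 ^ (d + 2) ∧ a * a = 1 ∧ b * b = 1 ∧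
    (⊤ : Subgroup Q).lowerCentralSeries (d + 1) = ⊥ ∧
    (List.replicate d b).foldl (fun x y => ⁅x, y⁆) a ≠ 1 := by
  refine ⟨DihedralGroup (2 ^ (d + 1)), inferInstance, sr 0, sr 1, ?_, sr_mul_self 0,
    sr_mul_self 1, ?_, ?_⟩
  · rw [DihedralGroup.nat_card]; ring
  · rw [eq_bot_iff]
    intro x hx
    obtain ⟨i, rfl⟩ := dihedral_lowerCentralSeries _ d hx
    have : (2 : ZMod (2 ^ (d + 1))) ^ (d + 1) = 0 := by
      have := ZMod.natCast_self (2 ^ (d + 1))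
      push_cast at this
      exact this
    rw [this, zero_mul, r_zero]
    exact Subgroup.mem_bot.2 rfl
  · rcases d with _ | d
    · intro h
      rw [List.replicate_zero, List.foldl_nil, one_def] at h
      exact nomatch h
    · have h1 : ⁅(sr 0 : DihedralGroup (2 ^ (d + 1 + 1))), (sr 1 : DihedralGroup (2 ^ (d + 1 + 1)))⁆ = r 2 := by
        rw [commutatorElement_def, inv_sr, inv_sr, sr_mul_sr, r_mul_sr, sr_mul_sr]
        congr 1; ring
      intro h
      rw [List.replicate_succ, List.foldl_cons, h1, dihedral_commutator_foldl, one_def] at h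
      have h2 : (2 : ZMod (2 ^ (d + 1 + 1))) ^ d * 2 = 0 := by
        injection h
      have h3 : ((2 ^ (d + 1) : ℕ) : ZMod (2 ^ (d + 1 + 1))) = 0 := by
        push_cast; exact (pow_succ _ _).trans h2
      rw [ZMod.natCast_eq_zero_iff] at h3
      have h4 := Nat.le_of_dvd (by positivity) h3
      have h5 : 2 ^ (d + 1) < 2 ^ (d + 1 + 1) := Nat.pow_lt_pow_right (by norm_num) (by omega)
      omega

/-- The class of the lamp group is bounded by the class of `Q`. -/
theorem nilpotentOfClassAtMost_lampGroup {I Q : Type} [Group Q] {c : ℕ}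
    (hQ : (⊤ : Subgroup Q).lowerCentralSeries c = ⊥) (e : I → ℤ → Q) :
    NilpotentOfClassAtMost (lampGroup e) c := by
  have h1 : (⊤ : Subgroup (ℤ → Q)).lowerCentralSeries c = ⊥ := by
    rw [eq_bot_iff]
    refine (Subgroup.top_lowerCentralSeries_pi_le c).trans ?_
    rw [le_bot_iff, Subgroup.pi_eq_bot_iff]
    exact fun _ => hQ
  have h2 : (⊤ : Subgroup (I → ℤ → Q)).lowerCentralSeries c = ⊥ := by
    rw [eq_bot_iff]
    refine (Subgroup.top_lowerCentralSeries_pi_le c).trans ?_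
    rw [le_bot_iff, Subgroup.pi_eq_bot_iff]
    exact fun _ => h1
  have h3 : (⊤ : Subgroup (lampGroup e)).lowerCentralSeries c = ⊥ := by
    rw [← Subgroup.map_subtype_inj, Subgroup.map_bot, Subgroup.top_subtype_lowerCentralSeries, eq_bot_iff, ← h2]
    exact Subgroup.lowerCentralSeries_mono c le_top
  have : Group.IsNilpotent (lampGroup e) := Subgroup.nilpotent_iff_lowerCentralSeries.2 ⟨c, h3⟩
  exact ⟨this, Subgroup.lowerCentralSeries_eq_bot_iff_nilpotencyClass_le.1 h3⟩

end Dihedral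

/-! ### Choice of scales and sizes of the levels -/

section LevelData

/-- The levels: at level `l` the scale `n l` and the number of lamps `m l` are such that
`n l * m l ^ d` is comparable to `2 ^ l`, and `2 ^ l ≤ τ (n l)`. -/
theorem exists_levels {d : ℕ} {τ : ℕ → ℝ}
    (hbound : ∀ n : ℕ, 1 ≤ n → τ n ≤ (n : ℝ) ^ (d + 1)) {A : ℕ} (hA : 1 ≤ A) :
    ∃ (act : ℕ → Prop) (n m : ℕ → ℕ),
      (∀ l, act l → 1 ≤ m l ∧ m l ≤ n l ∧ A * (n l * m l ^ d) ≤ 2 ^ l ∧ (2 : ℝ) ^ l ≤ τ (n l)) ∧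
      (∀ l N, 1 ≤ N → (2 : ℝ) ^ l ≤ τ N →
        (act l ∧ n l ≤ N ∧ 2 ^ l ≤ A * 2 ^ d * (n l * m l ^ d)) ∨ 2 ^ l ≤ A * N) := by
  classical
  have h : ∀ l : ℕ, ∃ (p : Prop) (n m : ℕ),
      (p → 1 ≤ m ∧ m ≤ n ∧ A * (n * m ^ d) ≤ 2 ^ l ∧ (2 : ℝ) ^ l ≤ τ n) ∧
      (∀ N, 1 ≤ N → (2 : ℝ) ^ l ≤ τ N →
        (p ∧ n ≤ N ∧ 2 ^ l ≤ A * 2 ^ d * (n * m ^ d)) ∨ 2 ^ l ≤ A * N) := by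
    intro l
    by_cases hex : ∃ N, 1 ≤ N ∧ (2 : ℝ) ^ l ≤ τ N
    -- The least scale at which `τ` reaches `2 ^ l`, so that the level is present at every scale
    -- where it is needed and absent at smaller ones; `m` is then as large as the entropy budget `2
    -- ^ l` allows.
    · set n := Nat.find hex with hn
      obtain ⟨hn1, hnτ⟩ : 1 ≤ n ∧ (2 : ℝ) ^ l ≤ τ n := Nat.find_spec hex
      set m := Nat.findGreatest (fun m => A * (n * m ^ d) ≤ 2 ^ l) n with hm
      refine ⟨1 ≤ m ∧ A * (n * m ^ d) ≤ 2 ^ l, n, m, fun hp => ⟨hp.1, Nat.findGreatest_le n,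
        hp.2, hnτ⟩, fun N hN1 hNτ => ?_⟩
      have hnN : n ≤ N := Nat.find_min' hex ⟨hN1, hNτ⟩
      by_cases hone : A * (n * 1 ^ d) ≤ 2 ^ l
      · left
        have hm1 : 1 ≤ m := Nat.le_findGreatest hn1 hone
        have hspec : A * (n * m ^ d) ≤ 2 ^ l :=
          Nat.findGreatest_spec (P := fun m => A * (n * m ^ d) ≤ 2 ^ l) hn1 hone
        refine ⟨⟨hm1, hspec⟩, hnN, ?_⟩
        -- If `m < n`, the budget fails at `m + 1 ≤ 2 * m`, which costs the factor `2 ^ d`. If `m =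
        -- n`, the growth bound `τ n ≤ n ^ (d + 1)` says that the full size is already enough.
        rcases (Nat.findGreatest_le (P := fun m => A * (n * m ^ d) ≤ 2 ^ l) n).lt_or_eq with
          hlt | heq
        · have hnot : ¬ (A * (n * (m + 1) ^ d) ≤ 2 ^ l) :=
            Nat.findGreatest_is_greatest (P := fun m => A * (n * m ^ d) ≤ 2 ^ l)
              (Nat.lt_succ_self m) hlt
          push Not at hnot
          refine hnot.le.trans ?_
          calc A * (n * (m + 1) ^ d) ≤ A * (n * (2 * m) ^ d) := by gcongr; omega
            _ = _ := by rw [mul_pow]; ring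
        · have h1 : (2 : ℝ) ^ l ≤ (n : ℝ) ^ (d + 1) := hnτ.trans (hbound n hn1)
          have h2 : 2 ^ l ≤ n ^ (d + 1) := by exact_mod_cast h1
          have hmn : m = n := heq
          rw [hmn]
          calc 2 ^ l ≤ n ^ (d + 1) := h2
            _ = 1 * 1 * (n * n ^ d) := by ring
            _ ≤ _ := by
              gcongr
              exact Nat.one_le_two_pow
      -- Not even `m = 1` fits: the level is dropped, and `2 ^ l` is bounded by a multiple of the
      -- scale, which the lamps provide.
      · right
        rw [one_pow, mul_one] at hone
        push Not at hone
        exact hone.le.trans (Nat.mul_le_mul_left A hnN)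
    · refine ⟨False, 0, 0, fun h => h.elim, fun N hN1 hNτ => absurd ⟨N, hN1, hNτ⟩ hex⟩
  choose act n m h1 h2 using h
  exact ⟨act, n, m, h1, h2⟩

end LevelData

end

section
open scoped commutatorElement

/-! ### The generator family: sparse periodic patterns -/

section LevelFamily

variable {d : ℕ}

/-- The positions of the distinguished generators within one period. -/
def lampPos (n : ℕ) (v : Fin d → ℕ) (t : Fin (d + 1)) : ℤ :=
  5 * n * (t : ℕ) + ((Fin.cons 0 v : Fin (d + 1) → ℕ) t : ℕ)

/-- The period of a level of scale `n`. -/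
def levelPeriod (d n : ℕ) : ℕ := 5 * n * (2 * (d + 1))

theorem lampPos_zero (n : ℕ) (v : Fin d → ℕ) : lampPos n v 0 = 0 := by simp [lampPos]

theorem lampPos_succ (n : ℕ) (v : Fin d → ℕ) (s : Fin d) :
    lampPos n v s.succ = 5 * n * ((s : ℕ) + 1) + v s := by simp [lampPos]

theorem cons_zero_lt {n : ℕ} (hn : 1 ≤ n) {v : Fin d → ℕ} (hv : ∀ s, v s < n)
    (t : Fin (d + 1)) : (Fin.cons 0 v : Fin (d + 1) → ℕ) t < n := by
  refine Fin.cases ?_ (fun s => ?_) t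
  · simpa using Nat.lt_of_succ_le hn
  · simpa using hv s

theorem eq_zero_of_mul_abs_lt {n : ℕ} {z y : ℤ} (h : 5 * n * z = y) (hy : |y| < 5 * n) :
    z = 0 := by
  rw [← h, abs_mul, abs_of_nonneg (by positivity : (0 : ℤ) ≤ 5 * n)] at hy
  by_contra hz
  have : 1 ≤ |z| := Int.one_le_abs hz
  nlinarith [(Nat.cast_nonneg n : (0 : ℤ) ≤ n)]

variable {Q : Type} [Group Q]

open Classical in
/-- The generator family of one coordinate of a level of scale `n`. -/
noncomputable def levelGen (a b : Q) (n : ℕ) (v : Fin d → ℕ) (i : ℤ) : Q :=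
  if (levelPeriod d n : ℤ) ∣ i then a
  else if ∃ t, (levelPeriod d n : ℤ) ∣ i - lampPos n v t then b else 1

variable {a b : Q} {n : ℕ} {v : Fin d → ℕ}

theorem levelGen_mul_self (haa : a * a = 1) (hbb : b * b = 1) (i : ℤ) :
    levelGen a b n v i * levelGen a b n v i = 1 := by
  unfold levelGen
  split_ifs <;> simp [haa, hbb]

theorem levelGen_add_period (i : ℤ) :
    levelGen a b n v (i + levelPeriod d n) = levelGen a b n v i := by
  unfold levelGen
  have h : ∀ x : ℤ, (levelPeriod d n : ℤ) ∣ x + levelPeriod d n ↔ (levelPeriod d n : ℤ) ∣ x :=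
    fun x => dvd_add_left (dvd_refl _)
  have h1 : ∀ t, i + (levelPeriod d n : ℤ) - lampPos n v t =
    i - lampPos n v t + levelPeriod d n := fun t => by ring
  simp only [h, h1]

theorem exists_of_levelGen_ne_one {i : ℤ} (h : levelGen a b n v i ≠ 1) :
    ∃ (k : ℤ) (t : Fin (d + 1)), i = levelPeriod d n * k + lampPos n v t := by
  unfold levelGen at h
  split_ifs at h with h1 h2
  · obtain ⟨k, hk⟩ := h1
    exact ⟨k, 0, by rw [lampPos_zero, add_zero, hk]⟩
  · obtain ⟨t, k, hk⟩ := h2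
    exact ⟨k, t, by rw [← hk]; ring⟩
  · exact absurd rfl h

/-- Uniqueness of an expansion with digits in units of `5 n` and remainders in `[0, n)`. The
remainder may be off by `4 n` on either side, and block indices by less than `2 * (d + 1)`, before
an ambiguity arises. -/
theorem lampPos_congr (hn : 1 ≤ n) {v' : Fin d → ℕ} (hv' : ∀ s, v' s < n) {k k' x : ℤ}
    {t' : Fin (d + 1)} {z : ℤ} (hz : -(2 * (d : ℤ) + 2) < t' - z) (hz' : (t' : ℤ) - z < 2 * d + 2)
    (hx : -(4 * n : ℤ) ≤ x) (hx' : x < 5 * n)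
    (h : 5 * n * (2 * (d + 1)) * k + 5 * n * z + x = levelPeriod d n * k' + lampPos n v' t') :
    k = k' ∧ (t' : ℤ) = z ∧ x = (Fin.cons 0 v' : Fin (d + 1) → ℕ) t' := by
  have hc := cons_zero_lt hn hv' t'
  set y : ℕ := (Fin.cons 0 v' : Fin (d + 1) → ℕ) t'
  have h1 : 5 * (n : ℤ) * (2 * (d + 1) * (k - k') + (z - t')) = y - x := by
    have h2 : lampPos n v' t' = 5 * n * (t' : ℕ) + (y : ℤ) := rfl
    rw [h2] at h
    unfold levelPeriod at h
    push_cast at h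
    linear_combination h
  have h2 := eq_zero_of_mul_abs_lt h1 (by rw [abs_lt]; omega)
  have h3 : k - k' = 0 := by
    by_contra hne
    rcases lt_or_gt_of_ne hne with h4 | h4
    · nlinarith
    · nlinarith
  have h4 : z - t' = 0 := by rw [h3] at h2; linarith
  rw [h2, mul_zero] at h1
  exact ⟨by omega, by omega, by omega⟩

/-- Positions of non-trivial generators are far apart. -/
theorem eq_of_levelGen_ne_one (hn : 1 ≤ n) (hv : ∀ s, v s < n) {i j : ℤ}
    (hi : levelGen a b n v i ≠ 1) (hj : levelGen a b n v j ≠ 1) (hij : |i - j| < 4 * n) :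
    i = j := by
  obtain ⟨k, t, rfl⟩ := exists_of_levelGen_ne_one hi
  obtain ⟨k', t', rfl⟩ := exists_of_levelGen_ne_one hj
  have hc := cons_zero_lt hn hv t
  have ht := t.2
  have ht' := t'.2
  have e1 : lampPos n v t = 5 * n * (t : ℕ) + ((Fin.cons 0 v : Fin (d + 1) → ℕ) t : ℤ) := rfl
  rw [abs_lt] at hij
  set j := (levelPeriod d n : ℤ) * k' + lampPos n v t' with hj'
  set i := (levelPeriod d n : ℤ) * k + lampPos n v t with hi'
  obtain ⟨-, h1, h2⟩ := lampPos_congr hn hv (k := k) (k' := k') (z := (t : ℕ)) (t' := t')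
    (x := ((Fin.cons 0 v : Fin (d + 1) → ℕ) t : ℤ) - (i - j)) (by omega) (by omega) (by omega)
    (by omega) (by
      rw [← hj', hi', e1, levelPeriod]
      push_cast
      ring)
  have h3 : t' = t := Fin.ext (by omega)
  subst h3
  omega

theorem levelGen_zero : levelGen a b n v 0 = a := by
  rw [levelGen, if_pos (dvd_zero _)]

theorem levelGen_lampPos_succ (hn : 1 ≤ n) (hv : ∀ s, v s < n) (s : Fin d) :
    levelGen a b n v (lampPos n v s.succ) = b := by
  have h0 : (0 : ℤ) < lampPos n v s.succ := by rw [lampPos_succ]; positivity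
  have h1 : lampPos n v s.succ < levelPeriod d n := by
    rw [lampPos_succ, levelPeriod]
    have h2 : (v s : ℤ) < n := by exact_mod_cast hv s
    have h3 : ((s : ℕ) : ℤ) + 1 ≤ d := by have := s.2; omega
    push_cast
    nlinarith
  rw [levelGen, if_neg fun h => absurd (Int.le_of_dvd h0 h) (by omega), if_pos]
  exact ⟨s.succ, by simp⟩

/-- A full pattern of non-trivial generators determines the level coordinate. -/
theorem eq_of_forall_levelGen_ne_one (hn : 1 ≤ n) (hv : ∀ s, v s < n) {v' : Fin d → ℕ}
    (hv' : ∀ s, v' s < n) {k : ℤ} (hk : |k| < levelPeriod d n)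
    (h : ∀ t, levelGen a b n v' (k + lampPos n v t) ≠ 1) : k = 0 ∧ v = v' := by
  obtain ⟨k₀, t₀, hk₀⟩ := exists_of_levelGen_ne_one (h 0)
  rw [lampPos_zero, add_zero] at hk₀
  have hc₀ := cons_zero_lt hn hv' t₀
  have e1 : lampPos n v' t₀ = 5 * n * (t₀ : ℕ) + ((Fin.cons 0 v' : Fin (d + 1) → ℕ) t₀ : ℤ) := rfl
  have key : ∀ s : Fin d, ∃ t' : Fin (d + 1), (t' : ℤ) = (t₀ : ℕ) + ((s : ℕ) + 1 : ℤ) ∧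
      ((Fin.cons 0 v' : Fin (d + 1) → ℕ) t₀ : ℤ) + v s =
        (Fin.cons 0 v' : Fin (d + 1) → ℕ) t' := by
    intro s
    obtain ⟨k', t', hk'⟩ := exists_of_levelGen_ne_one (h s.succ)
    have ht₀ := t₀.2
    have ht' := t'.2
    have hs := s.2
    have hvs := hv s
    refine ⟨t', (lampPos_congr hn (k := k₀) (k' := k') hv' (z := (t₀ : ℕ) + ((s : ℕ) + 1 : ℤ))
      (by omega) (by omega) (x := ((Fin.cons 0 v' : Fin (d + 1) → ℕ) t₀ : ℤ) + v s)
      (by omega) (by omega) ?_).2⟩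
    rw [← hk', hk₀, e1, lampPos_succ, levelPeriod]
    push_cast
    ring
  -- If the pattern of `v` starts at place `t₀` of the pattern of `v'`, its last place falls at `t₀
  -- + d`, which must be at most `d`. The empty second half of each period excludes wrapping around.
  have ht₀ : t₀ = 0 := by
    rcases d with _ | d
    · exact Fin.eq_zero t₀
    · obtain ⟨t', ht', -⟩ := key (Fin.last d)
      have := t'.2
      apply Fin.ext
      simp only [Fin.val_last] at ht'
      simp only [Fin.val_zero]
      omega
  subst ht₀
  rw [lampPos_zero, add_zero] at hk₀
  constructor
  · rw [hk₀, abs_mul, Nat.abs_cast] at hk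
    have : |k₀| < 1 := by
      by_contra hcon
      push Not at hcon
      nlinarith [(Nat.cast_nonneg (levelPeriod d n) : (0 : ℤ) ≤ levelPeriod d n)]
    rw [hk₀, Int.abs_lt_one_iff.1 this, mul_zero]
  · funext s
    obtain ⟨t', ht', hx⟩ := key s
    have : t' = s.succ := by
      apply Fin.ext
      simp only [Fin.val_zero, Fin.val_succ] at ht' ⊢
      omega
    subst this
    simpa using hx

/-- The family of generators: one coordinate for the lamps and, for each active level, a block of
coordinates. -/
noncomputable def levelFamily (a b : Q) (act : ℕ → Prop) (n m : ℕ → ℕ) :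
    Option (ℕ × (Fin d → ℕ)) → ℤ → Q
  | none, i => if i = 0 then a else 1
  | some (l, v), i =>
    open Classical in if act l ∧ ∀ s, v s < m l then levelGen a b (n l) v i else 1

variable {act : ℕ → Prop} {n m : ℕ → ℕ}

theorem levelFamily_none (i : ℤ) :
    levelFamily (d := d) a b act n m none i = if i = 0 then a else 1 := rfl

theorem levelFamily_some {l : ℕ} {v : Fin d → ℕ} (h : act l ∧ ∀ s, v s < m l) (i : ℤ) :
    levelFamily a b act n m (some (l, v)) i = levelGen a b (n l) v i := if_pos h

theorem levelFamily_some_of_not {l : ℕ} {v : Fin d → ℕ} (h : ¬ (act l ∧ ∀ s, v s < m l)) (i : ℤ) :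
    levelFamily a b act n m (some (l, v)) i = 1 := if_neg h

theorem levelFamily_mul_self (haa : a * a = 1) (hbb : b * b = 1) (ι : Option (ℕ × (Fin d → ℕ)))
    (i : ℤ) : levelFamily a b act n m ι i * levelFamily a b act n m ι i = 1 := by
  rcases ι with _ | ⟨l, v⟩
  · rw [levelFamily_none]
    split_ifs <;> simp [haa]
  · by_cases h : act l ∧ ∀ s, v s < m l
    · rw [levelFamily_some h, levelGen_mul_self haa hbb]
    · rw [levelFamily_some_of_not h, one_mul]

theorem levelFamily_add_period (l : ℕ) (v : Fin d → ℕ) (i : ℤ) :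
    levelFamily a b act n m (some (l, v)) (i + levelPeriod d (n l)) =
      levelFamily a b act n m (some (l, v)) i := by
  by_cases h : act l ∧ ∀ s, v s < m l
  · rw [levelFamily_some h, levelFamily_some h, levelGen_add_period]
  · rw [levelFamily_some_of_not h, levelFamily_some_of_not h]

theorem lampGroup_apply_eq_one_of_not {f : Option (ℕ × (Fin d → ℕ)) → ℤ → Q} {A : Set ℤ}
    (hf : f ∈ lampSubgroup (levelFamily a b act n m) A) {l : ℕ} {v : Fin d → ℕ}
    (h : ¬ (act l ∧ ∀ s, v s < m l)) (ρ : ℤ) : f (some (l, v)) ρ = 1 :=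
  apply_eq_one_of_forall_gen (fun _ _ => levelFamily_some_of_not h _) hf

theorem lampGroup_apply_emod {f : Option (ℕ × (Fin d → ℕ)) → ℤ → Q}
    (hf : f ∈ lampGroup (levelFamily a b act n m)) (l : ℕ) (v : Fin d → ℕ) (ρ : ℤ) :
    f (some (l, v)) (ρ % levelPeriod d (n l)) = f (some (l, v)) ρ := by
  have h1 : Function.Periodic (f (some (l, v))) (levelPeriod d (n l) : ℤ) := by
    intro ρ
    induction hf using Subgroup.closure_induction with
    | mem x hx =>
      obtain ⟨i, rfl⟩ := hx
      rw [lampGen, ← add_assoc, levelFamily_add_period, lampGen]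
    | one => rfl
    | mul x y _ _ hx hy => simp only [Pi.mul_apply, hx, hy]
    | inv x _ hx => simp only [Pi.inv_apply, hx]
  have h2 := h1.int_mul (ρ / levelPeriod d (n l)) (ρ % levelPeriod d (n l))
  rw [← h2]
  congr 1
  have := Int.emod_add_mul_ediv ρ (levelPeriod d (n l))
  rw [mul_comm] at this
  simpa using this

/-- On a window that is short with respect to the scale of a level, this level is controlled by
the lamps. -/
theorem lampSubgroup_apply_eq_one {A : Set ℤ} (ha : a ≠ 1) (haa : a * a = 1) (hbb : b * b = 1)
    {l : ℕ} (hlev : act l → 1 ≤ n l ∧ m l ≤ n l)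
    (hA : act l → ∀ i ∈ A, ∀ j ∈ A, |i - j| < 4 * n l) {f : Option (ℕ × (Fin d → ℕ)) → ℤ → Q}
    (hf : f ∈ lampSubgroup (levelFamily a b act n m) A) (hlamp : ∀ i ∈ A, f none (-i) = 1)
    (v : Fin d → ℕ) (ρ : ℤ) : f (some (l, v)) ρ = 1 := by
  by_cases hact : act l ∧ ∀ s, v s < m l
  · by_cases hex : ∃ i₀ ∈ A, levelFamily a b act n m (some (l, v)) (i₀ + ρ) ≠ 1
    · obtain ⟨i₀, hi₀, hne⟩ := hex
      refine apply_eq_one_of_lamp (o := none) (i₀ := i₀) ha haa levelFamily_none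
        (levelFamily_mul_self haa hbb _ _) (fun i hi hii => ?_) hf (hlamp i₀ hi₀)
      by_contra hne'
      rw [levelFamily_some hact] at hne hne'
      obtain ⟨h1, h2⟩ := hlev hact.1
      have := eq_of_levelGen_ne_one h1 (fun s => (hact.2 s).trans_le h2) hne' hne (by
        have := hA hact.1 i hi i₀ hi₀
        rwa [add_sub_add_right_eq_sub])
      exact hii (add_right_cancel this)
    · push Not at hex
      exact apply_eq_one_of_forall_gen hex hf
  · exact lampGroup_apply_eq_one_of_not hf hact ρ

end LevelFamily

end

section
open scoped commutatorElement

/-! ### Entropy of a window, and directions supplied by lamps and levels -/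

section FolnerBounds

variable {d : ℕ} {Q : Type} [Group Q] {a b : Q} {act : ℕ → Prop} {n m : ℕ → ℕ}

theorem sum_two_pow_le {x : ℝ} (hx : 0 ≤ x) (F : Finset ℕ) (hF : ∀ l ∈ F, (2 : ℝ) ^ l ≤ x) :
    ∑ l ∈ F, (2 : ℝ) ^ l ≤ 2 * x := by
  rcases F.eq_empty_or_nonempty with rfl | hne
  · simpa using hx
  · have h1 : F ⊆ Finset.range (F.max' hne + 1) := fun l hl =>
      Finset.mem_range.2 (Nat.lt_succ_of_le (F.le_max' l hl))
    have h2 := geom_sum_eq (by norm_num : (2 : ℝ) ≠ 1) (F.max' hne + 1)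
    have h3 := hF _ (F.max'_mem hne)
    calc ∑ l ∈ F, (2 : ℝ) ^ l ≤ ∑ l ∈ Finset.range (F.max' hne + 1), (2 : ℝ) ^ l :=
          Finset.sum_le_sum_of_subset_of_nonneg h1 fun _ _ _ => by positivity
      _ = 2 * 2 ^ (F.max' hne) - 1 := by rw [h2, pow_succ]; ring
      _ ≤ 2 * x := by linarith

/-- The number of configurations in the window `[0, 4 N)`. -/
theorem card_window_le (hQ : Nat.card Q = 2 ^ (d + 2)) (ha : a ≠ 1) (haa : a * a = 1)
    (hbb : b * b = 1) {τ : ℕ → ℝ} (hmono : Monotone τ) (hnonneg : ∀ n, 0 ≤ τ n)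
    (hlev : ∀ l, act l → 1 ≤ m l ∧ m l ≤ n l ∧
      40 * (d + 1) * (d + 2) * (n l * m l ^ d) ≤ 2 ^ l ∧ (2 : ℝ) ^ l ≤ τ (n l)) (N : ℕ) :
    Finite (lampSubgroup (levelFamily (d := d) a b act n m) (Set.Ico 0 ((4 * N : ℕ) : ℤ))) ∧
    (Nat.card (lampSubgroup (levelFamily (d := d) a b act n m)
      (Set.Ico 0 ((4 * N : ℕ) : ℤ))) : ℝ) ≤ Real.exp (4 * (d + 2) * N + τ N / 2) := by
  classical
  have : Finite Q := Nat.finite_of_card_ne_zero (by rw [hQ]; positivity)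
  -- Only the active levels of scale at most `N` need coordinates of their own; since `l < 2 ^ l ≤ τ
  -- N` for these, they are finitely many.
  set F : Finset ℕ := (Finset.range (⌊τ N⌋₊ + 1)).filter fun l => act l ∧ n l ≤ N with hF
  have hFmem : ∀ l, act l → n l ≤ N → l ∈ F := by
    intro l h1 h2
    refine Finset.mem_filter.2 ⟨Finset.mem_range.2 (Nat.lt_succ_of_le (Nat.le_floor ?_)), h1, h2⟩
    have h3 : (l : ℝ) < 2 ^ l := by exact_mod_cast Nat.lt_two_pow_self
    exact h3.le.trans ((hlev l h1).2.2.2.trans (hmono h2))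
  let T₁ : Finset (Option (ℕ × (Fin d → ℕ)) × ℤ) :=
    (Finset.range (4 * N)).image fun i : ℕ => (none, -(i : ℤ))
  let T₂ : ℕ → Finset (Option (ℕ × (Fin d → ℕ)) × ℤ) := fun l =>
    ((Fintype.piFinset fun _ : Fin d => Finset.range (m l)) ×ˢ
      Finset.range (levelPeriod d (n l))).image fun y => (some (l, y.1), (y.2 : ℤ))
  have hT₂ : ∀ l, (T₂ l).card ≤ m l ^ d * levelPeriod d (n l) := by
    intro l
    refine Finset.card_image_le.trans ?_
    rw [Finset.card_product, Fintype.card_piFinset, Finset.card_range]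
    simp
  have hT : (T₁ ∪ F.biUnion T₂).card ≤ 4 * N + ∑ l ∈ F, m l ^ d * levelPeriod d (n l) := by
    refine (Finset.card_union_le _ _).trans (add_le_add ?_ ?_)
    · exact Finset.card_image_le.trans (Finset.card_range _).le
    · exact Finset.card_biUnion_le.trans (Finset.sum_le_sum fun l _ => hT₂ l)
  obtain ⟨hfin, hcard⟩ := finite_and_card_le_of_coordinates
    (lampSubgroup (levelFamily (d := d) a b act n m) (Set.Ico 0 ((4 * N : ℕ) : ℤ)))
    (T₁ ∪ F.biUnion T₂) (by
      intro f hf hf1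
      have hlamp : ∀ i ∈ Set.Ico (0 : ℤ) ((4 * N : ℕ) : ℤ), f none (-i) = 1 := by
        intro i hi
        refine hf1 (none, -i) (Finset.mem_union_left _ (Finset.mem_image.2 ⟨i.toNat, ?_, ?_⟩))
        · rw [Finset.mem_range]
          have := hi.1; have := hi.2
          omega
        · rw [Int.toNat_of_nonneg hi.1]
      funext ι ρ
      rcases ι with _ | ⟨l, v⟩
      · by_cases hρ : -ρ ∈ Set.Ico (0 : ℤ) ((4 * N : ℕ) : ℤ)
        · simpa using hlamp _ hρ
        · simpa using lamp_eq_one_of_notMem (o := none) levelFamily_none hf hρ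
      · by_cases hact : act l ∧ ∀ s, v s < m l
        · by_cases hn : n l ≤ N
          · rw [← lampGroup_apply_emod (lampSubgroup_le _ _ hf)]
            have hp : 0 < levelPeriod d (n l) := by
              have := (hlev l hact.1).1
              have := (hlev l hact.1).2.1
              unfold levelPeriod
              exact Nat.mul_pos (by omega) (by omega)
            have h0 := Int.emod_nonneg ρ (b := levelPeriod d (n l)) (by omega)
            have h1 := Int.emod_lt_of_pos ρ (b := levelPeriod d (n l)) (by omega)
            refine hf1 (some (l, v), ρ % levelPeriod d (n l)) (Finset.mem_union_right _
              (Finset.mem_biUnion.2 ⟨l, hFmem l hact.1 hn, Finset.mem_image.2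
                ⟨(v, (ρ % levelPeriod d (n l)).toNat), Finset.mem_product.2 ⟨?_, ?_⟩, ?_⟩⟩))
            · exact Fintype.mem_piFinset.2 fun s => Finset.mem_range.2 (hact.2 s)
            · rw [Finset.mem_range]; omega
            · rw [Int.toNat_of_nonneg h0]
          · refine lampSubgroup_apply_eq_one ha haa hbb (fun h => ⟨?_, (hlev l h).2.1⟩)
              (fun _ i hi j hj => ?_) hf hlamp v ρ
            · exact (hlev l h).1.trans (hlev l h).2.1
            · have := hi.1; have := hi.2; have := hj.1; have := hj.2
              push_cast at *
              rw [abs_lt]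
              constructor <;> omega
        · exact lampGroup_apply_eq_one_of_not hf hact ρ)
  refine ⟨hfin, ?_⟩
  rw [hQ, ← pow_mul] at hcard
  have h2 : (2 : ℝ) ≤ Real.exp 1 := by linarith [Real.add_one_le_exp 1]
  -- Each coordinate carries `d + 2` bits and level `l` has `10 * (d + 1) * n * m ^ d` of them, so
  -- the factor `40` leaves `2 ^ l / 4` per level. Summing powers of two below `τ N` gives `τ N /
  -- 2`.
  have hsum : ((d : ℝ) + 2) * ∑ l ∈ F, ((m l ^ d * levelPeriod d (n l) : ℕ) : ℝ) ≤ τ N / 2 := by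
    have h3 := sum_two_pow_le (hnonneg N) F fun l hl =>
      (hlev l (Finset.mem_filter.1 hl).2.1).2.2.2.trans (hmono (Finset.mem_filter.1 hl).2.2)
    have h4 : ((d : ℝ) + 2) * ∑ l ∈ F, ((m l ^ d * levelPeriod d (n l) : ℕ) : ℝ) ≤
        ∑ l ∈ F, (2 : ℝ) ^ l / 4 := by
      rw [Finset.mul_sum]
      refine Finset.sum_le_sum fun l hl => ?_
      have h5 : ((40 * (d + 1) * (d + 2) * (n l * m l ^ d) : ℕ) : ℝ) ≤ ((2 ^ l : ℕ) : ℝ) := by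
        exact_mod_cast (hlev l (Finset.mem_filter.1 hl).2.1).2.2.1
      unfold levelPeriod
      push_cast at h5 ⊢
      linarith
    rw [← Finset.sum_div] at h4
    linarith
  calc _ ≤ ((2 ^ ((d + 2) * (T₁ ∪ F.biUnion T₂).card) : ℕ) : ℝ) := by exact_mod_cast hcard
    _ ≤ (Real.exp 1) ^ ((d + 2) * (T₁ ∪ F.biUnion T₂).card) := by
      push_cast
      gcongr
    _ = Real.exp (((d + 2) * (T₁ ∪ F.biUnion T₂).card : ℕ) : ℝ) := by
      rw [← Real.exp_nat_mul, mul_one]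
    _ ≤ _ := by
      apply Real.exp_le_exp.2
      have h5 : ((T₁ ∪ F.biUnion T₂).card : ℝ) ≤
          4 * N + ∑ l ∈ F, ((m l ^ d * levelPeriod d (n l) : ℕ) : ℝ) := by exact_mod_cast hT
      push_cast at h5 hsum ⊢
      nlinarith

/-- The window of length `4 * N` gives boundary ratio `1 / (2 * N)`, and the entropy has only `τ N /
2`: both have a factor two to spare, which is used up by a product of two such sets. -/
theorem exists_folnerSet_levelFamily (hQ : Nat.card Q = 2 ^ (d + 2)) (ha : a ≠ 1)
    (haa : a * a = 1) (hbb : b * b = 1) {τ : ℕ → ℝ} (hmono : Monotone τ) (hnonneg : ∀ n, 0 ≤ τ n)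
    (hlev : ∀ l, act l → 1 ≤ m l ∧ m l ≤ n l ∧
      40 * (d + 1) * (d + 2) * (n l * m l ^ d) ≤ 2 ^ l ∧ (2 : ℝ) ^ l ≤ τ (n l)) {N : ℕ}
    (hN : 1 ≤ N) :
    ∃ V : Finset (ShiftGroup (levelFamily (d := d) a b act n m)), V.Nonempty ∧
      ((wordBoundary (shiftGens (levelFamily (d := d) a b act n m))
        (V : Set (ShiftGroup (levelFamily (d := d) a b act n m)))).ncard : ℝ) / V.card ≤
          1 / (2 * N) ∧
      (V.card : ℝ) ≤ 4 * N * Real.exp (4 * (d + 2) * N + τ N / 2) := by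
  obtain ⟨hfin, hB⟩ := card_window_le hQ ha haa hbb hmono hnonneg hlev N
  obtain ⟨V, hV, hcard, hbd⟩ := exists_folnerSet (levelFamily (d := d) a b act n m)
    (W := 4 * N) (by omega)
  refine ⟨V, hV, ?_, ?_⟩
  · have h1 : 0 < (V.card : ℝ) := by exact_mod_cast hV.card_pos
    have h2 : (V.card : ℝ) = 4 * N * (Nat.card (lampSubgroup (levelFamily (d := d) a b act n m)
      (Set.Ico 0 ((4 * N : ℕ) : ℤ))) : ℝ) := by rw [hcard]; push_cast; ring
    have h3 : ((wordBoundary (shiftGens (levelFamily (d := d) a b act n m))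
        (V : Set (ShiftGroup (levelFamily (d := d) a b act n m)))).ncard : ℝ) ≤
        2 * (Nat.card (lampSubgroup (levelFamily (d := d) a b act n m)
      (Set.Ico 0 ((4 * N : ℕ) : ℤ))) : ℝ) := by exact_mod_cast hbd
    have h4 : (1 : ℝ) ≤ N := by exact_mod_cast hN
    rw [div_le_div_iff₀ h1 (by positivity)]
    rw [h2]
    nlinarith
  · rw [hcard]
    push_cast
    gcongr
    exact_mod_cast hB

variable {Γ : Type*} [Group Γ] {S : Finset Γ}

/-- The linear part of the lower bound: single lamps near the cursor are independent directions. -/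
theorem two_rpow_lamps_le_folnerFunction (ha : a ≠ 1)
    (p : Γ →* ShiftGroup (levelFamily (d := d) a b act n m))
    (j : ShiftGroup (levelFamily (d := d) a b act n m) →* Γ) (hpj : ∀ g, p (j g) = g)
    (hj : ∀ s ∈ genLetters (shiftGens (levelFamily (d := d) a b act n m)), j s ∈ genLetters S)
    {N : ℕ} (hN : 1 ≤ N) (hne : ∃ V : Finset Γ, V.Nonempty ∧
      ((wordBoundary S (V : Set Γ)).ncard : ℝ) / V.card ≤ 1 / N) :
    (2 : ℝ) ^ ((((N - 1) / 4 : ℕ) : ℝ) / 4) ≤ folnerFunction S N := by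
  have := two_rpow_le_folnerFunction_of_coordinates p j hpj hj (J := Fin ((N - 1) / 4))
    (fun k => lampElt _ (k : ℕ)) (fun k => (none, -((k : ℕ) : ℤ))) ?_ (r := 2 * ((N - 1) / 4))
    (fun k => (hasWord_lampElt _).mono ?_) (by omega) hne
  · rwa [Fintype.card_fin] at this
  · intro i k
    change levelFamily (d := d) a b act n m none (((i : ℕ) : ℤ) + -((k : ℕ) : ℤ)) = 1 ↔ _
    rw [levelFamily_none]
    constructor
    · rintro h rfl
      rw [if_pos (by ring)] at h
      exact ha h
    · intro h
      rw [if_neg]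
      intro h1
      exact h (Fin.ext (by omega))
  · have := k.2
    omega

/-- The directions are the iterated commutators of the generators at the places of the pattern of
`v`, shifted by `k` modulo the period. Evaluated at a level coordinate, such a commutator is
non-trivial only if all its entries are, which singles out `(v, k)`. -/
theorem two_rpow_level_le_folnerFunction
    (hab : (List.replicate d b).foldl (fun x y => ⁅x, y⁆) a ≠ 1) {l : ℕ} (hact : act l)
    (hn : 1 ≤ n l) (hm : m l ≤ n l)
    (p : Γ →* ShiftGroup (levelFamily (d := d) a b act n m))
    (j : ShiftGroup (levelFamily (d := d) a b act n m) →* Γ) (hpj : ∀ g, p (j g) = g)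
    (hj : ∀ s ∈ genLetters (shiftGens (levelFamily (d := d) a b act n m)), j s ∈ genLetters S)
    {N : ℕ} (hN : 60 * (d + 1) * 4 ^ d * n l < N) (hne : ∃ V : Finset Γ, V.Nonempty ∧
      ((wordBoundary S (V : Set Γ)).ncard : ℝ) / V.card ≤ 1 / N) :
    (2 : ℝ) ^ (((m l ^ d * levelPeriod d (n l) : ℕ) : ℝ) / 4) ≤ folnerFunction S N := by
  let e := levelFamily (d := d) a b act n m
  let J := (Fin d → Fin (m l)) × Fin (levelPeriod d (n l))
  let w : J → Fin d → ℕ := fun i s => i.1 s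
  have hwm : ∀ i s, w i s < m l := fun i s => (i.1 s).2
  have hwn : ∀ i s, w i s < n l := fun i s => (hwm i s).trans_le hm
  let u : J → lampGroup e := fun i => (List.ofFn fun s : Fin d =>
    lampElt e (lampPos (n l) (w i) s.succ - (i.2 : ℕ))).foldl (fun x y => ⁅x, y⁆)
      (lampElt e (-((i.2 : ℕ) : ℤ)))
  have hval : ∀ (i k : J), (u i : Option (ℕ × (Fin d → ℕ)) → ℤ → Q) (some (l, w k)) ((k.2 : ℕ)) =
      (List.ofFn fun s : Fin d => levelGen a b (n l) (w k)
        (((k.2 : ℕ) - (i.2 : ℕ) : ℤ) + lampPos (n l) (w i) s.succ)).foldl (fun x y => ⁅x, y⁆)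
        (levelGen a b (n l) (w k) ((k.2 : ℕ) - (i.2 : ℕ) : ℤ)) := by
    intro i k
    let ev : lampGroup e →* Q :=
      { toFun := fun f => (f : Option (ℕ × (Fin d → ℕ)) → ℤ → Q) (some (l, w k)) ((k.2 : ℕ))
        map_one' := rfl
        map_mul' := fun _ _ => rfl }
    have hev : ∀ z, ev (lampElt e z) = levelGen a b (n l) (w k) (z + (k.2 : ℕ)) := fun z =>
      levelFamily_some ⟨hact, hwm k⟩ _
    change ev (u i) = _
    rw [map_commutator_foldl, hev, List.map_ofFn]
    congr 2
    · ring
    · funext s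
      rw [Function.comp_apply, hev]
      congr 1; ring
  have := two_rpow_le_folnerFunction_of_coordinates p j hpj hj (J := J) u
    (fun k => (some (l, w k), ((k.2 : ℕ) : ℤ))) ?_ (r := 4 ^ d * (3 * levelPeriod d (n l)))
    ?_ ?_ hne
  · simpa [J] using this
  · intro i k
    rw [hval]
    constructor
    · rintro h rfl
      apply hab
      rw [← h, sub_self, levelGen_zero]
      congr 1
      rw [← List.ofFn_const]
      congr 1
      funext s
      rw [zero_add, levelGen_lampPos_succ hn (hwn _)]
    -- A trivial entry would trivialise the commutator, so a non-trivial value exhibits a full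
    -- pattern, and this determines both the shift and the level coordinate.
    · intro hki
      by_contra hne1
      apply hki
      have hall : ∀ t, levelGen a b (n l) (w k)
          (((k.2 : ℕ) - (i.2 : ℕ) : ℤ) + lampPos (n l) (w i) t) ≠ 1 := by
        intro t
        refine Fin.cases ?_ (fun s => ?_) t
        · intro h1
          rw [lampPos_zero, add_zero] at h1
          rw [h1, commutator_foldl_one] at hne1
          exact hne1 rfl
        · intro h1
          exact hne1 (commutator_foldl_of_mem_one _ ((List.mem_ofFn).2 ⟨s, h1⟩) _)
      have hk2 := k.2.2
      have hi2 := i.2.2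
      obtain ⟨h1, h2⟩ := eq_of_forall_levelGen_ne_one hn (hwn i) (hwn k)
        (by rw [abs_lt]; omega) hall
      refine Prod.ext ?_ (Fin.ext (by omega))
      funext s
      exact Fin.ext (congrFun h2 s).symm
  · intro i
    have hp : 1 ≤ levelPeriod d (n l) := by
      unfold levelPeriod
      exact Nat.mul_pos (by omega) (by omega)
    have hi2 := i.2.2
    change HasWord _ _ (lampIncl e (u i))
    have := HasWord.commutator_foldl (S := shiftGens e) (w := 3 * levelPeriod d (n l)) le_rfl
      (g := lampIncl e (lampElt e (-((i.2 : ℕ) : ℤ))))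
      ((hasWord_lampElt _).mono (by rw [Int.natAbs_neg, Int.natAbs_natCast]; omega))
      ((List.ofFn fun s : Fin d =>
        lampElt e (lampPos (n l) (w i) s.succ - (i.2 : ℕ))).map (lampIncl e)) (by
        intro x hx
        obtain ⟨y, hy, rfl⟩ := List.mem_map.1 hx
        obtain ⟨s, rfl⟩ := (List.mem_ofFn).1 hy
        refine (hasWord_lampElt _).mono ?_
        have h1 : (0 : ℤ) ≤ lampPos (n l) (w i) s.succ := by rw [lampPos_succ]; positivity
        have h2 : lampPos (n l) (w i) s.succ ≤ levelPeriod d (n l) := by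
          rw [lampPos_succ, levelPeriod]
          have h3 : (w i s : ℤ) < n l := by exact_mod_cast hwn i s
          have h4 : ((s : ℕ) : ℤ) + 1 ≤ d := by have := s.2; omega
          push_cast
          nlinarith
        omega)
    rw [← map_commutator_foldl] at this
    simpa using this
  · refine lt_of_le_of_lt (le_of_eq ?_) hN
    unfold levelPeriod
    ring

end FolnerBounds

end

section
open scoped commutatorElement

/-! ### From bounds at all scales to the two-sided estimate; Følner sets in products -/

section Assembly

/-- The estimate of the Følner function from upper and lower bounds at all scales. -/
theorem exists_folnerEstimate {Γ : Type*} [Group Γ] {S : Finset Γ} {τ : ℕ → ℝ}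
    (hmono : Monotone τ) (hτ : τ 1 ≤ 1) {A B D K : ℕ}
    (hU : ∀ N : ℕ, 1 ≤ N → ∃ V : Finset Γ, V.Nonempty ∧
      ((wordBoundary S (V : Set Γ)).ncard : ℝ) / V.card ≤ 1 / N ∧
      (V.card : ℝ) ≤ 16 * N ^ 2 * Real.exp (D * N + τ N))
    (hS : ∃ s ∈ genLetters S, s ≠ 1)
    (hL : ∀ N : ℕ, 1 ≤ N → (2 : ℝ) ^ ((((N - 1) / 4 : ℕ) : ℝ) / 4) ≤ folnerFunction S N)
    (hlev : ∀ l N M : ℕ, 1 ≤ N → (2 : ℝ) ^ l ≤ τ N → K * N < M →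
      (∃ x : ℝ, (2 : ℝ) ^ l ≤ B * x ∧ (2 : ℝ) ^ x ≤ folnerFunction S M) ∨ 2 ^ l ≤ A * N) :
    ∃ C : ℝ, 1 < C ∧ FolnerEstimate S τ C := by
  set C : ℝ := 2 * (21 + 2 * B + 40 * A) + K + 16 + D with hC
  have hA0 : (0 : ℝ) ≤ A := A.cast_nonneg
  have hB0 : (0 : ℝ) ≤ B := B.cast_nonneg
  have hD0 : (0 : ℝ) ≤ D := D.cast_nonneg
  have hK0 : (0 : ℝ) ≤ K := K.cast_nonneg
  have hCpos : 0 < C := by positivity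
  refine ⟨C, by linarith, fun N hN => ?_, fun N hN => ?_⟩
  · obtain ⟨V, hV, hbd, hcard⟩ := hU N hN
    have h1 : (folnerFunction S N : ℝ) ≤ V.card := by exact_mod_cast folnerFunction_le_card hV hbd
    have hN' : (1 : ℝ) ≤ N := by exact_mod_cast hN
    have h2 : (N : ℝ) ≤ Real.exp N := by linarith [Real.add_one_le_exp (N : ℝ)]
    calc (folnerFunction S N : ℝ) ≤ 16 * N ^ 2 * Real.exp (D * N + τ N) := h1.trans hcard
      _ = 16 * N * (N * Real.exp (D * N + τ N)) := by ring
      _ ≤ 16 * N * (Real.exp N * Real.exp (D * N + τ N)) := by gcongr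
      _ = 16 * N * Real.exp ((D + 1) * N + τ N) := by rw [← Real.exp_add]; ring_nf
      _ ≤ C * N * Real.exp (C * N + τ N) := by
        gcongr
        · linarith
        · linarith
  · obtain ⟨V, hV, hbd, -⟩ := hU N (by omega)
    have hF2 : (2 : ℝ) ≤ folnerFunction S N := by
      exact_mod_cast two_le_folnerFunction hS hN ⟨V, hV, hbd⟩
    set F : ℝ := (folnerFunction S N : ℝ) with hF
    have hFpos : 0 < F := by linarith
    set x : ℝ := Real.logb 2 F with hx
    have h2x : (2 : ℝ) ^ x = F := Real.rpow_logb (by norm_num) (by norm_num) hFpos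
    have hle : ∀ y : ℝ, (2 : ℝ) ^ y ≤ F → y ≤ x := fun y hy =>
      (Real.le_logb_iff_rpow_le (by norm_num) hFpos).2 hy
    have hx1 : 1 ≤ x := hle 1 (by simpa using hF2)
    -- With `F = 2 ^ x`, the lamps bound `N` by `16 * x + 4`; the additive constant is absorbed
    -- because the Følner function is at least `2`, that is `x ≥ 1`.
    have hNx : (N : ℝ) ≤ 20 * x := by
      have h1 := hle _ (hL N (by omega))
      have h2 : N ≤ 4 * ((N - 1) / 4) + 4 := by omega
      have h3 : (N : ℝ) ≤ 4 * ((N - 1) / 4 : ℕ) + 4 := by exact_mod_cast h2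
      linarith
    have hNC : ((⌊(N : ℝ) / C⌋₊ : ℕ) : ℝ) ≤ N / C := Nat.floor_le (by positivity)
    set N' := ⌊(N : ℝ) / C⌋₊ with hN'
    have hNC' : (N' : ℝ) * C ≤ N := (le_div_iff₀ hCpos).1 hNC
    -- Take `l` with `2 ^ l ≤ τ N' < 2 ^ (l + 1)`. Either this level supplies `2 * B * x`, or `2 ^
    -- l` is at most `A * N'` and the bound `N ≤ 20 * x` gives `40 * A * x`. As `C > K`, the words
    -- needed at scale `N'` are short enough for `N`.
    have hτN : τ N' ≤ (1 + 2 * B + 40 * A) * x := by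
      by_cases hτ1 : τ N' ≤ 1
      · nlinarith [mul_nonneg hA0 (zero_le_one.trans hx1), mul_nonneg hB0 (zero_le_one.trans hx1)]
      · push Not at hτ1
        have hN1 : 1 ≤ N' := by
          by_contra h
          have h0 : N' ≤ 1 := by omega
          linarith [hmono h0]
        obtain ⟨l, hl1, hl2⟩ := exists_nat_pow_near hτ1.le (by norm_num : (1 : ℝ) < 2)
        have hKN : K * N' < N := by
          have h1 : (1 : ℝ) ≤ N' := by exact_mod_cast hN1
          have h2 : (K : ℝ) * N' < N := by nlinarith
          exact_mod_cast h2
        rw [pow_succ] at hl2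
        rcases hlev l N' N hN1 hl1 hKN with ⟨y, hy1, hy2⟩ | h
        · have h1 := hle y hy2
          have h2 := mul_le_mul_of_nonneg_left h1 hB0
          nlinarith [mul_nonneg hA0 (zero_le_one.trans hx1)]
        · have h1 : (2 : ℝ) ^ l ≤ A * N' := by exact_mod_cast h
          have h2 : (N' : ℝ) ≤ N := by
            have : (0 : ℝ) ≤ N' := N'.cast_nonneg
            nlinarith
          have h3 := mul_le_mul_of_nonneg_left (h2.trans hNx) hA0
          nlinarith [mul_nonneg hB0 (zero_le_one.trans hx1)]
    have hlog : (1 : ℝ) / 2 ≤ Real.log 2 := by linarith [Real.log_two_gt_d9]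
    rw [← h2x, Real.rpow_def_of_pos (by norm_num)]
    apply Real.exp_le_exp.2
    have h1 : (N : ℝ) + τ N' ≤ (21 + 2 * B + 40 * A) * x := by linarith
    have h2 : (21 + 2 * B + 40 * A) ≤ C / 2 := by linarith
    have h3 : (N : ℝ) + τ N' ≤ C / 2 * x :=
      h1.trans (mul_le_mul_of_nonneg_right h2 (zero_le_one.trans hx1))
    calc 1 / C * (N + τ N') ≤ 1 / C * (C / 2 * x) := by gcongr
      _ = 1 / 2 * x := by field_simp
      _ ≤ _ := by gcongr

variable {G₁ G₂ : Type*} [Group G₁] [Group G₂] {S₁ : Finset G₁} {S₂ : Finset G₂}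

theorem mem_prodGenerators {x : G₁ × G₂} :
    x ∈ prodGenerators S₁ S₂ ↔ (x.1 ∈ S₁ ∧ x.2 = 1) ∨ (x.1 = 1 ∧ x.2 ∈ S₂) := by
  rw [prodGenerators, @Finset.mem_union _ (Classical.decEq (G₁ × G₂)), Finset.mem_product,
    Finset.mem_product, Finset.mem_singleton, Finset.mem_singleton]

theorem mem_genLetters_prodGenerators {x : G₁ × G₂} :
    x ∈ genLetters (prodGenerators S₁ S₂) ↔
      (x.1 ∈ genLetters S₁ ∧ x.2 = 1) ∨ (x.1 = 1 ∧ x.2 ∈ genLetters S₂) := by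
  simp only [genLetters, Set.mem_ofPred_eq, mem_prodGenerators, Prod.fst_inv, Prod.snd_inv,
    inv_eq_one]
  tauto

theorem ncard_wordBoundary_product_le {V₁ : Finset G₁} {V₂ : Finset G₂} (h₁ : V₁.Nonempty)
    (h₂ : V₂.Nonempty) {ε₁ ε₂ : ℝ}
    (hb₁ : ((wordBoundary S₁ (V₁ : Set G₁)).ncard : ℝ) / V₁.card ≤ ε₁)
    (hb₂ : ((wordBoundary S₂ (V₂ : Set G₂)).ncard : ℝ) / V₂.card ≤ ε₂) :
    ((wordBoundary (prodGenerators S₁ S₂) ((V₁ ×ˢ V₂ : Finset (G₁ × G₂)) : Set (G₁ × G₂))).ncard :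
      ℝ) / (V₁ ×ˢ V₂).card ≤ ε₁ + ε₂ := by
  have hc₁ : (0 : ℝ) < V₁.card := by exact_mod_cast h₁.card_pos
  have hc₂ : (0 : ℝ) < V₂.card := by exact_mod_cast h₂.card_pos
  have hsub : wordBoundary (prodGenerators S₁ S₂)
      ((V₁ ×ˢ V₂ : Finset (G₁ × G₂)) : Set (G₁ × G₂)) ⊆
      (wordBoundary S₁ (V₁ : Set G₁) ×ˢ (V₂ : Set G₂)) ∪
        ((V₁ : Set G₁) ×ˢ wordBoundary S₂ (V₂ : Set G₂)) := by
    rintro ⟨v₁, v₂⟩ hv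
    obtain ⟨hvV, ⟨s₁, s₂⟩, hs, hvs⟩ := exists_letter_of_mem_wordBoundary hv
    rw [Finset.coe_product] at hvV hvs
    rcases mem_genLetters_prodGenerators.1 hs with ⟨h, h'⟩ | ⟨h', h⟩
    · obtain rfl : s₂ = 1 := h'
      refine Or.inl ⟨mem_wordBoundary_of_mul_notMem hvV.1 h fun h3 => hvs ⟨h3, ?_⟩, hvV.2⟩
      simpa using hvV.2
    · obtain rfl : s₁ = 1 := h'
      refine Or.inr ⟨hvV.1, mem_wordBoundary_of_mul_notMem hvV.2 h fun h3 => hvs ⟨?_, h3⟩⟩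
      simpa using hvV.1
  have hcard := (Set.ncard_le_ncard hsub
    (((finite_wordBoundary S₁ V₁).prod V₂.finite_toSet).union
      (V₁.finite_toSet.prod (finite_wordBoundary S₂ V₂)))).trans (Set.ncard_union_le _ _)
  rw [Set.ncard_prod, Set.ncard_prod, Set.ncard_coe_finset, Set.ncard_coe_finset] at hcard
  rw [div_le_iff₀ hc₁] at hb₁
  rw [div_le_iff₀ hc₂] at hb₂
  rw [Finset.card_product, Nat.cast_mul, div_le_iff₀ (by positivity)]
  have h3 : ((wordBoundary (prodGenerators S₁ S₂)
      ((V₁ ×ˢ V₂ : Finset (G₁ × G₂)) : Set (G₁ × G₂))).ncard : ℝ) ≤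
      (wordBoundary S₁ (V₁ : Set G₁)).ncard * V₂.card +
        V₁.card * (wordBoundary S₂ (V₂ : Set G₂)).ncard := by exact_mod_cast hcard
  have h4 := mul_le_mul_of_nonneg_right hb₁ hc₂.le
  have h5 := mul_le_mul_of_nonneg_left hb₂ hc₁.le
  linarith

end Assembly

/-! ### The estimate for a single group and for two factors sharing the levels -/

section Families

variable {d : ℕ} {Q : Type} [Group Q] {a b : Q} {act : ℕ → Prop} {n m : ℕ → ℕ}

theorem lampIncl_lampElt_zero_ne_one (ha : a ≠ 1) :
    lampIncl (levelFamily (d := d) a b act n m) (lampElt _ 0) ≠ 1 := by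
  intro h
  have h1 : lampElt (levelFamily (d := d) a b act n m) 0 = 1 :=
    SemidirectProduct.inl_injective (h.trans (map_one _).symm)
  have h2 := congrArg (fun f : lampGroup (levelFamily (d := d) a b act n m) =>
    (f : Option (ℕ × (Fin d → ℕ)) → ℤ → Q) none 0) h1
  exact ha (by simpa [lampElt, lampGen, levelFamily_none] using h2)

variable {τ : ℕ → ℝ} (hQ : Nat.card Q = 2 ^ (d + 2)) (haa : a * a = 1) (hbb : b * b = 1)
  (hab : (List.replicate d b).foldl (fun x y => ⁅x, y⁆) a ≠ 1)
  (hmono : Monotone τ) (hnonneg : ∀ n, 0 ≤ τ n) (hτ : τ 1 ≤ 1)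
  (hlev : ∀ l, act l → 1 ≤ m l ∧ m l ≤ n l ∧
    40 * (d + 1) * (d + 2) * (n l * m l ^ d) ≤ 2 ^ l ∧ (2 : ℝ) ^ l ≤ τ (n l))
  (hlev' : ∀ l N, 1 ≤ N → (2 : ℝ) ^ l ≤ τ N →
    (act l ∧ n l ≤ N ∧ 2 ^ l ≤ 40 * (d + 1) * (d + 2) * 2 ^ d * (n l * m l ^ d)) ∨
      2 ^ l ≤ 40 * (d + 1) * (d + 2) * N)

theorem ne_one_of_commutator_foldl_ne_one {G : Type*} [Group G] {a : G} {l : List G}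
    (h : l.foldl (fun x y => ⁅x, y⁆) a ≠ 1) : a ≠ 1 := by
  rintro rfl
  exact h (commutator_foldl_one l)

theorem two_pow_le_of_level {A B l k m n : ℕ} (hB : 2 ^ l ≤ A * B * (n * m ^ k)) :
    (2 : ℝ) ^ l ≤ (A * B : ℕ) * (((m ^ k * levelPeriod k n : ℕ) : ℝ) / 4) := by
  have h1 : (2 : ℝ) ^ l ≤ (A * B : ℕ) * ((n : ℝ) * m ^ k) := by exact_mod_cast hB
  refine h1.trans (mul_le_mul_of_nonneg_left ?_ (Nat.cast_nonneg _))
  unfold levelPeriod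
  push_cast
  have h2 : 0 ≤ (n : ℝ) * m ^ k := by positivity
  have h3 : 0 ≤ (n : ℝ) * m ^ k * k := by positivity
  nlinarith

include hQ haa hbb hab hmono hnonneg hτ hlev hlev' in
theorem exists_folnerEstimate_levelFamily :
    ∃ C : ℝ, 1 < C ∧ FolnerEstimate (shiftGens (levelFamily (d := d) a b act n m)) τ C := by
  have ha := ne_one_of_commutator_foldl_ne_one hab
  have hU : ∀ N : ℕ, 1 ≤ N → ∃ V : Finset (ShiftGroup (levelFamily (d := d) a b act n m)),
      V.Nonempty ∧
      ((wordBoundary (shiftGens (levelFamily (d := d) a b act n m))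
        (V : Set (ShiftGroup (levelFamily (d := d) a b act n m)))).ncard : ℝ) / V.card ≤ 1 / N ∧
      (V.card : ℝ) ≤ 16 * N ^ 2 * Real.exp ((8 * (d + 2) : ℕ) * N + τ N) := by
    intro N hN
    obtain ⟨V, hV, hbd, hcard⟩ := exists_folnerSet_levelFamily hQ ha haa hbb hmono hnonneg hlev hN
    have hN' : (1 : ℝ) ≤ N := by exact_mod_cast hN
    refine ⟨V, hV, hbd.trans ?_, hcard.trans ?_⟩
    · apply one_div_le_one_div_of_le <;> linarith
    · have h1 : (4 * N : ℝ) ≤ 16 * N ^ 2 := by nlinarith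
      have h2 := hnonneg N
      push_cast
      gcongr
      · linarith
      · linarith
  refine exists_folnerEstimate hmono hτ (A := 40 * (d + 1) * (d + 2))
    (B := 40 * (d + 1) * (d + 2) * 2 ^ d) (K := 60 * (d + 1) * 4 ^ d) hU
    ⟨_, Or.inl (mem_shiftGens.2 (Or.inl rfl)), lampIncl_lampElt_zero_ne_one ha⟩ ?_ ?_
  · intro N hN
    obtain ⟨V, hV, hbd, -⟩ := hU N hN
    exact two_rpow_lamps_le_folnerFunction ha (MonoidHom.id _) (MonoidHom.id _) (fun _ => rfl)
      (fun _ h => h) hN ⟨V, hV, hbd⟩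
  · intro l N M hN hl hM
    refine (hlev' l N hN hl).imp_left fun ⟨hact, hnN, hB⟩ => ⟨_, two_pow_le_of_level hB, ?_⟩
    obtain ⟨V, hV, hbd, -⟩ := hU M (by omega)
    obtain ⟨h1, h2, -⟩ := hlev l hact
    exact two_rpow_level_le_folnerFunction hab hact (h1.trans h2) h2 (MonoidHom.id _)
      (MonoidHom.id _) (fun _ => rfl) (fun _ h => h)
      (lt_of_le_of_lt (Nat.mul_le_mul_left _ hnN) hM) ⟨V, hV, hbd⟩

include hQ haa hbb hab hmono hnonneg hτ hlev hlev' in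
/-- The levels may be distributed over the two factors of a direct product. -/
theorem exists_folnerEstimate_prod {A₁ A₂ : ℕ → Prop} (hA : ∀ l, A₁ l ∨ A₂ l) :
    ∃ C : ℝ, 1 < C ∧ FolnerEstimate (prodGenerators
      (shiftGens (levelFamily (d := d) a b (fun l => act l ∧ A₁ l) n m))
      (shiftGens (levelFamily (d := d) a b (fun l => act l ∧ A₂ l) n m))) τ C := by
  have ha := ne_one_of_commutator_foldl_ne_one hab
  let e₁ := levelFamily (d := d) a b (fun l => act l ∧ A₁ l) n m
  let e₂ := levelFamily (d := d) a b (fun l => act l ∧ A₂ l) n m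
  have hj₁ : ∀ s ∈ genLetters (shiftGens e₁),
      MonoidHom.inl (ShiftGroup e₁) (ShiftGroup e₂) s ∈
        genLetters (prodGenerators (shiftGens e₁) (shiftGens e₂)) := fun s hs =>
    mem_genLetters_prodGenerators.2 (Or.inl ⟨hs, rfl⟩)
  have hj₂ : ∀ s ∈ genLetters (shiftGens e₂),
      MonoidHom.inr (ShiftGroup e₁) (ShiftGroup e₂) s ∈
        genLetters (prodGenerators (shiftGens e₁) (shiftGens e₂)) := fun s hs =>
    mem_genLetters_prodGenerators.2 (Or.inr ⟨rfl, hs⟩)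
  have hU : ∀ N : ℕ, 1 ≤ N → ∃ V : Finset (ShiftGroup e₁ × ShiftGroup e₂), V.Nonempty ∧
      ((wordBoundary (prodGenerators (shiftGens e₁) (shiftGens e₂))
        (V : Set (ShiftGroup e₁ × ShiftGroup e₂))).ncard : ℝ) / V.card ≤ 1 / N ∧
      (V.card : ℝ) ≤ 16 * N ^ 2 * Real.exp ((8 * (d + 2) : ℕ) * N + τ N) := by
    intro N hN
    obtain ⟨V₁, hV₁, hbd₁, hcard₁⟩ := exists_folnerSet_levelFamily hQ ha haa hbb hmono hnonneg
      (act := fun l => act l ∧ A₁ l) (fun l h => hlev l h.1) hN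
    obtain ⟨V₂, hV₂, hbd₂, hcard₂⟩ := exists_folnerSet_levelFamily hQ ha haa hbb hmono hnonneg
      (act := fun l => act l ∧ A₂ l) (fun l h => hlev l h.1) hN
    have hN' : (1 : ℝ) ≤ N := by exact_mod_cast hN
    refine ⟨V₁ ×ˢ V₂, hV₁.product hV₂,
      (ncard_wordBoundary_product_le hV₁ hV₂ hbd₁ hbd₂).trans (le_of_eq ?_), ?_⟩
    · field_simp
      norm_num
    · rw [Finset.card_product]
      push_cast
      calc (V₁.card : ℝ) * V₂.card ≤ (4 * N * Real.exp (4 * (d + 2) * N + τ N / 2)) *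
            (4 * N * Real.exp (4 * (d + 2) * N + τ N / 2)) := by gcongr
        _ = 16 * N ^ 2 * (Real.exp (4 * (d + 2) * N + τ N / 2) *
            Real.exp (4 * (d + 2) * N + τ N / 2)) := by ring
        _ = _ := by rw [← Real.exp_add]; ring_nf
  refine exists_folnerEstimate hmono hτ (A := 40 * (d + 1) * (d + 2))
    (B := 40 * (d + 1) * (d + 2) * 2 ^ d) (K := 60 * (d + 1) * 4 ^ d) hU
    ⟨_, hj₁ _ (Or.inl (mem_shiftGens.2 (Or.inl rfl))), fun h =>
      lampIncl_lampElt_zero_ne_one ha (congrArg Prod.fst h)⟩ ?_ ?_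
  · intro N hN
    obtain ⟨V, hV, hbd, -⟩ := hU N hN
    exact two_rpow_lamps_le_folnerFunction ha (MonoidHom.fst _ _) (MonoidHom.inl _ _)
      (fun _ => rfl) hj₁ hN ⟨V, hV, hbd⟩
  · intro l N M hN hl hM
    refine (hlev' l N hN hl).imp_left fun ⟨hact, hnN, hB⟩ => ⟨_, two_pow_le_of_level hB, ?_⟩
    obtain ⟨V, hV, hbd, -⟩ := hU M (by omega)
    obtain ⟨h1, h2, -⟩ := hlev l hact
    have hM' := lt_of_le_of_lt (Nat.mul_le_mul_left _ hnN) hM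
    rcases hA l with h | h
    · exact two_rpow_level_le_folnerFunction hab (act := fun l => act l ∧ A₁ l) ⟨hact, h⟩
        (h1.trans h2) h2 (MonoidHom.fst _ _) (MonoidHom.inl _ _) (fun _ => rfl) hj₁ hM'
        ⟨V, hV, hbd⟩
    · exact two_rpow_level_le_folnerFunction hab (act := fun l => act l ∧ A₂ l) ⟨hact, h⟩
        (h1.trans h2) h2 (MonoidHom.snd _ _) (MonoidHom.inr _ _) (fun _ => rfl) hj₂ hM'
        ⟨V, hV, hbd⟩

end Families

end

section
open Filter

/-! ### Words in the lamp generators -/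

section LampWords

variable {I Q : Type} [Group Q] {e : I → ℤ → Q}

/-- The element of the lamp group that is represented by a list of indices. -/
def lampProd (e : I → ℤ → Q) (w : List ℤ) : lampGroup e := (w.map (lampElt e)).prod

theorem lampProd_apply (w : List ℤ) (ι : I) (ρ : ℤ) :
    (lampProd e w : I → ℤ → Q) ι ρ = (w.map fun i => e ι (i + ρ)).prod := by
  induction w with
  | nil => rfl
  | cons i w ih =>
    rw [List.map_cons, List.prod_cons, ← ih]
    rfl

theorem exists_lampProd_eq (he : ∀ ι i, e ι i * e ι i = 1) (h : lampGroup e) :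
    ∃ w, lampProd e w = h := by
  have key : ∀ f (hf : f ∈ lampGroup e), ∃ w, lampProd e w = ⟨f, hf⟩ := by
    intro f hf
    induction hf using Subgroup.closure_induction with
    | mem x hx =>
      obtain ⟨i, rfl⟩ := hx
      exact ⟨[i], by simp [lampProd, lampElt]⟩
    | one => exact ⟨[], rfl⟩
    | mul x y hx hy h1 h2 =>
      obtain ⟨w, hw⟩ := h1
      obtain ⟨w', hw'⟩ := h2
      refine ⟨w ++ w', ?_⟩
      rw [lampProd, List.map_append, List.prod_append, ← lampProd, ← lampProd, hw, hw']
      rfl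
    | inv x hx h1 =>
      obtain ⟨w, hw⟩ := h1
      refine ⟨w.reverse, ?_⟩
      have h2 : lampProd e w.reverse = (lampProd e w)⁻¹ := by
        rw [lampProd, lampProd, List.prod_inv_reverse, List.map_map, List.map_reverse]
        congr 3
        funext i
        exact (lampElt_inv he i).symm
      rw [h2, hw]
      rfl
  exact key h h.2

theorem lampProd_mem_lampSubgroup {A : Set ℤ} {w : List ℤ} (hw : ∀ i ∈ w, i ∈ A) :
    (lampProd e w : I → ℤ → Q) ∈ lampSubgroup e A := by
  induction w with
  | nil => exact one_mem _
  | cons i w ih =>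
    have h1 : (lampProd e (i :: w) : I → ℤ → Q) = lampGen e i * (lampProd e w : I → ℤ → Q) := by
      rw [lampProd, List.map_cons, List.prod_cons]
      rfl
    rw [h1]
    exact mul_mem (lampGen_mem_lampSubgroup e (hw i List.mem_cons_self))
      (ih fun j hj => hw j (List.mem_cons_of_mem _ hj))

theorem hasWord_lampProd (w : List ℤ) :
    HasWord (shiftGens e) (w.map fun i => 2 * i.natAbs + 1).sum (lampIncl e (lampProd e w)) := by
  induction w with
  | nil => simpa [lampProd] using HasWord.one (shiftGens e)
  | cons i w ih =>
    have := (hasWord_lampElt (e := e) i).mul ih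
    rw [← map_mul] at this
    rw [List.map_cons, List.sum_cons]
    exact this

end LampWords

/-! ### Caution from gaps between the scales -/

section Cautious

variable {d : ℕ} {Q : Type} [Group Q] {a b : Q} {act : ℕ → Prop} {n m : ℕ → ℕ}

/-- The elements that are only visible on the first `k` levels are short, uniformly over all
choices of a sparse set of active levels. -/
theorem exists_hasWord_bound [Finite Q] (ha : a ≠ 1) (haa : a * a = 1) (hbb : b * b = 1)
    (hlev : ∀ l, act l → 1 ≤ n l ∧ m l ≤ n l) (k : ℕ) :
    ∃ D : ℕ, ∀ A : ℕ → Prop, (∀ l, k ≤ l → act l → A l → D ≤ n l) →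
      ∀ h : lampGroup (levelFamily (d := d) a b (fun l => act l ∧ A l) n m),
        (∀ r, (h : Option (ℕ × (Fin d → ℕ)) → ℤ → Q) none r = 1) →
        (∀ l, k ≤ l → ∀ v r, (h : Option (ℕ × (Fin d → ℕ)) → ℤ → Q) (some (l, v)) r = 1) →
        HasWord (shiftGens (levelFamily (d := d) a b (fun l => act l ∧ A l) n m)) D
          (lampIncl _ h) := by
  classical
  let e := levelFamily (d := d) a b act n m
  let T : Finset (Option (ℕ × (Fin d → ℕ)) × ℤ) := (Finset.range k).biUnion fun l =>
    ((Fintype.piFinset fun _ : Fin d => Finset.range (m l)) ×ˢ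
      Finset.range (levelPeriod d (n l))).image fun y => (some (l, y.1), (y.2 : ℤ))
  let σ : List ℤ → T → Q := fun w j =>
    (lampProd e w : Option (ℕ × (Fin d → ℕ)) → ℤ → Q) j.1.1 j.1.2
  let len : List ℤ → ℕ := fun w => (w.map fun i => 2 * i.natAbs + 1).sum
  let triv : List ℤ → Prop := fun w =>
    ∀ r, (lampProd e w : Option (ℕ × (Fin d → ℕ)) → ℤ → Q) none r = 1
  -- Only finitely many configurations occur on the coordinates in `T`. For each realisable one a
  -- word with trivial lamps is fixed, in the family with all levels, so that the maximal length
  -- does not depend on `A`.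
  have hchoice : ∀ x : T → Q, ∃ D, ∀ w, triv w → σ w = x →
      ∃ w', triv w' ∧ σ w' = x ∧ len w' ≤ D := by
    intro x
    by_cases hx : ∃ w, triv w ∧ σ w = x
    · obtain ⟨w, h1, h2⟩ := hx
      exact ⟨len w, fun _ _ _ => ⟨w, h1, h2, le_rfl⟩⟩
    · push Not at hx
      exact ⟨0, fun w h1 h2 => absurd h2 (hx w h1)⟩
  choose D hD using hchoice
  have := Fintype.ofFinite (T → Q)
  refine ⟨Finset.univ.sup D, fun A hA h hh hk => ?_⟩
  let eA := levelFamily (d := d) a b (fun l => act l ∧ A l) n m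
  have heA : ∀ ι i, eA ι i * eA ι i = 1 := levelFamily_mul_self haa hbb
  obtain ⟨w, rfl⟩ := exists_lampProd_eq heA h
  have hnone : ∀ w r, (lampProd e w : Option (ℕ × (Fin d → ℕ)) → ℤ → Q) none r =
      (lampProd eA w : Option (ℕ × (Fin d → ℕ)) → ℤ → Q) none r := fun w r => by
    rw [lampProd_apply, lampProd_apply]
    rfl
  obtain ⟨w', h1, h2, h3⟩ := hD (σ w) w (fun r => (hnone w r).trans (hh r)) rfl
  have hlen : len w' ≤ Finset.univ.sup D := h3.trans (Finset.le_sup (Finset.mem_univ _))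
  have hwin : ∀ i ∈ w', i ∈ Set.Icc (-(Finset.univ.sup D : ℕ) : ℤ) (Finset.univ.sup D : ℕ) := by
    intro i hi
    have : 2 * i.natAbs + 1 ≤ len w' :=
      List.single_le_sum (fun _ _ => Nat.zero_le _) _ (List.mem_map.2 ⟨i, hi, rfl⟩)
    constructor <;> omega
  have heq : lampProd eA w = lampProd eA w' := by
    apply Subtype.ext
    funext ι ρ
    rcases ι with _ | ⟨l, v⟩
    · rw [hh, ← hnone, h1]
    · by_cases hl : k ≤ l
      · rw [hk l hl]
        symm
        -- The chosen word uses only indices in `[-D, D]`, a window too short for the active levels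
        -- from `k` on; hence it is trivial there, like the element it replaces.
        refine lampSubgroup_apply_eq_one ha haa hbb (fun h => hlev l h.1) (fun h i hi j hj => ?_)
          (lampProd_mem_lampSubgroup hwin) (fun i _ => by rw [← hnone, h1]) v ρ
        have h4 := hA l hl h.1 h.2
        have h5 := (hlev l h.1).1
        have := hi.1; have := hi.2; have := hj.1; have := hj.2
        rw [abs_lt]
        constructor <;> omega
      · by_cases hact : (act l ∧ A l) ∧ ∀ s, v s < m l
        · have hact' : act l ∧ ∀ s, v s < m l := ⟨hact.1.1, hact.2⟩
          have hsome : ∀ w r,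
              (lampProd e w : Option (ℕ × (Fin d → ℕ)) → ℤ → Q) (some (l, v)) r =
              (lampProd eA w : Option (ℕ × (Fin d → ℕ)) → ℤ → Q) (some (l, v)) r := fun w r => by
            rw [lampProd_apply, lampProd_apply]
            congr 2
            funext i
            exact (levelFamily_some hact' _).trans
              (levelFamily_some (act := fun l => act l ∧ A l) hact _).symm
          have hp : 0 < levelPeriod d (n l) := by
            have := (hlev l hact.1.1).1
            unfold levelPeriod
            exact Nat.mul_pos (by omega) (by omega)
          have h0 := Int.emod_nonneg ρ (b := levelPeriod d (n l)) (by omega)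
          have h1 := Int.emod_lt_of_pos ρ (b := levelPeriod d (n l)) (by omega)
          have hmem : ((some (l, v), ρ % levelPeriod d (n l)) :
              Option (ℕ × (Fin d → ℕ)) × ℤ) ∈ T := by
            refine Finset.mem_biUnion.2 ⟨l, Finset.mem_range.2 (by omega), Finset.mem_image.2
                ⟨(v, (ρ % levelPeriod d (n l)).toNat), Finset.mem_product.2 ⟨?_, ?_⟩, ?_⟩⟩
            · exact Fintype.mem_piFinset.2 fun s => Finset.mem_range.2 (hact.2 s)
            · rw [Finset.mem_range]; omega
            · rw [Int.toNat_of_nonneg h0]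
          have h4 := congrFun h2 ⟨_, hmem⟩
          change (lampProd e w' : Option (ℕ × (Fin d → ℕ)) → ℤ → Q) (some (l, v))
              (ρ % levelPeriod d (n l)) =
            (lampProd e w : Option (ℕ × (Fin d → ℕ)) → ℤ → Q) (some (l, v))
              (ρ % levelPeriod d (n l)) at h4
          rw [lampGroup_apply_emod (lampProd e w').2, lampGroup_apply_emod (lampProd e w).2] at h4
          rw [← hsome, ← hsome, h4]
        · have hz : ∀ u : lampGroup eA, (u : Option (ℕ × (Fin d → ℕ)) → ℤ → Q) (some (l, v)) ρ = 1 :=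
            fun u => lampGroup_apply_eq_one_of_not (A := Set.univ)
              (by rw [lampSubgroup, Set.image_univ]; exact u.2) hact ρ
          rw [hz, hz]
  change HasWord _ _ (lampIncl eA (lampProd eA w))
  rw [heq]
  exact (hasWord_lampProd w').mono hlen

/-- Simple random walk is cautious when there are large gaps between the active levels. -/
theorem isCautious_levelFamily (ha : a ≠ 1) (haa : a * a = 1) (hbb : b * b = 1)
    (hlev : ∀ l, act l → 1 ≤ n l ∧ m l ≤ n l) {A : ℕ → Prop} {D : ℕ → ℕ}
    (hD : ∀ k, (∀ l, k ≤ l → act l → A l → D k ≤ n l) →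
      ∀ h : lampGroup (levelFamily (d := d) a b (fun l => act l ∧ A l) n m),
        (∀ r, (h : Option (ℕ × (Fin d → ℕ)) → ℤ → Q) none r = 1) →
        (∀ l, k ≤ l → ∀ v r, (h : Option (ℕ × (Fin d → ℕ)) → ℤ → Q) (some (l, v)) r = 1) →
        HasWord (shiftGens (levelFamily (d := d) a b (fun l => act l ∧ A l) n m)) (D k)
          (lampIncl _ h))
    (hgap : ∀ J, ∃ k, J ≤ k ∧ ∀ l, k ≤ l → act l → A l → (k + 1) * (D k + 3) ≤ n l) :
    IsCautious (shiftGens (levelFamily (d := d) a b (fun l => act l ∧ A l) n m)) := by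
  refine isCautious_of_wordLength_le (levelFamily_mul_self haa hbb) fun c hc => ?_
  -- At time `s ^ 2` with `s = (k + 1) * (D k + 3)`, the radius `R ≤ c * s / 14` makes the sweep
  -- cost `7 * R` at most `c * s / 2`, and `k ≥ 2 / c` does the same for `D k + 3`. The gap
  -- condition `s ≤ n l` hides the levels from `k` on.
  refine ⟨min (c / 14) 1, lt_min (by positivity) one_pos, frequently_atTop.2 fun N₀ => ?_⟩
  obtain ⟨k, hk, hgapk⟩ := hgap (max N₀ ⌈2 / c⌉₊)
  set s := (k + 1) * (D k + 3) with hs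
  have hsk : k + 1 ≤ s := Nat.le_mul_of_pos_right _ (by omega)
  have hsD : D k + 3 ≤ s := Nat.le_mul_of_pos_left _ (by omega)
  have hN₀ : N₀ ≤ k := (le_max_left _ _).trans hk
  have hck : 2 / c ≤ k := (Nat.le_ceil _).trans (by exact_mod_cast (le_max_right _ _).trans hk)
  have hsq : Real.sqrt ((s ^ 2 : ℕ) : ℝ) = s := by
    rw [Nat.cast_pow, Real.sqrt_sq (Nat.cast_nonneg s)]
  have hs0 : (0 : ℝ) ≤ s := Nat.cast_nonneg s
  refine ⟨s ^ 2, by nlinarith, ⌊min (c / 14) 1 * s⌋₊, ?_, ?_⟩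
  · rw [hsq]
    exact (Nat.lt_floor_add_one _).le
  · rw [hsq]
    set R := ⌊min (c / 14) 1 * (s : ℝ)⌋₊ with hR
    have hR1 : (R : ℝ) ≤ min (c / 14) 1 * s := Nat.floor_le (by positivity)
    have hRs : R ≤ s := by
      have : (R : ℝ) ≤ s := hR1.trans (mul_le_of_le_one_left hs0 (min_le_right _ _))
      exact_mod_cast this
    have hRc : (R : ℝ) ≤ c / 14 * s :=
      hR1.trans (mul_le_mul_of_nonneg_right (min_le_left _ _) hs0)
    intro g hg hpos
    have hword := hasWord_of_window (o := none) (D := D k) haa levelFamily_none ?_ g hg hpos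
    · have h1 : (wordLength (shiftGens (levelFamily (d := d) a b (fun l => act l ∧ A l) n m)) g : ℝ)
          ≤ 7 * R + 3 + D k := by exact_mod_cast hword.wordLength_le
      have h2 : ((D k : ℝ) + 3) ≤ c / 2 * s := by
        rw [div_le_iff₀ hc] at hck
        rw [hs]
        push_cast
        nlinarith [(Nat.cast_nonneg (D k) : (0 : ℝ) ≤ D k)]
      linarith
    · intro u hu hnone
      refine hD k (fun l hl h1 h2 => by have := hgapk l hl h1 h2; omega) u hnone
        fun l hl v r => ?_
      refine lampSubgroup_apply_eq_one ha haa hbb (fun h => hlev l h.1) (fun h i hi j hj => ?_)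
        hu (fun i _ => hnone _) v r
      have h4 := hgapk l hl h.1 h.2
      have := hi.1; have := hi.2; have := hj.1; have := hj.2
      rw [abs_lt]
      constructor <;> omega

/-- The levels can be distributed over two sets, each of which has large gaps. -/
theorem exists_alternating_levels (Ψ : ℕ → ℕ)
    (hlarge : ∀ x, ∃ K, ∀ l, K ≤ l → act l → x ≤ n l) :
    ∃ A₁ A₂ : ℕ → Prop, (∀ l, A₁ l ∨ A₂ l) ∧
      (∀ J, ∃ k, J ≤ k ∧ ∀ l, k ≤ l → act l → A₁ l → Ψ k ≤ n l) ∧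
      (∀ J, ∃ k, J ≤ k ∧ ∀ l, k ≤ l → act l → A₂ l → Ψ k ≤ n l) := by
  choose K hK using hlarge
  -- From level `κ (j + 1)` on, all active scales exceed `Ψ (κ j)`. Even blocks of levels go to
  -- `A₁`, odd ones to `A₂`.
  let κ : ℕ → ℕ := fun j => Nat.rec (motive := fun _ => ℕ) 0 (fun _ k => max (k + 1) (K (Ψ k))) j
  have hκ0 : κ 0 = 0 := rfl
  have hκs : ∀ j, κ (j + 1) = max (κ j + 1) (K (Ψ (κ j))) := fun _ => rfl
  have hκ : StrictMono κ := strictMono_nat_of_lt_succ fun j => by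
    rw [hκs]; exact lt_max_of_lt_left (Nat.lt_succ_self _)
  have hstep : ∀ j l, κ (j + 1) ≤ l → act l → Ψ (κ j) ≤ n l := fun j l hl =>
    hK _ l ((le_max_right _ _).trans ((hκs j).symm.le.trans hl))
  refine ⟨fun l => ∃ i, κ (2 * i) ≤ l ∧ l < κ (2 * i + 1),
    fun l => ∃ i, κ (2 * i + 1) ≤ l ∧ l < κ (2 * i + 2), fun l => ?_, fun J => ?_, fun J => ?_⟩
  · obtain ⟨j, h1, h2⟩ : ∃ j, κ j ≤ l ∧ l < κ (j + 1) := by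
      induction l with
      | zero => exact ⟨0, le_rfl, by rw [hκs, hκ0]; exact lt_max_of_lt_left Nat.one_pos⟩
      | succ l ih =>
        obtain ⟨j, h1, h2⟩ := ih
        by_cases h : l + 1 < κ (j + 1)
        · exact ⟨j, by omega, h⟩
        · exact ⟨j + 1, by omega, lt_of_le_of_lt h2 (hκ (show j + 1 < j + 1 + 1 by omega))⟩
    rcases Nat.even_or_odd' j with ⟨i, rfl | rfl⟩
    · exact Or.inl ⟨i, h1, h2⟩
    · exact Or.inr ⟨i, h1, h2⟩
  -- At the beginning of a block belonging to the other set, the next level of this set lies beyond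
  -- the whole block.
  · refine ⟨κ (2 * J + 1), (by omega : J ≤ 2 * J + 1).trans hκ.le_apply, ?_⟩
    rintro l hl hact ⟨i, h1, h2⟩
    have h3 : 2 * J + 1 < 2 * i + 1 := hκ.lt_iff_lt.1 (hl.trans_lt h2)
    exact hstep (2 * J + 1) l ((hκ.monotone (show 2 * J + 1 + 1 ≤ 2 * i by omega)).trans h1) hact
  · refine ⟨κ (2 * J), (by omega : J ≤ 2 * J).trans hκ.le_apply, ?_⟩
    rintro l hl hact ⟨i, h1, h2⟩
    have h3 : 2 * J < 2 * i + 2 := hκ.lt_iff_lt.1 (hl.trans_lt h2)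
    exact hstep (2 * J) l ((hκ.monotone (show 2 * J + 1 ≤ 2 * i + 1 by omega)).trans h1) hact

end Cautious

end

/-! ### The main theorem -/

theorem mainTheorem5 (c : ℕ) (hc : 1 ≤ c) (τ : ℕ → ℝ) (hmono : Monotone τ)
    (hnonneg : ∀ n : ℕ, 0 ≤ τ n) (hbound : ∀ n : ℕ, 1 ≤ n → τ n ≤ (n : ℝ) ^ c) :
    (∃ (N : Type) (_ : Group N) (φ : Multiplicative ℤ →* MulAut N)
      (S : Finset (N ⋊[φ] Multiplicative ℤ)) (C : ℝ),
      NilpotentOfClassAtMost N c ∧ Generates S ∧ 1 < C ∧ FolnerEstimate S τ C) ∧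
    (∃ (N₁ : Type) (_ : Group N₁) (φ₁ : Multiplicative ℤ →* MulAut N₁)
      (N₂ : Type) (_ : Group N₂) (φ₂ : Multiplicative ℤ →* MulAut N₂)
      (S₁ : Finset (N₁ ⋊[φ₁] Multiplicative ℤ)) (S₂ : Finset (N₂ ⋊[φ₂] Multiplicative ℤ))
      (C : ℝ),
      NilpotentOfClassAtMost N₁ c ∧ NilpotentOfClassAtMost N₂ c ∧
      Generates S₁ ∧ Generates S₂ ∧ IsCautious S₁ ∧ IsCautious S₂ ∧
      1 < C ∧ FolnerEstimate (prodGenerators S₁ S₂) τ C) ∧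
    (∀ (G₁ : Type) [Group G₁] (G₂ : Type) [Group G₂] (S₁ : Finset G₁) (S₂ : Finset G₂),
      Generates S₁ → Generates S₂ → IsCautious S₁ → IsCautious S₂ →
      PropertyHFD.{u} G₁ ∧ PropertyHFD.{u} G₂ ∧ PropertyHFD.{u} (G₁ × G₂)) := by
  obtain ⟨d, rfl⟩ : ∃ d, c = d + 1 := ⟨c - 1, by omega⟩
  have hτ : τ 1 ≤ 1 := by simpa using hbound 1 le_rfl
  obtain ⟨Q, hgroup, a, b, hQ, haa, hbb, hclass, hab⟩ := exists_group_with_commutator d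
  obtain ⟨act, n, m, hlev, hlev'⟩ := exists_levels hbound
    (A := 40 * (d + 1) * (d + 2)) (Nat.mul_pos (by omega) (by omega))
  have ha := ne_one_of_commutator_foldl_ne_one hab
  have hfin : Finite Q := Nat.finite_of_card_ne_zero (by rw [hQ]; positivity)
  have hn : ∀ l, act l → 1 ≤ n l ∧ m l ≤ n l := fun l h =>
    ⟨(hlev l h).1.trans (hlev l h).2.1, (hlev l h).2.1⟩
  -- The growth bound makes the scales tend to infinity: `2 ^ l ≤ n l ^ (d + 1)`.
  have hlarge : ∀ x, ∃ K, ∀ l, K ≤ l → act l → x ≤ n l := by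
    refine fun x => ⟨x ^ (d + 1), fun l hl hact => ?_⟩
    by_contra hcon
    have h1 : (2 : ℝ) ^ l ≤ (n l : ℝ) ^ (d + 1) :=
      (hlev l hact).2.2.2.trans (hbound _ (hn l hact).1)
    have h2 : 2 ^ l ≤ n l ^ (d + 1) := by exact_mod_cast h1
    have h3 : n l ^ (d + 1) ≤ x ^ (d + 1) := Nat.pow_le_pow_left (by omega) _
    have h4 : l < 2 ^ l := Nat.lt_two_pow_self
    omega
  -- The bound `D` is fixed before the levels are distributed: the gaps required of `A₁` and `A₂`
  -- depend on `D`, which is possible because `D` is uniform over all distributions.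
  choose D hD using exists_hasWord_bound (d := d) ha haa hbb hn
  obtain ⟨A₁, A₂, hA, hA₁, hA₂⟩ :=
    exists_alternating_levels (fun k => (k + 1) * (D k + 3)) hlarge
  obtain ⟨C, hC, hfol⟩ :=
    exists_folnerEstimate_levelFamily hQ haa hbb hab hmono hnonneg hτ hlev hlev'
  obtain ⟨C', hC', hfol'⟩ :=
    exists_folnerEstimate_prod hQ haa hbb hab hmono hnonneg hτ hlev hlev' hA
  refine ⟨⟨lampGroup _, inferInstance, lampShift _, shiftGens _, C,
      nilpotentOfClassAtMost_lampGroup hclass _, generates_shiftGens _, hC, hfol⟩,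
    ⟨lampGroup _, inferInstance, lampShift _, lampGroup _, inferInstance, lampShift _,
      shiftGens _, shiftGens _, C', nilpotentOfClassAtMost_lampGroup hclass _,
      nilpotentOfClassAtMost_lampGroup hclass _, generates_shiftGens _, generates_shiftGens _,
      isCautious_levelFamily ha haa hbb hn (fun k => hD k A₁) hA₁,
      isCautious_levelFamily ha haa hbb hn (fun k => hD k A₂) hA₂, hC', hfol'⟩, ?_⟩
  intro G₁ _ G₂ _ S₁ S₂ hS₁ hS₂ hc₁ hc₂
  exact ⟨hc₁.propertyHFD hS₁, hc₂.propertyHFD hS₂, propertyHFD_prod hS₁ hS₂ hc₁ hc₂⟩
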